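/- Let $J^1$ have coordinates $(x,y,z,p,q)$, contact form $U=dz-p\,dx-q\,dy$ and contact distribution $\mathcal C=\{U=0\}$; let $\partial_x,\dots,\partial_q$ be the coordinate vector fields, $\widehat\partial_x=\partial_x+p\,\partial_z$, $\widehat\partial_y=\partial_y+q\,\partial_z$. Everything is $C^\infty$. For a 2-form $\omega$ on an open set $\Omega\subseteq J^1$ the Monge–Ampère equation $\mathcal E_\omega\subset J^2$ is the set of 2-jets $(x,y,z,p,q,r,s,t)$ over $\Omega$ such that $\omega$ vanishes on the R-plane $\langle\widehat\partial_x+r\partial_p+s\partial_q,\ \widehat\partial_y+s\partial_p+t\partial_q\rangle$. Assume that $\mathcal E_\omega$ is parabolic: at every point of $\Omega$ the restriction $\omega|_{\mathcal C}$ is not a multiple of $dU|_{\mathcal C}$, and there is exactly one $\lambda\in\mathbb R$ for which $(\omega+\lambda\,dU)|_{\mathcal C}$ is degenerate. Let $\mathcal D\subset\mathcal C$, the characteristic distribution, be the radical of this degenerate form, and suppose $\mathcal D=\langle X,Y\rangle$ with vector fields $X,Y$ on $\Omega$. For a vector field $Z\in\mathcal C$ let $Z(\alpha)$ denote the Lie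 derivative of a form $\alpha$; $Z$ is of type $k$ if $U,Z(U),Z^2(U),Z^3(U)$ have constant rank $k$. For a function $f$ let $X_f\in\mathcal C$ be the field with $X_f\lrcorner\, dU=df-f_zU$, and put $Z_f=Y(f)X-X(f)Y$. A 2-dimensional distribution is integrable if it is tangent to a foliation; a distribution $\widehat{\mathcal D}\subset\mathcal C$ is lagrangian if it equals its orthogonal complement in $\mathcal C$ with respect to $dU$. A complete integral of $\mathcal E_\omega$ is an integrable 2-dimensional distribution $\widehat{\mathcal D}\subset\mathcal C$ with $\omega|_{\widehat{\mathcal D}}=0$. A generalized intermediate integral is a nowhere vanishing field in the characteristic distribution of type less than $4$. A contact chart is a diffeomorphism between open subsets of $J^1$ that preserves $\mathcal C$. **Theorem.** For a point $\theta_0\in\Omega$ consider the following properties, each required on some open neighbourhood $V\subseteq\Omega$ of $\theta_0$: 1. there is a complete integral of $\mathcal E_\omega$; 2. there is a generalized intermediate integral; 3. there is a nowhere vanishing field $Z\in\langle X,Y\rangle$ of type less than $4$; 4. there is a nowhere vanishing field $Z\in\langle X,Y\rangle$ that is contained in an integrable lagrangian distribution; 5. there is an integrable lagrangian distribution $\widehat{\mathcal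 D}$ which in some contact chart on $V$ consists of the R-planes of a section $J^1\to J^2$ whose graph is contained in the equation $\mathcal E_\omega$ (written in that chart); 6. there is a function $f$ with $X_f$ nowhere zero such that $dU(Z_f,[Z_f,X_f])=0$. Then there is a dense open subset $\Omega'\subseteq\Omega$ such that, for every $\theta_0\in\Omega'$, the six properties are equivalent. Moreover, at every $\theta_0\in\Omega$, $2\Leftrightarrow3\Rightarrow4\Rightarrow1\Leftrightarrow5$ and $1\Rightarrow6$. -/

import Mathlib

open scoped ContDiff

namespace ParabolicMAE

/-! ### The first jet space and its contact structure -/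

/-- The space `J¹(τ)` of 1-jets of functions `z = z(x, y)`, with its standard contact coordinates:
the components `0, 1, 2, 3, 4` are `x, y, z, p = z_x, q = z_y`. -/
abbrev J1 : Type := Fin 5 → ℝ

/-- Differential 1-forms on `J¹(τ)`. -/
abbrev OneForm : Type := J1 → J1 →L[ℝ] ℝ

/-- Differential 2-forms on `J¹(τ)`. -/
abbrev TwoForm : Type := J1 → J1 [⋀^Fin 2]→L[ℝ] ℝ

/-- The exterior derivative of a 1-form: `dα(v, w) = (D_v α)(w) - (D_w α)(v)`. -/
noncomputable def extDerivOne (α : OneForm) (θ v w : J1) : ℝ :=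
  fderiv ℝ α θ v w - fderiv ℝ α θ w v

/-- The Lie derivative `X(α) = L_X α` of a 1-form along a vector field:
`(L_X α)(v) = (D_X α)(v) + α(D_v X)`. -/
noncomputable def lieDerivOne (X : J1 → J1) (α : OneForm) : OneForm := fun θ =>
  fderiv ℝ α θ (X θ) + (α θ).comp (fderiv ℝ X θ)

/-- The contact form `U = dz - p dx - q dy`. -/
noncomputable def contactForm : OneForm := fun θ =>
  ContinuousLinearMap.proj (R := ℝ) (φ := fun _ : Fin 5 => ℝ) 2
    - θ 3 • ContinuousLinearMap.proj (R := ℝ) (φ := fun _ : Fin 5 => ℝ) 0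
    - θ 4 • ContinuousLinearMap.proj (R := ℝ) (φ := fun _ : Fin 5 => ℝ) 1

/-- The 2-form `dU`. -/
noncomputable def dU (θ v w : J1) : ℝ := extDerivOne contactForm θ v w

/-- The contact distribution `𝒞 = {U = 0}`. -/
noncomputable def contactPlane (θ : J1) : Submodule ℝ J1 :=
  LinearMap.ker (contactForm θ : J1 →ₗ[ℝ] ℝ)

theorem contactForm_apply (θ v : J1) :
    contactForm θ v = v 2 - θ 3 * v 0 - θ 4 * v 1 := by
  simp [contactForm]

theorem hasFDerivAt_contactForm (θ : J1) :
    HasFDerivAt contactForm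
      (-((ContinuousLinearMap.proj (R := ℝ) (φ := fun _ : Fin 5 => ℝ) 3).smulRight
          (ContinuousLinearMap.proj (R := ℝ) (φ := fun _ : Fin 5 => ℝ) 0))
        - (ContinuousLinearMap.proj (R := ℝ) (φ := fun _ : Fin 5 => ℝ) 4).smulRight
          (ContinuousLinearMap.proj (R := ℝ) (φ := fun _ : Fin 5 => ℝ) 1)) θ := by
  have h3 := ((ContinuousLinearMap.proj (R := ℝ) (φ := fun _ : Fin 5 => ℝ) 3).hasFDerivAt
    (x := θ)).smul_const (ContinuousLinearMap.proj (R := ℝ) (φ := fun _ : Fin 5 => ℝ) 0)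
  have h4 := ((ContinuousLinearMap.proj (R := ℝ) (φ := fun _ : Fin 5 => ℝ) 4).hasFDerivAt
    (x := θ)).smul_const (ContinuousLinearMap.proj (R := ℝ) (φ := fun _ : Fin 5 => ℝ) 1)
  have h := (h3.const_sub
    (ContinuousLinearMap.proj (R := ℝ) (φ := fun _ : Fin 5 => ℝ) 2)).sub h4
  exact h

/-- In coordinates `dU = dx ∧ dp + dy ∧ dq`. -/
theorem dU_apply (θ v w : J1) :
    dU θ v w = v 0 * w 3 - v 3 * w 0 + (v 1 * w 4 - v 4 * w 1) := by
  rw [dU, extDerivOne, (hasFDerivAt_contactForm θ).fderiv]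
  simp
  ring

/-- The orthogonal complement in `𝒞_θ`, with respect to `dU`, of a space of tangent vectors. -/
noncomputable def orthogonal (θ : J1) (E : Submodule ℝ J1) : Submodule ℝ J1 where
  carrier := {v | v ∈ contactPlane θ ∧ ∀ w ∈ E, dU θ v w = 0}
  zero_mem' := ⟨Submodule.zero_mem _, fun w _ => by simp [dU_apply]⟩
  add_mem' := fun {a b} ha hb => ⟨Submodule.add_mem _ ha.1 hb.1, fun w hw => by
    have h1 := ha.2 w hw
    have h2 := hb.2 w hw
    simp only [dU_apply, Pi.add_apply] at h1 h2 ⊢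
    linarith⟩
  smul_mem' := fun c a ha => ⟨Submodule.smul_mem _ c ha.1, fun w hw => by
    have h1 := ha.2 w hw
    simp only [dU_apply, Pi.smul_apply, smul_eq_mul] at h1 ⊢
    linear_combination c * h1⟩

/-- `E` is a lagrangian distribution over `V`: `E = E^⊥` (in particular `E ⊆ 𝒞`). -/
def IsLagrangianOn (E : J1 → Submodule ℝ J1) (V : Set J1) : Prop :=
  ∀ θ ∈ V, E θ = orthogonal θ (E θ)

/-- `E` is an integrable 2-dimensional distribution over `V`, that is, the tangent distribution
of a 2-dimensional smooth foliation: around every point of `V` the leaves are the level sets of a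
smooth submersion `F` to `ℝ³`. -/
def IsIntegrableOn (E : J1 → Submodule ℝ J1) (V : Set J1) : Prop :=
  ∀ θ ∈ V, ∃ W : Set J1, IsOpen W ∧ θ ∈ W ∧ W ⊆ V ∧ ∃ F : J1 → (Fin 3 → ℝ),
    ContDiffOn ℝ ∞ F W ∧ ∀ η ∈ W, Function.Surjective (fderiv ℝ F η) ∧
      E η = LinearMap.ker (fderiv ℝ F η : J1 →ₗ[ℝ] (Fin 3 → ℝ))

/-! ### Parabolic Monge-Ampère equations -/

/-- The radical of the restriction of `ρ + lam • dU` to the contact space at `θ`. -/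
noncomputable def radical (ρ : TwoForm) (lam : ℝ) (θ : J1) : Submodule ℝ J1 where
  carrier := {v | v ∈ contactPlane θ ∧
    ∀ w ∈ contactPlane θ, ρ θ ![v, w] + lam * dU θ v w = 0}
  zero_mem' := ⟨Submodule.zero_mem _, fun w _ => by
    rw [(ρ θ).map_coord_zero (m := ![0, w]) 0 rfl]
    simp [dU_apply]⟩
  add_mem' := fun {a b} ha hb => ⟨Submodule.add_mem _ ha.1 hb.1, fun w hw => by
    have h1 := ha.2 w hw
    have h2 := hb.2 w hw
    have h3 : ρ θ ![a + b, w] = ρ θ ![a, w] + ρ θ ![b, w] := (ρ θ).vecCons_add ![w] a b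
    rw [h3]
    simp only [dU_apply, Pi.add_apply] at h1 h2 ⊢
    linear_combination h1 + h2⟩
  smul_mem' := fun c a ha => ⟨Submodule.smul_mem _ c ha.1, fun w hw => by
    have h1 := ha.2 w hw
    have h3 : ρ θ ![c • a, w] = c * ρ θ ![a, w] := (ρ θ).vecCons_smul ![w] c a
    rw [h3]
    simp only [dU_apply, Pi.smul_apply, smul_eq_mul] at h1 ⊢
    linear_combination c * h1⟩

/-- The Monge-Ampère equation defined by `ρ` is parabolic at `θ`: `ρ` does not belong at `θ` to
the differential ideal generated by `U` (its restriction to `𝒞_θ` is not a multiple of that of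
`dU`), and exactly one of the forms `ρ + lam • dU` is degenerate on `𝒞_θ`. -/
def IsParabolicAt (ρ : TwoForm) (θ : J1) : Prop :=
  (¬ ∃ μ : ℝ, ∀ v ∈ contactPlane θ, ∀ w ∈ contactPlane θ, ρ θ ![v, w] = μ * dU θ v w) ∧
  ∃! lam : ℝ, radical ρ lam θ ≠ ⊥

/-- The characteristic distribution. In the parabolic case all radicals but one are zero, and
the supremum is the radical of the degenerate representative `ρ + lam • dU` of the equation. -/
noncomputable def characteristicDistribution (ρ : TwoForm) (θ : J1) : Submodule ℝ J1 :=
  ⨆ lam : ℝ, radical ρ lam θ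

/-- The space `J²(τ)` of 2-jets; components `0, …, 7` are `x, y, z, p, q, r, s, t`. -/
abbrev J2 : Type := Fin 8 → ℝ

/-- The projection `τ_{2,1} : J²(τ) → J¹(τ)`. -/
def proj21 (η : J2) : J1 := ![η 0, η 1, η 2, η 3, η 4]

/-- The R-plane in `T J¹(τ)` of a 2-jet, spanned by
`∂_x + p ∂_z + r ∂_p + s ∂_q` and `∂_y + q ∂_z + s ∂_p + t ∂_q`. -/
noncomputable def rPlane (η : J2) : Submodule ℝ J1 :=
  Submodule.span ℝ {![1, 0, η 3, η 5, η 6], ![0, 1, η 4, η 6, η 7]}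

/-- The Monge-Ampère equation `ℰ_ρ ⊆ J²(τ)`: the 2-jets on whose R-plane `ρ` vanishes. -/
def equation (ρ : TwoForm) : Set J2 :=
  {η | ∀ v ∈ rPlane η, ∀ w ∈ rPlane η, ρ (proj21 η) ![v, w] = 0}

/-! ### Cartan fields -/

/-- The Cartan field `Z` has type `k` over `V`: at every point of `V` the 1-forms
`U, Z(U), Z²(U), Z³(U)` have rank `k`. -/
def HasTypeOn (Z : J1 → J1) (V : Set J1) (k : ℕ) : Prop :=
  ∀ θ ∈ V, Module.finrank ℝ (Submodule.span ℝ
    (Set.range fun j : Fin 4 => ((lieDerivOne Z)^[(j : ℕ)] contactForm) θ)) = k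

/-- `Z` is a smooth nowhere vanishing section over `V` of the distribution `E`. -/
def IsFieldIn (Z : J1 → J1) (E : J1 → Submodule ℝ J1) (V : Set J1) : Prop :=
  ContDiffOn ℝ ∞ Z V ∧ ∀ θ ∈ V, Z θ ≠ 0 ∧ Z θ ∈ E θ

/-- `∂_i f`, the derivative in the direction of the `i`-th coordinate. -/
noncomputable def partialDeriv (i : Fin 5) (f : J1 → ℝ) (θ : J1) : ℝ :=
  fderiv ℝ f θ (Pi.single i 1)

/-- The contact-hamiltonian field
`X_f = f_p (∂_x + p ∂_z) + f_q (∂_y + q ∂_z) - (f_x + p f_z) ∂_p - (f_y + q f_z) ∂_q`. -/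
noncomputable def hamiltonianField (f : J1 → ℝ) : J1 → J1 := fun θ =>
  ![partialDeriv 3 f θ, partialDeriv 4 f θ,
    θ 3 * partialDeriv 3 f θ + θ 4 * partialDeriv 4 f θ,
    -(partialDeriv 0 f θ + θ 3 * partialDeriv 2 f θ),
    -(partialDeriv 1 f θ + θ 4 * partialDeriv 2 f θ)]

/-- `X_f` is a Cartan field. -/
theorem hamiltonianField_mem (f : J1 → ℝ) (θ : J1) :
    hamiltonianField f θ ∈ contactPlane θ := by
  simp [contactPlane, contactForm_apply, hamiltonianField]

/-- The defining property of `X_f`: `X_f ⌟ dU = df - f_z U`. -/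
theorem dU_hamiltonianField (f : J1 → ℝ) (θ w : J1) :
    dU θ (hamiltonianField f θ) w
      = fderiv ℝ f θ w - partialDeriv 2 f θ * contactForm θ w := by
  have hw : w = ∑ i, w i • (Pi.single i (1 : ℝ) : J1) := by
    ext j
    simp [Finset.sum_apply, Pi.single_apply]
  have h : fderiv ℝ f θ w = ∑ i, w i * partialDeriv i f θ := by
    conv_lhs => rw [hw]
    simp [partialDeriv, map_sum]
  rw [h, dU_apply, contactForm_apply]
  simp [hamiltonianField, Fin.sum_univ_succ]
  ring

/-- The field `Z_f = Y(f) X - X(f) Y`. -/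
noncomputable def fieldOf (X Y : J1 → J1) (f : J1 → ℝ) : J1 → J1 := fun θ =>
  fderiv ℝ f θ (Y θ) • X θ - fderiv ℝ f θ (X θ) • Y θ

/-! ### Contact charts -/

/-- `Φ` is a contact chart: a diffeomorphism between open subsets of `J¹(τ)` that maps the contact
distribution to itself. -/
def IsContactChart (Φ : OpenPartialHomeomorph J1 J1) : Prop :=
  ContDiffOn ℝ ∞ Φ Φ.source ∧ ContDiffOn ℝ ∞ Φ.symm Φ.target ∧
  ∀ θ ∈ Φ.source, ∃ c : ℝ, c ≠ 0 ∧
    (contactForm (Φ θ)).comp (fderiv ℝ Φ θ) = c • contactForm θ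

/-- The form `ρ` written in the chart `Φ`, i.e. its pull-back by `Φ⁻¹`. -/
noncomputable def inChart (Φ : OpenPartialHomeomorph J1 J1) (ρ : TwoForm) : TwoForm := fun η =>
  (ρ (Φ.symm η)).compContinuousLinearMap (fderiv ℝ Φ.symm η)

/-! ### The six properties, over an open set `V` -/

/-- `E` is a complete integral over `V` of the equation of `ρ`. -/
def IsCompleteIntegralOn (ρ : TwoForm) (E : J1 → Submodule ℝ J1) (V : Set J1) : Prop :=
  IsIntegrableOn E V ∧ ∀ θ ∈ V, E θ ≤ contactPlane θ ∧ ∀ v ∈ E θ, ∀ w ∈ E θ, ρ θ ![v, w] = 0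

/-- `Z` is a generalized intermediate integral over `V` of the parabolic equation of `ρ`. -/
def IsGeneralizedIntermediateIntegralOn (ρ : TwoForm) (Z : J1 → J1) (V : Set J1) : Prop :=
  IsFieldIn Z (characteristicDistribution ρ) V ∧ ∃ k < 4, HasTypeOn Z V k

/-- There is a complete integral over `V`. -/
def HasCompleteIntegral (ρ : TwoForm) (V : Set J1) : Prop :=
  ∃ E : J1 → Submodule ℝ J1, IsCompleteIntegralOn ρ E V

/-- There is a generalized intermediate integral over `V`. -/
def HasGeneralizedIntermediateIntegral (ρ : TwoForm) (V : Set J1) : Prop :=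
  ∃ Z : J1 → J1, IsGeneralizedIntermediateIntegralOn ρ Z V

/-- There is a field of type `< 4` in `⟨X, Y⟩` over `V`. -/
def HasFieldOfTypeLTFour (X Y : J1 → J1) (V : Set J1) : Prop :=
  ∃ Z : J1 → J1, IsFieldIn Z (fun θ => Submodule.span ℝ {X θ, Y θ}) V ∧
    ∃ k < 4, HasTypeOn Z V k

/-- There is a field in `⟨X, Y⟩` over `V` that lies in an integrable lagrangian distribution. -/
def HasFieldInIntegrableLagrangian (X Y : J1 → J1) (V : Set J1) : Prop :=
  ∃ (Z : J1 → J1) (E : J1 → Submodule ℝ J1),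
    IsFieldIn Z (fun θ => Submodule.span ℝ {X θ, Y θ}) V ∧
    IsIntegrableOn E V ∧ IsLagrangianOn E V ∧ ∀ θ ∈ V, Z θ ∈ E θ

/-- There is an integrable lagrangian distribution `E` over `V` which, in some contact chart
`Φ` of `V`, is the distribution of R-planes of a smooth section `σ` of `J²(τ) → J¹(τ)` whose graph
is contained in the equation. -/
def HasIntegrableSection (ρ : TwoForm) (V : Set J1) : Prop :=
  ∃ (E : J1 → Submodule ℝ J1) (Φ : OpenPartialHomeomorph J1 J1) (σ : J1 → J2),
    IsIntegrableOn E V ∧ IsLagrangianOn E V ∧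
    Φ.source = V ∧ IsContactChart Φ ∧
    ContDiffOn ℝ ∞ σ Φ.target ∧ (∀ η ∈ Φ.target, proj21 (σ η) = η) ∧
    (∀ θ ∈ V, (E θ).map (fderiv ℝ Φ θ : J1 →ₗ[ℝ] J1) = rPlane (σ (Φ θ))) ∧
    ∀ η ∈ Φ.target, σ η ∈ equation (inChart Φ ρ)

/-- There is a function `f` over `V`, with `X_f` nowhere zero, such that
`dU(Z_f, [Z_f, X_f]) = 0`. -/
def HasDeterminingFunction (X Y : J1 → J1) (V : Set J1) : Prop :=
  ∃ f : J1 → ℝ, ContDiffOn ℝ ∞ f V ∧ (∀ θ ∈ V, hamiltonianField f θ ≠ 0) ∧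
    ∀ θ ∈ V, dU θ (fieldOf X Y f θ)
      (VectorField.lieBracket ℝ (fieldOf X Y f) (hamiltonianField f) θ) = 0

/-- `P` holds over some open neighbourhood of `θ₀` contained in `Ω`. -/
def Near (Ω : Set J1) (θ₀ : J1) (P : Set J1 → Prop) : Prop :=
  ∃ V : Set J1, IsOpen V ∧ θ₀ ∈ V ∧ V ⊆ Ω ∧ P V

end ParabolicMAE

/-! At a point, a parabolic equation is a nilpotent operator `J` on the contact plane: dU(Jv, w) =
(ρ + lam dU)(v, w) and J² = 0, because the Pfaffian of ρ + μ dU has a double root at lam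
(`IsParabolicAt.exists_operator`). The characteristic plane 𝒟 is the kernel of `J` in the contact
plane. It follows that 𝒟 is lagrangian, and that ρ vanishes on a lagrangian plane E exactly when E
meets 𝒟 nontrivially (`IsParabolicAt.exists_mem_inf`, `IsParabolicAt.twoForm_eq_zero`). Integrable
planes inside the contact distribution are automatically lagrangian, so complete integrals are the
integrable lagrangian distributions that meet 𝒟 everywhere.

A field Z of type less than four lies in such a distribution. The common kernel of U, Z(U), Z²(U),
Z³(U) lies in 𝒞, contains Z and is invariant under Z. For type three it is a plane field, integrable
because it is preserved by one of its own sections; for type two it has rank three and is cut down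
by a first integral of Z (`exists_integrable_of_type_lt_four`). The Frobenius theorem behind this
rests on flow boxes, and these on a smooth local flow obtained from the implicit function theorem in
a space of curves.

A complete integral becomes a section of J² once a partial Legendre transformation makes its planes
transversal to ⟨∂_p, ∂_q⟩. It also yields a determining function: for a first integral f of its
foliation, X_f and Z_f are both tangent to the leaves, so their bracket is tangent too and is
orthogonal to Z_f.

Conversely, dU(Z_f, [Z_f, X_f]) = 0 says that the lagrangian plane ⟨Z_f, X_f⟩ is closed under
bracket wherever the two fields are independent, which bounds the rank of Z_f by three
(`lieRank_le_three`). If they are nowhere independent, X_f is itself characteristic, of rank at most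
two (`lieRank_hamiltonianField_le`). A bounded rank is constant only on some smaller open set,
arbitrarily close to the given point but perhaps not around it. Hence the cycle closes on a dense
open set: the points having a field of low type, where everything holds, together with the exterior
of the points having a determining function, where everything fails. -/

namespace ParabolicMAE

/-! ### Composition operators on spaces of continuous maps; the smooth inverse function theorem. -/

section FlowBox

open Topology Set Metric

universe v

variable {K : Type*} [TopologicalSpace K] [CompactSpace K]

/-- Pointwise application of operators, as a continuous bilinear map. -/
noncomputable def pointwiseApply {E : Type*} [NormedAddCommGroup E] [NormedSpace ℝ E]
    {F : Type*} [NormedAddCommGroup F] [NormedSpace ℝ F] :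
    C(K, E →L[ℝ] F) →L[ℝ] C(K, E) →L[ℝ] C(K, F) :=
  LinearMap.mkContinuous₂
    (LinearMap.mk₂ ℝ (fun (A : C(K, E →L[ℝ] F)) (h : C(K, E)) =>
        (⟨fun s => A s (h s), by fun_prop⟩ : C(K, F)))
      (fun A B h => by ext s; simp) (fun c A h => by ext s; simp)
      (fun A h k => by ext s; simp) (fun c A h => by ext s; simp)) 1
    (fun A h => by
      rw [ContinuousMap.norm_le _ (by positivity)]
      intro s
      calc ‖A s (h s)‖ ≤ ‖A s‖ * ‖h s‖ := (A s).le_opNorm _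
        _ ≤ 1 * ‖A‖ * ‖h‖ := by
          rw [one_mul]
          gcongr
          exacts [A.norm_coe_le_norm s, h.norm_coe_le_norm s])

theorem pointwiseApply_apply {E : Type*} [NormedAddCommGroup E] [NormedSpace ℝ E]
    {F : Type*} [NormedAddCommGroup F] [NormedSpace ℝ F]
    (A : C(K, E →L[ℝ] F)) (h : C(K, E)) (s : K) : pointwiseApply A h s = A s (h s) := rfl

/-- The composition operator of a `C¹` function is differentiable on spaces of continuous maps. -/
theorem hasFDerivAt_postcomp {E : Type*} [NormedAddCommGroup E] [NormedSpace ℝ E]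
    {F : Type*} [NormedAddCommGroup F] [NormedSpace ℝ F] (f : C(E, F)) (f' : C(E, E →L[ℝ] F))
    (hf : ∀ x, HasFDerivAt f (f' x) x) (γ : C(K, E)) :
    HasFDerivAt (fun γ : C(K, E) => f.comp γ) (pointwiseApply (f'.comp γ)) γ := by
  rw [hasFDerivAt_iff_isLittleO_nhds_zero, Asymptotics.isLittleO_iff]
  intro ε hε
  have hc : Continuous fun h : C(K, E) => f'.comp (γ + h) :=
    (ContinuousMap.continuous_postcomp f').comp (continuous_const.add continuous_id)
  obtain ⟨δ, hδ, hball⟩ := (Metric.continuous_iff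
    (f := fun h : C(K, E) => f'.comp (γ + h))).1 hc 0 ε hε
  filter_upwards [Metric.ball_mem_nhds (0 : C(K, E)) hδ] with h hh
  rw [ContinuousMap.norm_le _ (by positivity)]
  intro s
  have key : ∀ y ∈ segment ℝ (γ s) (γ s + h s), ‖f' y - f' (γ s)‖ ≤ ε := by
    intro y hy
    rw [segment_eq_image'] at hy
    obtain ⟨t, ht, rfl⟩ := hy
    have hth : t • h ∈ Metric.ball (0 : C(K, E)) δ := by
      rw [mem_ball_zero_iff] at hh ⊢
      rw [norm_smul, Real.norm_of_nonneg ht.1]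
      nlinarith [norm_nonneg h, ht.2]
    have h1 := (ContinuousMap.dist_apply_le_dist s).trans (hball _ hth).le
    rw [dist_eq_norm] at h1
    simpa using h1
  have h2 := (convex_segment (γ s) (γ s + h s)).norm_image_sub_le_of_norm_hasFDerivWithin_le'
    (fun y _ => (hf y).hasFDerivWithinAt) key (left_mem_segment ℝ _ _) (right_mem_segment ℝ _ _)
  calc _ = ‖f (γ s + h s) - f (γ s) - f' (γ s) (γ s + h s - γ s)‖ := by
        simp [pointwiseApply_apply]
    _ ≤ ε * ‖γ s + h s - γ s‖ := h2
    _ ≤ ε * ‖h‖ := by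
      gcongr
      simpa using h.norm_coe_le_norm s

/-- The derivative of the composition operator of f is the composition operator of f' followed by
the bounded linear map `pointwiseApply`, which gives an induction on n. The target changes from F to
E →L[ℝ] F, so F is quantified inside the induction and shares its universe with E. -/
theorem contDiff_postcomp_nat {E : Type v} [NormedAddCommGroup E] [NormedSpace ℝ E] (n : ℕ) :
    ∀ {F : Type v} [NormedAddCommGroup F] [NormedSpace ℝ F] (f : C(E, F)),
      ContDiff ℝ n f → ContDiff ℝ n (fun γ : C(K, E) => f.comp γ) := by
  induction n with
  | zero =>
    intro F _ _ f _
    exact contDiff_zero.2 (ContinuousMap.continuous_postcomp f)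
  | succ n ih =>
    intro F _ _ f hf
    push_cast at hf ⊢
    obtain ⟨f', hf', hd⟩ := contDiff_succ_iff_hasFDerivAt.1 hf
    refine contDiff_succ_iff_hasFDerivAt.2
      ⟨fun γ => pointwiseApply ((⟨f', hf'.continuous⟩ : C(E, E →L[ℝ] F)).comp γ), ?_, fun γ =>
        hasFDerivAt_postcomp f ⟨f', hf'.continuous⟩ hd γ⟩
    exact pointwiseApply.contDiff.comp (ih ⟨f', hf'.continuous⟩ hf')

theorem contDiff_postcomp {E : Type*} [NormedAddCommGroup E] [NormedSpace ℝ E]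
    (f : C(E, E)) (hf : ContDiff ℝ ∞ f) : ContDiff ℝ ∞ (fun γ : C(K, E) => f.comp γ) :=
  contDiff_infty.2 fun n => contDiff_postcomp_nat n f (contDiff_infty.1 hf n)

/-- The inverse function theorem, with smoothness of the inverse on a whole neighbourhood. -/
theorem exists_smooth_localInverse {E F : Type*} [NormedAddCommGroup E] [NormedSpace ℝ E]
    [CompleteSpace E] [NormedAddCommGroup F] [NormedSpace ℝ F] {f : E → F} {U : Set E}
    (hU : IsOpen U) (hf : ContDiffOn ℝ ∞ f U) {a : E} (ha : a ∈ U) (f' : E ≃L[ℝ] F)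
    (hf' : HasFDerivAt f (f' : E →L[ℝ] F) a) :
    ∃ e : OpenPartialHomeomorph E F, (∀ x, e x = f x) ∧ a ∈ e.source ∧ e.source ⊆ U ∧
      ContDiffOn ℝ ∞ e.symm e.target := by
  have hat : ContDiffAt ℝ ∞ f a := hf.contDiffAt (hU.mem_nhds ha)
  have hn : (∞ : WithTop ℕ∞) ≠ 0 := by simp
  let e₀ := hat.toOpenPartialHomeomorph f hf' hn
  have he₀ : ∀ x, e₀ x = f x := fun x => by rw [hat.toOpenPartialHomeomorph_coe hf' hn]
  -- Shrinking to the points with invertible derivative makes the inverse smooth at every point of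
  -- the target, not only at the image of a.
  let U' := U ∩ (fderiv ℝ f) ⁻¹' (range ((↑) : (E ≃L[ℝ] F) → E →L[ℝ] F))
  have hU' : IsOpen U' :=
    (hf.continuousOn_fderiv_of_isOpen hU (by simp)).isOpen_inter_preimage hU
      ContinuousLinearEquiv.isOpen
  have haU' : a ∈ U' := ⟨ha, f', hf'.fderiv.symm⟩
  refine ⟨e₀.restrOpen U' hU', he₀, ⟨hat.mem_toOpenPartialHomeomorph_source hf' hn, haU'⟩,
    fun x hx => hx.2.1, fun y hy => ?_⟩
  have hy1 : (e₀.restrOpen U' hU').symm y ∈ (e₀.restrOpen U' hU').source :=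
    (e₀.restrOpen U' hU').map_target hy
  obtain ⟨g, hg⟩ := hy1.2.2
  have hd : ContDiffAt ℝ ∞ f ((e₀.restrOpen U' hU').symm y) :=
    hf.contDiffAt (hU.mem_nhds hy1.2.1)
  refine ((e₀.restrOpen U' hU').contDiffAt_symm (f₀' := g) hy ?_ ?_).contDiffWithinAt
  · rw [hg]
    exact (hd.differentiableAt (by simp)).hasFDerivAt
  · exact hd

end FlowBox

end ParabolicMAE

namespace ParabolicMAE

/-! ### Smooth local flows by the implicit function theorem. -/

section Flow

open Topology Set Metric

variable {E : Type*} [NormedAddCommGroup E] [NormedSpace ℝ E]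

/-- The primitive vanishing at `0` of a continuous function on the unit interval. -/
noncomputable def primitiveCLM : C(unitInterval, E) →L[ℝ] C(unitInterval, E) :=
  LinearMap.mkContinuous
    { toFun := fun β => ⟨fun s => ∫ u in (0 : ℝ)..s, IccExtend zero_le_one β u,
        (intervalIntegral.continuous_primitive
          (fun a b => (β.continuous.Icc_extend' (h := zero_le_one)).intervalIntegrable a b) 0).comp
          continuous_subtype_val⟩
      map_add' := fun β γ => by
        ext s
        exact intervalIntegral.integral_add
          ((β.continuous.Icc_extend' (h := zero_le_one)).intervalIntegrable _ _)
          ((γ.continuous.Icc_extend' (h := zero_le_one)).intervalIntegrable _ _)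
      map_smul' := fun c β => by
        ext s
        exact intervalIntegral.integral_smul c _ } 1
    (fun β => by
      rw [ContinuousMap.norm_le _ (by positivity)]
      intro s
      have h := intervalIntegral.norm_integral_le_of_norm_le_const (a := (0 : ℝ)) (b := s)
        (f := IccExtend zero_le_one β) (C := ‖β‖) (fun u _ => β.norm_coe_le_norm _)
      refine h.trans ?_
      have h1 : |(s : ℝ) - 0| ≤ 1 := by
        rw [sub_zero, abs_of_nonneg s.2.1]
        exact s.2.2
      nlinarith [norm_nonneg β])

/-- The defect of a curve `γ` in the integral equation `γ(s) = τ ∫₀ˢ f (x + γ)`. -/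
noncomputable def integralDefect (f : C(E, E)) (q : (ℝ × E) × C(unitInterval, E)) :
    C(unitInterval, E) :=
  q.2 - q.1.1 • primitiveCLM (f.comp (ContinuousLinearMap.const ℝ unitInterval q.1.2 + q.2))

theorem integralDefect_apply (f : C(E, E)) (τ : ℝ) (x : E) (γ : C(unitInterval, E))
    (s : unitInterval) : integralDefect f ((τ, x), γ) s
      = γ s - τ • ∫ u in (0 : ℝ)..s, f (x + IccExtend zero_le_one γ u) := rfl

theorem contDiff_primitive_comp (f : C(E, E)) (hf : ContDiff ℝ ∞ f) :
    ContDiff ℝ ∞ (fun q : (ℝ × E) × C(unitInterval, E) =>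
      primitiveCLM (f.comp (ContinuousLinearMap.const ℝ unitInterval q.1.2 + q.2))) := by
  have h0 : ContDiff ℝ ∞ (fun x : E => ContinuousLinearMap.const ℝ unitInterval x) :=
    ContinuousLinearMap.contDiff (𝕜 := ℝ) (E := E) (F := C(unitInterval, E))
      (ContinuousLinearMap.const ℝ unitInterval)
  have h1 : ContDiff ℝ ∞ (fun q : (ℝ × E) × C(unitInterval, E) =>
      ContinuousLinearMap.const ℝ unitInterval q.1.2 + q.2) :=
    (h0.comp contDiff_fst.snd).add contDiff_snd
  exact (ContinuousLinearMap.contDiff (𝕜 := ℝ) (E := C(unitInterval, E)) primitiveCLM).comp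
    ((contDiff_postcomp f hf).comp h1)

theorem contDiff_integralDefect (f : C(E, E)) (hf : ContDiff ℝ ∞ f) :
    ContDiff ℝ ∞ (integralDefect f) := by
  exact contDiff_snd.sub (contDiff_fst.fst.smul (contDiff_primitive_comp f hf))

/-- At τ = 0 the product rule for τ times the primitive keeps only the derivative of the factor τ.
The partial derivative in γ is therefore the identity, as the implicit function theorem requires. -/
theorem hasFDerivAt_integralDefect (f : C(E, E)) (hf : ContDiff ℝ ∞ f) (x₀ : E) :
    HasFDerivAt (integralDefect f)
      (ContinuousLinearMap.snd ℝ (ℝ × E) C(unitInterval, E)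
        - ((ContinuousLinearMap.fst ℝ ℝ E).comp
          (ContinuousLinearMap.fst ℝ (ℝ × E) C(unitInterval, E))).smulRight
          (primitiveCLM (f.comp (ContinuousLinearMap.const ℝ unitInterval x₀))))
      ((0, x₀), 0) := by
  have h3 := (((contDiff_primitive_comp f hf).differentiable (by simp)) ((0, x₀), 0)).hasFDerivAt
  have h4 : HasFDerivAt (fun q : (ℝ × E) × C(unitInterval, E) => q.1.1)
      ((ContinuousLinearMap.fst ℝ ℝ E).comp
          (ContinuousLinearMap.fst ℝ (ℝ × E) C(unitInterval, E))) ((0, x₀), 0) :=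
    ((ContinuousLinearMap.fst ℝ ℝ E).comp
      (ContinuousLinearMap.fst ℝ (ℝ × E) C(unitInterval, E))).hasFDerivAt
  have h5 := (ContinuousLinearMap.snd ℝ (ℝ × E) C(unitInterval, E)).hasFDerivAt
    (x := ((0, x₀), 0)) |>.sub (h4.smul h3)
  refine h5.congr_fderiv ?_
  simp

/-- Local smooth flow of a smooth vector field. -/
theorem exists_smooth_flow [CompleteSpace E] {f : E → E} (hf : ContDiff ℝ ∞ f) (x₀ : E) :
    ∃ (φ : ℝ × E → E) (U : Set (ℝ × E)), IsOpen U ∧ (0, x₀) ∈ U ∧ ContDiffOn ℝ ∞ φ U ∧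
      (∀ x, (0, x) ∈ U → φ (0, x) = x) ∧ ∀ p ∈ U, fderiv ℝ φ p (1, 0) = f (φ p) := by
  let f₁ : C(E, E) := ⟨f, hf.continuous⟩
  -- The implicit function theorem in the form of an inverse function theorem: γ is the displacement
  -- of the solution from x, with time rescaled by τ to the unit interval, and is recovered by
  -- inverting H at defect 0.
  let H : (ℝ × E) × C(unitInterval, E) → (ℝ × E) × C(unitInterval, E) :=
    fun q => (q.1, integralDefect f₁ q)
  let c := primitiveCLM (f₁.comp (ContinuousLinearMap.const ℝ unitInterval x₀))
  let c' := ((ContinuousLinearMap.fst ℝ ℝ E).comp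
          (ContinuousLinearMap.fst ℝ (ℝ × E) C(unitInterval, E))).smulRight c
  let H' : ((ℝ × E) × C(unitInterval, E)) ≃L[ℝ] ((ℝ × E) × C(unitInterval, E)) :=
    ContinuousLinearEquiv.equivOfInverse
      ((ContinuousLinearMap.fst ℝ (ℝ × E) C(unitInterval, E)).prod
        (ContinuousLinearMap.snd ℝ (ℝ × E) C(unitInterval, E) - c'))
      ((ContinuousLinearMap.fst ℝ (ℝ × E) C(unitInterval, E)).prod
        (ContinuousLinearMap.snd ℝ (ℝ × E) C(unitInterval, E) + c'))
      (fun q => by simp [c']) (fun q => by simp [c'])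
  have hH : ContDiff ℝ ∞ H := contDiff_fst.prodMk (contDiff_integralDefect f₁ hf)
  have hH' : HasFDerivAt H (H' : _ →L[ℝ] _) ((0, x₀), 0) :=
    (ContinuousLinearMap.fst ℝ (ℝ × E) C(unitInterval, E)).hasFDerivAt.prodMk
      (hasFDerivAt_integralDefect f₁ hf x₀)
  obtain ⟨e, he, hmem, -, hsymm⟩ :=
    exists_smooth_localInverse isOpen_univ hH.contDiffOn (mem_univ _) H' hH'
  have hH0 : H ((0, x₀), 0) = ((0, x₀), 0) := by simp [H, integralDefect]
  obtain ⟨δ, hδ, hδS⟩ := Metric.isOpen_iff.1 e.open_source _ hmem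
  have hT0 : ((0, x₀), (0 : C(unitInterval, E))) ∈ e.target := by
    have := e.map_source hmem
    rwa [he, hH0] at this
  let Γ : ℝ × E → C(unitInterval, E) := fun p => (e.symm (p, 0)).2
  let T : Set (ℝ × E) := {p | (p, (0 : C(unitInterval, E))) ∈ e.target}
  have hTo : IsOpen T := e.open_target.preimage (by fun_prop)
  have hΓ : ContDiffOn ℝ ∞ Γ T := by
    refine contDiff_snd.comp_contDiffOn (hsymm.comp ?_ fun p hp => hp)
    exact (contDiff_id.prodMk contDiff_const).contDiffOn
  have hΓ0 : Γ (0, x₀) = 0 := by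
    have h := e.left_inv hmem
    rw [he, hH0] at h
    simp only [Γ, h]
  have hO : IsOpen (T ∩ Γ ⁻¹' ball 0 δ) := hΓ.continuousOn.isOpen_inter_preimage hTo isOpen_ball
  obtain ⟨r, hr, hrO⟩ := Metric.isOpen_iff.1 hO (0, x₀) ⟨hT0, by simp [hΓ0, hδ]⟩
  let ε := min r δ
  have hε : 0 < ε := lt_min hr hδ
  have hUO : ball ((0 : ℝ), x₀) ε ⊆ T ∩ Γ ⁻¹' ball 0 δ :=
    (ball_subset_ball (min_le_left _ _)).trans hrO
  have hsol : ∀ p ∈ ball ((0 : ℝ), x₀) ε, ∀ s : unitInterval,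
      Γ p s = p.1 • ∫ u in (0 : ℝ)..s, f (p.2 + IccExtend zero_le_one (Γ p) u) := by
    intro p hp s
    have h1 : H (e.symm (p, 0)) = (p, 0) := by
      rw [← he]
      exact e.right_inv (hUO hp).1
    have h2 : e.symm (p, 0) = (p, Γ p) := Prod.ext (show (H (e.symm (p, 0))).1 = _ by rw [h1]) rfl
    rw [h2] at h1
    have h3 := congrArg (fun q => q.2 s) h1
    simp only [H] at h3
    rw [show (p, Γ p) = ((p.1, p.2), Γ p) from rfl, integralDefect_apply, ContinuousMap.zero_apply, sub_eq_zero] at h3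
    exact h3
  -- The solution for time τ, run at speed σ, solves the equation for time στ. Its norm does not
  -- grow, so it stays in the source of `e`, where `H` is injective, and it must be the solution
  -- found there.
  have hscale : ∀ (τ : ℝ) (x : E), (τ, x) ∈ ball ((0 : ℝ), x₀) ε → ∀ σ : unitInterval,
      Γ (σ * τ, x) 1 = Γ (τ, x) σ := by
    intro τ x hp σ
    have hpσ : ((σ : ℝ) * τ, x) ∈ ball ((0 : ℝ), x₀) ε := by
      rw [← ball_prod_same] at hp ⊢
      refine ⟨?_, hp.2⟩
      have h1 := hp.1
      simp only [mem_ball_zero_iff, norm_mul] at h1 ⊢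
      rw [Real.norm_of_nonneg σ.2.1]
      nlinarith [norm_nonneg τ, σ.2.2]
    let γ : C(unitInterval, E) := (Γ (τ, x)).comp ⟨fun s => σ * s, by fun_prop⟩
    have hγ : ((((σ : ℝ) * τ, x), γ) : (ℝ × E) × C(unitInterval, E)) ∈ e.source := by
      apply hδS
      rw [← ball_prod_same]
      refine ⟨ball_subset_ball (min_le_right _ _) hpσ, ?_⟩
      have h1 := (hUO hp).2
      rw [mem_preimage, mem_ball_zero_iff] at h1
      rw [mem_ball_zero_iff]
      refine lt_of_le_of_lt ?_ h1
      rw [ContinuousMap.norm_le _ (by positivity)]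
      exact fun s => (Γ (τ, x)).norm_coe_le_norm _
    have hHγ : H ((σ * τ, x), γ) = ((σ * τ, x), 0) := by
      refine Prod.ext rfl ?_
      ext s
      simp only [H]
      rw [integralDefect_apply, ContinuousMap.zero_apply, sub_eq_zero]
      have h1 : γ s = Γ (τ, x) (σ * s) := rfl
      rw [h1, hsol _ hp]
      rw [Set.Icc.coe_mul]
      rw [mul_comm (σ : ℝ) τ, mul_smul]
      congr 1
      have h2 := intervalIntegral.smul_integral_comp_mul_left (a := 0) (b := (s : ℝ))
        (fun u => f (x + IccExtend zero_le_one (Γ (τ, x)) u)) (σ : ℝ)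
      rw [mul_zero] at h2
      rw [← h2]
      congr 1
      apply intervalIntegral.integral_congr
      intro u hu
      rw [uIcc_of_le s.2.1] at hu
      have hu1 : u ∈ Icc (0 : ℝ) 1 := ⟨hu.1, hu.2.trans s.2.2⟩
      have hu2 : (σ : ℝ) * u ∈ Icc (0 : ℝ) 1 :=
        ⟨mul_nonneg σ.2.1 hu1.1, mul_le_one₀ σ.2.2 hu1.1 hu1.2⟩
      change f (x + _) = f (x + _)
      rw [IccExtend_of_mem _ _ hu1, IccExtend_of_mem _ _ hu2]
      rfl
    have h2 : e.symm ((σ * τ, x), 0) = ((σ * τ, x), γ) := by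
      rw [← hHγ, ← he]
      exact e.left_inv hγ
    have h3 : Γ (σ * τ, x) = γ := by simp only [Γ, h2]
    rw [h3]
    change Γ (τ, x) (σ * 1) = _
    rw [mul_one]
  have hφ : ContDiffOn ℝ ∞ (fun p : ℝ × E => p.2 + Γ p 1) (ball ((0 : ℝ), x₀) ε) := by
    refine contDiff_snd.contDiffOn.add ?_
    exact (ContinuousLinearMap.contDiff (𝕜 := ℝ)
      (ContinuousMap.evalCLM ℝ (1 : unitInterval))).comp_contDiffOn
      (hΓ.mono fun p hp => (hUO hp).1)
  refine ⟨fun p => p.2 + Γ p 1, ball ((0 : ℝ), x₀) ε, isOpen_ball, mem_ball_self hε, hφ, ?_, ?_⟩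
  · intro x hx
    have := hsol _ hx 1
    simp [this]
  -- The curve t ↦ φ(tτ, x) is differentiated at σ by the chain rule and by the integral equation,
  -- and the common factor τ is cancelled. The derivatives are taken within [0, 1], where `hscale`
  -- is available.
  · have main : ∀ (τ : ℝ) (x : E), (τ, x) ∈ ball ((0 : ℝ), x₀) ε → τ ≠ 0 → ∀ σ : unitInterval,
        fderiv ℝ (fun p : ℝ × E => p.2 + Γ p 1) (σ * τ, x) (1, 0)
          = f (x + Γ (σ * τ, x) 1) := by
      intro τ x hp hτ σ
      have hpσ : ((σ : ℝ) * τ, x) ∈ ball ((0 : ℝ), x₀) ε := by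
        rw [← ball_prod_same] at hp ⊢
        refine ⟨?_, hp.2⟩
        have h1 := hp.1
        simp only [mem_ball_zero_iff, norm_mul] at h1 ⊢
        rw [Real.norm_of_nonneg σ.2.1]
        nlinarith [norm_nonneg τ, σ.2.2]
      have hd := ((hφ.contDiffAt (isOpen_ball.mem_nhds hpσ)).differentiableAt
        (by simp)).hasFDerivAt
      have hl : HasDerivAt (fun t : ℝ => (t * τ, x)) (τ, (0 : E)) (σ : ℝ) := by
        simpa using ((hasDerivAt_id (σ : ℝ)).mul_const τ).prodMk (hasDerivAt_const (σ : ℝ) x)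
      have h1 := (hd.comp_hasDerivAt (σ : ℝ) hl).hasDerivWithinAt (s := Icc 0 1)
      have hcont : Continuous fun u : ℝ => f (x + IccExtend zero_le_one (Γ (τ, x)) u) :=
        hf.continuous.comp (continuous_const.add
          ((Γ (τ, x)).continuous.Icc_extend' (h := zero_le_one)))
      have h2 : HasDerivWithinAt (fun t : ℝ => x + τ • ∫ u in (0 : ℝ)..t,
          f (x + IccExtend zero_le_one (Γ (τ, x)) u)) (τ • f (x + Γ (τ, x) σ)) (Icc 0 1) σ := by
        have h3 := (((hcont.integral_hasStrictDerivAt 0 (σ : ℝ)).hasDerivAt).const_smul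
          τ).const_add x
        rw [IccExtend_of_mem _ _ σ.2] at h3
        exact h3.hasDerivWithinAt
      have h4 : HasDerivWithinAt ((fun p : ℝ × E => p.2 + Γ p 1) ∘ fun t : ℝ => (t * τ, x))
          (τ • f (x + Γ (τ, x) σ)) (Icc 0 1) σ := by
        refine h2.congr_of_mem (fun t ht => ?_) σ.2
        have h5 := hscale τ x hp ⟨t, ht⟩
        simp only [Function.comp]
        rw [h5, hsol _ hp]
      have h6 := (uniqueDiffOn_Icc_zero_one (σ : ℝ) σ.2).eq_deriv _ h1 h4
      have h7 : ((τ, (0 : E)) : ℝ × E) = τ • (1, 0) := by simp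
      rw [h7, map_smul] at h6
      rw [hscale τ x hp σ]
      exact smul_right_injective E hτ h6
    rintro ⟨t, x⟩ hp
    by_cases ht : t = 0
    · subst ht
      -- For t = 0 the choice τ = t would leave nothing to cancel; any nonzero admissible τ with σ =
      -- 0 reaches the same point.
      have hp' : (ε / 2, x) ∈ ball ((0 : ℝ), x₀) ε := by
        rw [← ball_prod_same] at hp ⊢
        refine ⟨?_, hp.2⟩
        rw [mem_ball_zero_iff, Real.norm_of_nonneg (by positivity)]
        linarith
      simpa using main (ε / 2) x hp' (by positivity) 0
    · simpa using main t x hp ht 1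

end Flow

end ParabolicMAE

namespace ParabolicMAE

/-! ### Flow boxes and first integrals of an invariant plane field. -/

section Frobenius

open Topology Set Metric

variable {E : Type*} [NormedAddCommGroup E] [NormedSpace ℝ E] [FiniteDimensional ℝ E]

omit [FiniteDimensional ℝ E] in
theorem fderiv_comp_isOpen {F G : Type*} [NormedAddCommGroup F] [NormedSpace ℝ F]
    [NormedAddCommGroup G] [NormedSpace ℝ G] {f : E → F} {g : F → G} {s : Set E} {t : Set F}
    (hs : IsOpen s) (ht : IsOpen t) (hf : ContDiffOn ℝ ∞ f s) (hg : ContDiffOn ℝ ∞ g t) {x : E}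
    (hx : x ∈ s) (hfx : f x ∈ t) :
    fderiv ℝ (fun x => g (f x)) x = (fderiv ℝ g (f x)).comp (fderiv ℝ f x) :=
  fderiv_comp x ((hg.contDiffAt (ht.mem_nhds hfx)).differentiableAt (by simp))
    ((hf.contDiffAt (hs.mem_nhds hx)).differentiableAt (by simp))

omit [FiniteDimensional ℝ E] in
theorem fderiv_symm_comp_fderiv {F : Type*} [NormedAddCommGroup F] [NormedSpace ℝ F]
    {e : OpenPartialHomeomorph E F} (hec : ContDiffOn ℝ ∞ e e.source)
    (hesc : ContDiffOn ℝ ∞ e.symm e.target) {x : E} (hx : x ∈ e.source) :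
    (fderiv ℝ e.symm (e x)).comp (fderiv ℝ e x) = ContinuousLinearMap.id ℝ E := by
  rw [← fderiv_comp_isOpen e.open_source e.open_target hec hesc hx (e.map_source hx),
    ← fderiv_id (x := x)]
  apply Filter.EventuallyEq.fderiv_eq
  filter_upwards [e.open_source.mem_nhds hx] with y hy using e.left_inv hy

omit [FiniteDimensional ℝ E] in
theorem fderiv_comp_fderiv_symm {F : Type*} [NormedAddCommGroup F] [NormedSpace ℝ F]
    {e : OpenPartialHomeomorph E F} (hec : ContDiffOn ℝ ∞ e e.source)
    (hesc : ContDiffOn ℝ ∞ e.symm e.target) {y : F} (hy : y ∈ e.target) :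
    (fderiv ℝ e (e.symm y)).comp (fderiv ℝ e.symm y) = ContinuousLinearMap.id ℝ F :=
  fderiv_symm_comp_fderiv (e := e.symm) hesc hec hy

/-- A smooth vector field agrees near a point with a globally defined smooth one. -/
theorem exists_contDiff_eqOn_ball {F : Type*} [NormedAddCommGroup F] [NormedSpace ℝ F]
    {V : Set E} (hV : IsOpen V) {Z : E → F}
    (hZ : ContDiffOn ℝ ∞ Z V) {x₀ : E} (hx₀ : x₀ ∈ V) :
    ∃ (f : E → F) (r : ℝ), 0 < r ∧ ball x₀ r ⊆ V ∧ ContDiff ℝ ∞ f ∧ EqOn f Z (ball x₀ r) := by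
  obtain ⟨R, hR, hRV⟩ := Metric.isOpen_iff.1 hV x₀ hx₀
  let χ : ContDiffBump x₀ := ⟨R / 4, R / 2, by positivity, by linarith⟩
  refine ⟨fun x => χ x • Z x, R / 4, by positivity,
    (ball_subset_ball (by linarith)).trans hRV, contDiff_iff_contDiffAt.2 fun x => ?_,
    fun x hx => ?_⟩
  · by_cases hx : x ∈ ball x₀ R
    · exact χ.contDiff.contDiffAt.smul (hZ.contDiffAt (hV.mem_nhds (hRV hx)))
    · have h1 : x ∈ (closedBall x₀ (R / 2))ᶜ := fun h =>
        hx (closedBall_subset_ball (by linarith) h)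
      refine (contDiffAt_const (c := (0 : F))).congr_of_eventuallyEq ?_
      filter_upwards [isClosed_closedBall.isOpen_compl.mem_nhds h1] with y hy
      rw [mem_compl_iff, mem_closedBall, not_le] at hy
      rw [χ.zero_of_le_dist hy.le, zero_smul]
  · simp only
    rw [χ.one_of_mem_closedBall (ball_subset_closedBall hx), one_smul]

/-- The flow box theorem: a nonvanishing smooth vector field is locally conjugate to a constant
one. -/
theorem exists_flowBox {V : Set E} (hV : IsOpen V) {Z : E → E} (hZ : ContDiffOn ℝ ∞ Z V) {x₀ : E}
    (hx₀ : x₀ ∈ V) (hZ₀ : Z x₀ ≠ 0) :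
    ∃ e : OpenPartialHomeomorph E E, x₀ ∈ e.source ∧ e x₀ = x₀ ∧
      fderiv ℝ e x₀ = ContinuousLinearMap.id ℝ E ∧ e.target ⊆ V ∧ ContDiffOn ℝ ∞ e e.source ∧
      ContDiffOn ℝ ∞ e.symm e.target ∧ ∀ x ∈ e.source, fderiv ℝ e x (Z x₀) = Z (e x) := by
  have : CompleteSpace E := FiniteDimensional.complete ℝ E
  -- The flow was constructed for globally defined fields, so Z is first cut off outside a ball.
  obtain ⟨f, r, hr, hrV, hf, hfZ⟩ := exists_contDiff_eqOn_ball hV hZ hx₀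
  obtain ⟨φ, U, hU, hU₀, hφ, hφ0, hφf⟩ := exists_smooth_flow hf x₀
  obtain ⟨ℓ, hℓ⟩ := SeparatingDual.exists_eq_one (R := ℝ) hZ₀
  -- `L` separates x into a time along Z x₀ and a point of the hyperplane ℓ = ℓ(x₀). Flowing that
  -- point for that time gives a map φ ∘ L with derivative the identity at x₀ which carries the
  -- constant field Z x₀ to Z.
  let L : E → ℝ × E := fun x => (ℓ (x - x₀), x - ℓ (x - x₀) • Z x₀)
  let L' : E →L[ℝ] ℝ × E := ℓ.prod (ContinuousLinearMap.id ℝ E - ℓ.smulRight (Z x₀))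
  have hL : ContDiff ℝ ∞ L := by fun_prop
  have hL' : ∀ x, HasFDerivAt L L' x := by
    intro x
    have h1 : HasFDerivAt (fun x => ℓ (x - x₀)) ℓ x := by
      have h2 := (ℓ.hasFDerivAt (x := x - x₀)).comp x ((hasFDerivAt_id x).sub_const x₀)
      rwa [ContinuousLinearMap.comp_id] at h2
    exact h1.prodMk ((hasFDerivAt_id x).sub (h1.smul_const (Z x₀)))
  have hL0 : L x₀ = (0, x₀) := by simp [L]
  have hO : IsOpen (L ⁻¹' U) := hU.preimage hL.continuous
  have hΨ : ContDiffOn ℝ ∞ (fun x => φ (L x)) (L ⁻¹' U) :=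
    hφ.comp hL.contDiffOn fun x hx => hx
  have hΨ' : ∀ x ∈ L ⁻¹' U, HasFDerivAt (fun x => φ (L x)) ((fderiv ℝ φ (L x)).comp L') x :=
    fun x hx => ((hφ.contDiffAt (hU.mem_nhds hx)).differentiableAt
      (by simp)).hasFDerivAt.comp x (hL' x)
  have hx₀O : x₀ ∈ L ⁻¹' U := by rw [mem_preimage, hL0]; exact hU₀
  have hΨ₀ : φ (L x₀) = x₀ := by rw [hL0]; exact hφ0 _ hU₀
  have hsplit : ∀ v : E, fderiv ℝ φ (0, x₀) (0, v) = v := by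
    intro v
    have h1 := ((hφ.contDiffAt (hU.mem_nhds hU₀)).differentiableAt (by simp)).hasFDerivAt
    have h2 : HasFDerivAt (fun x : E => ((0 : ℝ), x)) (ContinuousLinearMap.inr ℝ ℝ E) x₀ :=
      (ContinuousLinearMap.inr ℝ ℝ E).hasFDerivAt
    have h3 := h1.comp x₀ h2
    have h4 : (φ ∘ fun x : E => ((0 : ℝ), x)) =ᶠ[𝓝 x₀] fun x => x := by
      have h5 : IsOpen ((fun x : E => ((0 : ℝ), x)) ⁻¹' U) := hU.preimage (by fun_prop)
      filter_upwards [h5.mem_nhds hU₀] with x hx using hφ0 x hx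
    have h6 := h3.unique ((hasFDerivAt_id x₀).congr_of_eventuallyEq h4)
    simpa using congrArg (fun T : E →L[ℝ] E => T v) h6
  have hid : (fderiv ℝ φ (L x₀)).comp L' = ContinuousLinearMap.id ℝ E := by
    ext v
    have h1 : L' v = ℓ v • ((1 : ℝ), (0 : E)) + (0, v - ℓ v • Z x₀) := by
      simp [L']
    rw [hL0, ContinuousLinearMap.comp_apply, h1, map_add, map_smul, hφf _ hU₀, hsplit,
      hφ0 _ hU₀, hfZ (mem_ball_self hr)]
    simp
  have hO' : IsOpen (L ⁻¹' U ∩ (fun x => φ (L x)) ⁻¹' ball x₀ r) :=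
    hΨ.continuousOn.isOpen_inter_preimage hO isOpen_ball
  obtain ⟨e, he, hes, hsub, hsymm⟩ := exists_smooth_localInverse hO' (hΨ.mono inter_subset_left)
    (a := x₀) ⟨hx₀O, by rw [mem_preimage, hΨ₀]; exact mem_ball_self hr⟩
    (ContinuousLinearEquiv.refl ℝ E) (by
      have := hΨ' x₀ hx₀O
      rw [hid] at this
      exact this)
  have hef : (e : E → E) = fun x => φ (L x) := funext he
  refine ⟨e, hes, by rw [he, hΨ₀], ?_, fun y hy => ?_, ?_, hsymm, fun x hx => ?_⟩
  · rw [hef, (hΨ' x₀ hx₀O).fderiv, hid]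
  · have h1 := (hsub (e.map_target hy)).2
    rw [mem_preimage, ← he, e.right_inv hy] at h1
    exact hrV h1
  · rw [hef]
    exact hΨ.mono fun x hx => (hsub hx).1
  · rw [he, hef, (hΨ' x (hsub hx).1).fderiv]
    have h1 : L' (Z x₀) = ((1 : ℝ), (0 : E)) := by simp [L', hℓ]
    rw [ContinuousLinearMap.comp_apply, h1, hφf _ (hsub hx).1]
    exact hfZ (hsub hx).2

variable {G : Type*} [NormedAddCommGroup G] [NormedSpace ℝ G] [FiniteDimensional ℝ G]

omit [FiniteDimensional ℝ G] in
theorem finrank_ker_of_surjective (hEG : Module.finrank ℝ E = Module.finrank ℝ G + 2)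
    {T : E →L[ℝ] G} (hT : Function.Surjective T) :
    Module.finrank ℝ (LinearMap.ker (T : E →ₗ[ℝ] G)) = 2 := by
  have h := LinearMap.finrank_range_add_finrank_ker (T : E →ₗ[ℝ] G)
  rw [LinearMap.range_eq_top.2 hT, finrank_top] at h
  omega

omit [FiniteDimensional ℝ G] in
/-- Two surjections with two independent vectors in common in their kernels have the same
kernel. -/
theorem ker_eq_of_common_pair (hEG : Module.finrank ℝ E = Module.finrank ℝ G + 2)
    {S T : E →L[ℝ] G} (hS : Function.Surjective S) (hT : Function.Surjective T) {v w : E}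
    (hvw : LinearIndependent ℝ ![v, w]) (hSv : S v = 0) (hSw : S w = 0) (hTv : T v = 0)
    (hTw : T w = 0) :
    LinearMap.ker (S : E →ₗ[ℝ] G) = LinearMap.ker (T : E →ₗ[ℝ] G) := by
  have h2 : Module.finrank ℝ (Submodule.span ℝ (range ![v, w])) = 2 := by
    simpa using finrank_span_eq_card hvw
  have key : ∀ {A : E →L[ℝ] G}, Function.Surjective A → A v = 0 → A w = 0 →
      Submodule.span ℝ (range ![v, w]) = LinearMap.ker (A : E →ₗ[ℝ] G) := by
    intro A hA hv hw
    refine Submodule.eq_of_le_of_finrank_eq ?_ ?_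
    · rw [Submodule.span_le]
      rintro _ ⟨i, rfl⟩
      fin_cases i
      · exact hv
      · exact hw
    · rw [h2, finrank_ker_of_surjective hEG hA]
  rw [← key hS hSv hSw, ← key hT hTv hTw]

/-- First integrals of a rank two distribution `ker B` which contains a constant vector field and
is invariant under the corresponding translations. -/
theorem exists_firstIntegrals_of_invariant
    (hEG : Module.finrank ℝ E = Module.finrank ℝ G + 2) {x₀ Z₀ : E} (hZ₀ : Z₀ ≠ 0) {r : ℝ}
    (hr : 0 < r) {B : E → E →L[ℝ] G} (hB : ContDiffOn ℝ ∞ B (ball x₀ r)) (R : G →L[ℝ] E)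
    (hBR : ∀ x ∈ ball x₀ r, ∀ g, B x (R g) = g) (hBZ : ∀ x ∈ ball x₀ r, B x Z₀ = 0)
    (hBinv : ∀ x ∈ ball x₀ r, fderiv ℝ B x Z₀ = 0) :
    ∃ W : Set E, IsOpen W ∧ x₀ ∈ W ∧ W ⊆ ball x₀ r ∧ ∃ F : E → G, ContDiffOn ℝ ∞ F W ∧
      ∀ x ∈ W, Function.Surjective (fderiv ℝ F x) ∧
        LinearMap.ker (B x : E →ₗ[ℝ] G) = LinearMap.ker (fderiv ℝ F x : E →ₗ[ℝ] G) := by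
  have : CompleteSpace E := FiniteDimensional.complete ℝ E
  have : CompleteSpace G := FiniteDimensional.complete ℝ G
  have hx₀ : x₀ ∈ ball x₀ r := mem_ball_self hr
  obtain ⟨ℓ, hℓ⟩ := SeparatingDual.exists_eq_one (R := ℝ) hZ₀
  -- Projection along Z₀ to a transversal hyperplane. Since B is constant along Z₀, the plane field
  -- descends to a line field on the hyperplane, and a line field can be straightened by a flow box.
  let P : E → E := fun x => x - ℓ (x - x₀) • Z₀
  let P₀ : E →L[ℝ] E := ContinuousLinearMap.id ℝ E - ℓ.smulRight Z₀
  have hP₀ : ∀ v, P₀ v = v - ℓ v • Z₀ := fun v => by simp [P₀]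
  have hP : ContDiff ℝ ∞ P := by fun_prop
  have hP' : ∀ x, HasFDerivAt P P₀ x := by
    intro x
    have h1 : HasFDerivAt (fun x => ℓ (x - x₀)) ℓ x := by
      have h2 := (ℓ.hasFDerivAt (x := x - x₀)).comp x ((hasFDerivAt_id x).sub_const x₀)
      rwa [ContinuousLinearMap.comp_id] at h2
    exact (hasFDerivAt_id x).sub (h1.smul_const Z₀)
  have hPx₀ : P x₀ = x₀ := by simp [P]
  have hPP : ∀ x, P (P x) = P x := by
    intro x
    have : ℓ (P x - x₀) = 0 := by simp [P, hℓ]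
    change P x - ℓ (P x - x₀) • Z₀ = P x
    rw [this, zero_smul, sub_zero]
  have hBsurj : ∀ x ∈ ball x₀ r, Function.Surjective (B x) := fun x hx g => ⟨R g, hBR x hx g⟩
  obtain ⟨w₀, hw₀, hPw₀⟩ : ∃ w₀, B x₀ w₀ = 0 ∧ P₀ w₀ ≠ 0 := by
    by_contra! hcon
    have h1 : LinearMap.ker (B x₀ : E →ₗ[ℝ] G) ≤ Submodule.span ℝ {Z₀} := by
      intro w hw
      have h2 := hcon w hw
      rw [hP₀, sub_eq_zero] at h2
      rw [h2]
      exact Submodule.smul_mem _ _ (Submodule.mem_span_singleton_self _)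
    have h2 := Submodule.finrank_mono h1
    rw [finrank_ker_of_surjective hEG (hBsurj x₀ hx₀), finrank_span_singleton hZ₀] at h2
    omega
  -- The segment from x to P x is parallel to Z₀ and stays in the ball by convexity, so B is
  -- constant on it.
  have hBP : ∀ x ∈ ball x₀ r, P x ∈ ball x₀ r → B (P x) = B x := by
    intro x hx hPx
    let c : ℝ → E := fun t => x + t • (P x - x)
    have hc : ∀ t ∈ Icc (0 : ℝ) 1, c t ∈ ball x₀ r := by
      intro t ht
      have h1 := (convex_ball x₀ r).add_smul_sub_mem hx hPx ht
      exact h1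
    have hc' : ∀ t, HasDerivAt c (P x - x) t := by
      intro t
      have h1 := ((hasDerivAt_id t).smul_const (P x - x)).const_add x
      rwa [one_smul] at h1
    have hd : ∀ t ∈ Icc (0 : ℝ) 1, HasDerivAt (fun t => B (c t)) 0 t := by
      intro t ht
      have h1 := ((hB.contDiffAt (isOpen_ball.mem_nhds (hc t ht))).differentiableAt
        (by simp)).hasFDerivAt.comp_hasDerivAt t (hc' t)
      have h2 : P x - x = -ℓ (x - x₀) • Z₀ := by
        rw [neg_smul]
        exact sub_sub_cancel_left _ _
      rwa [h2, map_smul, hBinv _ (hc t ht), smul_zero] at h1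
    have h3 := constant_of_has_deriv_right_zero (f := fun t => B (c t)) (a := 0) (b := 1)
      (fun t ht => (hd t ht).continuousAt.continuousWithinAt)
      (fun t ht => (hd t (Ico_subset_Icc_self ht)).hasDerivWithinAt) 1 (by simp)
    simpa [c] using h3
  -- Because B x ∘ R is the identity, subtracting R(B x w₀) moves w₀ into the kernel at x.
  let w : E → E := fun x => w₀ - R (B x w₀)
  have hw : ContDiffOn ℝ ∞ w (ball x₀ r) :=
    contDiffOn_const.sub (R.contDiff.comp_contDiffOn (hB.clm_apply contDiffOn_const))
  have hBw : ∀ x ∈ ball x₀ r, B x (w x) = 0 := by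
    intro x hx
    simp [w, hBR x hx]
  have hwx₀ : w x₀ = w₀ := by simp [w, hw₀]
  have hV' : IsOpen (P ⁻¹' ball x₀ r) := isOpen_ball.preimage hP.continuous
  have hW' : ContDiffOn ℝ ∞ (fun x => P₀ (w (P x))) (P ⁻¹' ball x₀ r) :=
    P₀.contDiff.comp_contDiffOn (hw.comp hP.contDiffOn fun x hx => hx)
  obtain ⟨e, hes, hex₀, hed, het, hec, hesc, heZ⟩ := exists_flowBox hV' hW' (x₀ := x₀)
    (by rw [mem_preimage, hPx₀]; exact hx₀) (by rw [hPx₀, hwx₀]; exact hPw₀)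
  simp only [hPx₀, hwx₀] at heZ
  have hx₀t : x₀ ∈ e.target := by
    have := e.map_source hes
    rwa [hex₀] at this
  have hinv : ∀ x ∈ e.source, (fderiv ℝ e.symm (e x)).comp (fderiv ℝ e x)
      = ContinuousLinearMap.id ℝ E := fun x hx => fderiv_symm_comp_fderiv hec hesc hx
  have hsymmw : ∀ y ∈ e.target, fderiv ℝ e.symm y (P₀ (w (P y))) = P₀ w₀ := by
    intro y hy
    have hx := e.map_target hy
    have h1 := heZ _ hx
    rw [e.right_inv hy] at h1
    rw [← h1]
    have h2 := hinv _ hx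
    rw [e.right_inv hy] at h2
    exact congrArg (fun T : E →L[ℝ] E => T (P₀ w₀)) h2
  -- The projection kills Z₀, and `e.symm` turns the projected second kernel field into the constant
  -- P₀ w₀, which B x₀ kills. So dF annihilates both generators Z₀ and w x of ker B x.
  let F : E → G := fun x => B x₀ (e.symm (P x))
  let N : Set E := ball x₀ r ∩ P ⁻¹' (ball x₀ r ∩ e.target)
  have hN : IsOpen N := isOpen_ball.inter ((isOpen_ball.inter e.open_target).preimage hP.continuous)
  have hx₀N : x₀ ∈ N := ⟨hx₀, by rw [mem_preimage, hPx₀]; exact ⟨hx₀, hx₀t⟩⟩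
  have hF : ContDiffOn ℝ ∞ F N :=
    (B x₀).contDiff.comp_contDiffOn (hesc.comp hP.contDiffOn fun x hx => hx.2.2)
  have hF' : ∀ x ∈ N, ∀ v, fderiv ℝ F x v = B x₀ (fderiv ℝ e.symm (P x) (P₀ v)) := by
    intro x hx v
    have h1 := ((hesc.contDiffAt (e.open_target.mem_nhds hx.2.2)).differentiableAt
      (by simp)).hasFDerivAt.comp x (hP' x)
    have h2 := (B x₀).hasFDerivAt.comp x h1
    exact congrArg (fun T : E →L[ℝ] G => T v) h2.fderiv
  have hFx₀ : ∀ g, fderiv ℝ F x₀ (R g) = g := by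
    intro g
    have h2 := hinv x₀ hes
    rw [hed, hex₀, ContinuousLinearMap.comp_id] at h2
    rw [hF' x₀ hx₀N, hPx₀, h2, ContinuousLinearMap.id_apply, hP₀, map_sub, map_smul,
      hBZ x₀ hx₀, hBR x₀ hx₀]
    simp
  have hFc : ContinuousOn (fun x => (fderiv ℝ F x).comp R) N :=
    (hF.continuousOn_fderiv_of_isOpen hN (by simp)).clm_comp continuousOn_const
  have hO1 : IsOpen (N ∩ (fun x => (fderiv ℝ F x).comp R) ⁻¹'
      (range ((↑) : (G ≃L[ℝ] G) → G →L[ℝ] G))) :=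
    hFc.isOpen_inter_preimage hN ContinuousLinearEquiv.isOpen
  have hPw : ContinuousOn (fun x => P₀ (w x)) N :=
    P₀.continuous.comp_continuousOn (hw.continuousOn.mono fun x hx => hx.1)
  have hO2 : IsOpen (N ∩ (fun x => P₀ (w x)) ⁻¹' {0}ᶜ) :=
    hPw.isOpen_inter_preimage hN isOpen_compl_singleton
  refine ⟨_, hO1.inter hO2, ⟨⟨hx₀N, ContinuousLinearEquiv.refl ℝ G, ?_⟩, hx₀N, ?_⟩,
    fun x hx => hx.1.1.1, F, hF.mono fun x hx => hx.1.1, fun x hx => ?_⟩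
  · ext g
    simp [hFx₀ g]
  · simp only [mem_preimage, hwx₀]
    exact hPw₀
  · obtain ⟨⟨hxN, T, hT⟩, -, hPwx⟩ := hx
    have hsurj : Function.Surjective (fderiv ℝ F x) := by
      intro g
      refine ⟨R (T.symm g), ?_⟩
      have h1 := congrArg (fun S : G →L[ℝ] G => S (T.symm g)) hT
      simpa using h1.symm
    refine ⟨hsurj, ?_⟩
    have hP₀Z : P₀ Z₀ = 0 := by simp [hP₀, hℓ]
    have hli : LinearIndependent ℝ ![Z₀, w x] := by
      rw [LinearIndependent.pair_iff' hZ₀]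
      intro a ha
      apply hPwx
      simp only [mem_singleton_iff]
      rw [← ha, map_smul, hP₀Z, smul_zero]
    refine ker_eq_of_common_pair hEG (hBsurj x hxN.1) hsurj hli (hBZ x hxN.1) (hBw x hxN.1) ?_ ?_
    · rw [hF' x hxN, hP₀Z, map_zero, map_zero]
    · have h1 : w (P x) = w x := by simp only [w, hBP x hxN.1 hxN.2.1]
      have h2 := hsymmw _ hxN.2.2
      rw [hPP, h1] at h2
      rw [hF' x hxN, h2, hP₀, map_sub, map_smul, hBZ x₀ hx₀, hw₀]
      simp

end Frobenius

end ParabolicMAE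

namespace ParabolicMAE

/-! ### The Frobenius theorem for a plane field preserved by one of its sections. -/

section Frobenius

open Topology Set Metric

variable {E : Type*} [NormedAddCommGroup E] [NormedSpace ℝ E] [FiniteDimensional ℝ E]
variable {G : Type*} [NormedAddCommGroup G] [NormedSpace ℝ G] [FiniteDimensional ℝ G]

theorem minSmoothness_two_le_infty : minSmoothness ℝ 2 ≤ (∞ : WithTop ℕ∞) := by
  rw [minSmoothness_of_isRCLikeNormedField]
  exact WithTop.coe_le_coe.2 le_top

omit [FiniteDimensional ℝ E] in
theorem exists_right_inverse {A : E →L[ℝ] G} (hA : Function.Surjective A) :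
    ∃ R : G →L[ℝ] E, ∀ g, A (R g) = g := by
  obtain ⟨g, hg⟩ := LinearMap.exists_rightInverse_of_surjective (A : E →ₗ[ℝ] G)
    (LinearMap.range_eq_top.2 hA)
  exact ⟨g.toContinuousLinearMap, fun x => LinearMap.congr_fun hg x⟩

/-- A version of the Frobenius theorem: a rank two distribution `ker A` which contains the smooth
nonvanishing vector field `Z` and is invariant under its flow, in the infinitesimal sense and on a
dense set of points, has a full set of first integrals. -/
theorem exists_firstIntegrals
    (hEG : Module.finrank ℝ E = Module.finrank ℝ G + 2) {V V₁ : Set E} (hV : IsOpen V)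
    (hV₁ : V ⊆ closure V₁) {Z : E → E} (hZ : ContDiffOn ℝ ∞ Z V) {A : E → E →L[ℝ] G}
    (hA : ContDiffOn ℝ ∞ A V) (hAZ : ∀ x ∈ V, A x (Z x) = 0) {x₀ : E} (hx₀ : x₀ ∈ V)
    (hZ₀ : Z x₀ ≠ 0) (hAx₀ : Function.Surjective (A x₀))
    (hinv : ∀ x ∈ V, x ∈ V₁ → ∀ v, A x v = 0 →
      fderiv ℝ A x (Z x) v + A x (fderiv ℝ Z x v) = 0) :
    ∃ W : Set E, IsOpen W ∧ x₀ ∈ W ∧ W ⊆ V ∧ ∃ F : E → G, ContDiffOn ℝ ∞ F W ∧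
      ∀ x ∈ W, Function.Surjective (fderiv ℝ F x) ∧
        LinearMap.ker (A x : E →ₗ[ℝ] G) = LinearMap.ker (fderiv ℝ F x : E →ₗ[ℝ] G) := by
  have : CompleteSpace E := FiniteDimensional.complete ℝ E
  have : CompleteSpace G := FiniteDimensional.complete ℝ G
  obtain ⟨e, hes, hex₀, hed, het, hec, hesc, heZ⟩ := exists_flowBox hV hZ hx₀ hZ₀
  have hmaps : ∀ x ∈ e.source, e x ∈ V := fun x hx => het (e.map_source hx)
  have hec' : ContDiffOn ℝ ∞ (fderiv ℝ e) e.source :=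
    hec.fderiv_of_isOpen e.open_source (by simp)
  let Z₀ := Z x₀
  -- the pulled back distribution
  let A' : E → E →L[ℝ] G := fun x => (A (e x)).comp (fderiv ℝ e x)
  have hA' : ContDiffOn ℝ ∞ A' e.source :=
    (hA.comp hec hmaps).clm_comp hec'
  have hA'Z : ∀ x ∈ e.source, A' x Z₀ = 0 := by
    intro x hx
    simp only [A', ContinuousLinearMap.comp_apply, Z₀]
    rw [heZ x hx, hAZ _ (hmaps x hx)]
  have hA'x₀ : A' x₀ = A x₀ := by simp only [A', hex₀, hed, ContinuousLinearMap.comp_id]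
  obtain ⟨R, hR⟩ := exists_right_inverse hAx₀
  have hMo : IsOpen (e.source ∩ (fun x => (A' x).comp R) ⁻¹'
      (range ((↑) : (G ≃L[ℝ] G) → G →L[ℝ] G))) :=
    (hA'.continuousOn.clm_comp continuousOn_const).isOpen_inter_preimage e.open_source
      ContinuousLinearEquiv.isOpen
  obtain ⟨r, hr, hball⟩ := Metric.isOpen_iff.1 hMo x₀
    ⟨hes, ContinuousLinearEquiv.refl ℝ G, by ext g; simp [hA'x₀, hR]⟩
  have hbs : ball x₀ r ⊆ e.source := fun x hx => (hball hx).1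
  -- Normalising by B R = 1 keeps the kernel and turns its invariance under Z₀ into the plain
  -- equation that the derivative of B along Z₀ is zero.
  let B : E → E →L[ℝ] G := fun x => (ContinuousLinearMap.inverse ((A' x).comp R)).comp (A' x)
  have hM : ContDiffOn ℝ ∞ (fun x => (A' x).comp R) (ball x₀ r) :=
    (hA'.mono hbs).clm_comp contDiffOn_const
  have hB : ContDiffOn ℝ ∞ B (ball x₀ r) := by
    refine ContDiffOn.clm_comp (fun x hx => ?_) (hA'.mono hbs)
    obtain ⟨T, hT⟩ := (hball hx).2
    have h1 : ContDiffAt ℝ ∞ ContinuousLinearMap.inverse ((A' x).comp R) := by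
      simp only at hT
      rw [← hT]
      exact contDiffAt_map_inverse T
    exact h1.comp_contDiffWithinAt x (hM x hx)
  have hMB : ∀ x ∈ ball x₀ r, ∀ v, A' x v = A' x (R (B x v)) := by
    intro x hx v
    obtain ⟨T, hT⟩ := (hball hx).2
    simp only at hT
    simp only [B, ContinuousLinearMap.comp_apply]
    rw [← hT, ContinuousLinearMap.inverse_equiv]
    have h1 := congrArg (fun S : G →L[ℝ] G => S (T.symm (A' x v))) hT
    simpa using h1
  have hBR : ∀ x ∈ ball x₀ r, ∀ g, B x (R g) = g := by
    intro x hx g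
    obtain ⟨T, hT⟩ := (hball hx).2
    simp only at hT
    have h2 := congrArg (fun S : G →L[ℝ] G => S g) hT
    simp only [B, ContinuousLinearMap.comp_apply]
    rw [← hT, ContinuousLinearMap.inverse_equiv]
    simp only [ContinuousLinearMap.comp_apply] at h2
    rw [← h2]
    simp
  have hBA : ∀ x ∈ ball x₀ r, ∀ v, B x v = 0 ↔ A' x v = 0 := by
    intro x hx v
    constructor
    · intro h
      rw [hMB x hx v, h, map_zero, map_zero]
    · intro h
      simp only [B, ContinuousLinearMap.comp_apply, h, map_zero]
  have hBZ : ∀ x ∈ ball x₀ r, B x Z₀ = 0 := fun x hx => (hBA x hx Z₀).2 (hA'Z x (hbs hx))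
  have hdB : ∀ x ∈ ball x₀ r, HasFDerivAt B (fderiv ℝ B x) x := fun x hx =>
    ((hB.contDiffAt (isOpen_ball.mem_nhds hx)).differentiableAt (by simp)).hasFDerivAt
  have hdA' : ∀ x ∈ ball x₀ r, HasFDerivAt A' (fderiv ℝ A' x) x := fun x hx =>
    ((hA'.contDiffAt (e.open_source.mem_nhds (hbs hx))).differentiableAt (by simp)).hasFDerivAt
  have hBR' : ∀ x ∈ ball x₀ r, ∀ g, fderiv ℝ B x Z₀ (R g) = 0 := by
    intro x hx g
    have h1 := (hdB x hx).clm_apply (hasFDerivAt_const (R g) x)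
    have h2 : (fun x => B x (R g)) =ᶠ[𝓝 x] fun _ => g := by
      filter_upwards [isOpen_ball.mem_nhds hx] with y hy using hBR y hy g
    have h3 := h1.unique ((hasFDerivAt_const g x).congr_of_eventuallyEq h2)
    simpa using congrArg (fun T : E →L[ℝ] G => T Z₀) h3
  -- derivative of the pulled back distribution in the direction of the constant field
  have hA'd : ∀ x ∈ ball x₀ r, ∀ u, fderiv ℝ A' x Z₀ u =
      fderiv ℝ A (e x) (Z (e x)) (fderiv ℝ e x u)
        + A (e x) (fderiv ℝ Z (e x) (fderiv ℝ e x u)) := by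
    intro x hx u
    have hxs := hbs hx
    have hex := (hec.contDiffAt (e.open_source.mem_nhds hxs))
    have hde := (hex.differentiableAt (by simp)).hasFDerivAt
    have hdde := ((hec'.contDiffAt (e.open_source.mem_nhds hxs)).differentiableAt
      (by simp)).hasFDerivAt
    have hdA := ((hA.contDiffAt (hV.mem_nhds (hmaps x hxs))).differentiableAt
      (by simp)).hasFDerivAt
    have hdZ := ((hZ.contDiffAt (hV.mem_nhds (hmaps x hxs))).differentiableAt
      (by simp)).hasFDerivAt
    have h1 : HasFDerivAt (fun x => A (e x)) ((fderiv ℝ A (e x)).comp (fderiv ℝ e x)) x :=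
      hdA.comp x hde
    have h2 := congrArg (fun T : E →L[ℝ] E →L[ℝ] G => T Z₀ u) (h1.clm_comp hdde).fderiv
    have h3 : HasFDerivAt (fun x => Z (e x)) ((fderiv ℝ Z (e x)).comp (fderiv ℝ e x)) x :=
      hdZ.comp x hde
    have h4 := hdde.clm_apply (hasFDerivAt_const Z₀ x)
    have h5 : (fun x => fderiv ℝ e x Z₀) =ᶠ[𝓝 x] fun x => Z (e x) := by
      filter_upwards [e.open_source.mem_nhds hxs] with y hy using heZ y hy
    have h6 := congrArg (fun T : E →L[ℝ] E => T u)
      (h4.unique (h3.congr_of_eventuallyEq h5))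
    have h7 := hex.isSymmSndFDerivAt minSmoothness_two_le_infty
    simp at h2 h6
    rw [← h6, ← heZ x hxs]
    rw [h7.eq u Z₀]
    exact h2.trans (add_comm _ _)
  -- Any v is the sum of v - R(B v), which is in the kernel, and R(B v). The derivative of B along
  -- Z₀ kills the former by the invariance hypothesis and the latter because B R is constant.
  have hzero : ∀ x ∈ ball x₀ r, e x ∈ V₁ → fderiv ℝ B x Z₀ = 0 := by
    intro x hx hxV
    ext v
    have hu : B x (v - R (B x v)) = 0 := by rw [map_sub, hBR x hx, sub_self]
    have h1 : fderiv ℝ A' x Z₀ (v - R (B x v)) = 0 := by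
      rw [hA'd x hx]
      exact hinv (e x) (hmaps x (hbs hx)) hxV _ ((hBA x hx _).1 hu)
    have h2 : fderiv ℝ B x Z₀ (v - R (B x v)) = 0 := by
      have h3 := (hdB x hx).clm_apply (hasFDerivAt_const (v - R (B x v)) x)
      have h4 := (hdA' x hx).clm_apply (R.hasFDerivAt.comp x h3)
      have h5 := (hdA' x hx).clm_apply (hasFDerivAt_const (v - R (B x v)) x)
      have h6 : (fun y => A' y (v - R (B x v))) =ᶠ[𝓝 x]
          fun y => A' y (R (B y (v - R (B x v)))) := by
        filter_upwards [isOpen_ball.mem_nhds hx] with y hy using hMB y hy _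
      have h7 := congrArg (fun T : E →L[ℝ] G => T Z₀)
        (h5.unique (h4.congr_of_eventuallyEq h6))
      simp only [add_apply, ContinuousLinearMap.comp_apply,
        ContinuousLinearMap.flip_apply, zero_apply, map_zero, zero_add,
        Function.comp, hu, h1, add_zero] at h7
      have h8 := (hBA x hx _).2 h7.symm
      rwa [hBR x hx] at h8
    have h3 := hBR' x hx (B x v)
    rw [map_sub, h3, sub_zero] at h2
    rw [h2, zero_apply]
  -- The derivative is continuous and `e` is open, so vanishing over the dense set `V₁` is enough.
  have hBinv : ∀ x ∈ ball x₀ r, fderiv ℝ B x Z₀ = 0 := by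
    intro x hx
    by_contra hne
    have hc : ContinuousOn (fun x => fderiv ℝ B x Z₀) (ball x₀ r) :=
      (hB.continuousOn_fderiv_of_isOpen isOpen_ball (by simp)).clm_apply continuousOn_const
    have hO : IsOpen (ball x₀ r ∩ (fun x => fderiv ℝ B x Z₀) ⁻¹' {0}ᶜ) :=
      hc.isOpen_inter_preimage isOpen_ball isOpen_compl_singleton
    have hO' := e.isOpen_image_of_subset_source hO (inter_subset_left.trans hbs)
    obtain ⟨_, ⟨y, hy, rfl⟩, hyV⟩ := mem_closure_iff.1 (hV₁ (hmaps x (hbs hx))) _ hO'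
      ⟨x, ⟨hx, hne⟩, rfl⟩
    exact hy.2 (hzero y hy.1 hyV)
  obtain ⟨W, hW, hx₀W, hWb, F, hF, hFW⟩ :=
    exists_firstIntegrals_of_invariant hEG hZ₀ hr hB R hBR hBZ hBinv
  have hWs : W ⊆ e.source := hWb.trans hbs
  have hO : IsOpen (e.target ∩ e.symm ⁻¹' W) :=
    hesc.continuousOn.isOpen_inter_preimage e.open_target hW
  have hxt : x₀ ∈ e.target := by
    have := e.map_source hes
    rwa [hex₀] at this
  have hsx : e.symm x₀ = x₀ := by
    have := e.left_inv hes
    rwa [hex₀] at this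
  refine ⟨e.target ∩ e.symm ⁻¹' W, hO, ⟨hxt, by rw [mem_preimage, hsx]; exact hx₀W⟩,
    inter_subset_left.trans het, fun y => F (e.symm y),
    hF.comp (hesc.mono inter_subset_left) fun y hy => hy.2, fun y hy => ?_⟩
  obtain ⟨hyt, hyW⟩ := hy
  have hxs := hWs hyW
  have hd1 : fderiv ℝ (fun y => F (e.symm y)) y
      = (fderiv ℝ F (e.symm y)).comp (fderiv ℝ e.symm y) :=
    fderiv_comp_isOpen e.open_target hW hesc hF hyt hyW
  have hinv1 : (fderiv ℝ e.symm y).comp (fderiv ℝ e (e.symm y)) = ContinuousLinearMap.id ℝ E := by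
    have h1 := fderiv_symm_comp_fderiv hec hesc hxs
    rwa [e.right_inv hyt] at h1
  have hinv2 := fderiv_comp_fderiv_symm hec hesc hyt
  rw [hd1]
  refine ⟨?_, ?_⟩
  · intro g
    obtain ⟨v, hv⟩ := (hFW _ hyW).1 g
    refine ⟨fderiv ℝ e (e.symm y) v, ?_⟩
    have h1 := congrArg (fun T : E →L[ℝ] E => T v) hinv1
    simp only [ContinuousLinearMap.comp_apply, ContinuousLinearMap.id_apply] at h1 ⊢
    rw [h1, hv]
  · ext v
    have h1 := congrArg (fun T : E →L[ℝ] E => T v) hinv2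
    simp only [ContinuousLinearMap.comp_apply, ContinuousLinearMap.id_apply] at h1
    have h2 : A y v = A' (e.symm y) (fderiv ℝ e.symm y v) := by
      simp only [A', ContinuousLinearMap.comp_apply, h1, e.right_inv hyt]
    have h3 := SetLike.ext_iff.1 (hFW _ hyW).2 (fderiv ℝ e.symm y v)
    simp only [LinearMap.mem_ker, ContinuousLinearMap.coe_coe] at h3 ⊢
    rw [h2, ← hBA _ (hWb hyW), h3]
    rfl

end Frobenius

end ParabolicMAE

namespace ParabolicMAE

/-! ### Lie derivatives, brackets and the iterated forms Z^j(U). -/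

section Calculus

open Topology Set Metric

theorem hasFDerivAt_of_contDiffOn {E F : Type*} [NormedAddCommGroup E] [NormedSpace ℝ E]
    [NormedAddCommGroup F] [NormedSpace ℝ F] {f : E → F} {V : Set E} (hf : ContDiffOn ℝ ∞ f V)
    (hV : IsOpen V) {x : E} (hx : x ∈ V) : HasFDerivAt f (fderiv ℝ f x) x :=
  ((hf.contDiffAt (hV.mem_nhds hx)).differentiableAt (by simp)).hasFDerivAt

variable {G : Type*} [NormedAddCommGroup G] [NormedSpace ℝ G]

/-- `(L_Z A)(W) = Z(A(W)) - A([Z, W])`. -/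
theorem lieDeriv_apply_field {A : J1 → J1 →L[ℝ] G} {Z W : J1 → J1} {V : Set J1} (hV : IsOpen V)
    (hA : ContDiffOn ℝ ∞ A V) (hW : ContDiffOn ℝ ∞ W V) {θ : J1} (hθ : θ ∈ V) :
    fderiv ℝ A θ (Z θ) (W θ) + A θ (fderiv ℝ Z θ (W θ))
      = fderiv ℝ (fun η => A η (W η)) θ (Z θ) - A θ (VectorField.lieBracket ℝ Z W θ) := by
  have h := congrArg (fun T : J1 →L[ℝ] G => T (Z θ))
    ((hasFDerivAt_of_contDiffOn hA hV hθ).clm_apply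
      (hasFDerivAt_of_contDiffOn hW hV hθ)).fderiv
  simp at h
  rw [h, VectorField.lieBracket, map_sub]
  abel

theorem lieDerivOne_apply (Z : J1 → J1) (α : OneForm) (θ v : J1) :
    lieDerivOne Z α θ v = fderiv ℝ α θ (Z θ) v + α θ (fderiv ℝ Z θ v) := rfl

theorem lieDerivOne_apply_field {α : OneForm} {Z W : J1 → J1} {V : Set J1} (hV : IsOpen V)
    (hα : ContDiffOn ℝ ∞ α V) (hW : ContDiffOn ℝ ∞ W V) {θ : J1} (hθ : θ ∈ V) :
    lieDerivOne Z α θ (W θ)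
      = fderiv ℝ (fun η => α η (W η)) θ (Z θ) - α θ (VectorField.lieBracket ℝ Z W θ) :=
  lieDeriv_apply_field hV hα hW hθ

/-- `L_Z (dF) = d(Z(F))`. -/
theorem lieDeriv_fderiv {F : J1 → G} {Z : J1 → J1} {V : Set J1} (hV : IsOpen V)
    (hF : ContDiffOn ℝ ∞ F V) (hZ : ContDiffOn ℝ ∞ Z V) {θ : J1} (hθ : θ ∈ V) (v : J1) :
    fderiv ℝ (fderiv ℝ F) θ (Z θ) v + fderiv ℝ F θ (fderiv ℝ Z θ v)
      = fderiv ℝ (fun η => fderiv ℝ F η (Z η)) θ v := by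
  have hF' : ContDiffOn ℝ ∞ (fderiv ℝ F) V := hF.fderiv_of_isOpen hV (by simp)
  have h := congrArg (fun T : J1 →L[ℝ] G => T v)
    ((hasFDerivAt_of_contDiffOn hF' hV hθ).clm_apply
      (hasFDerivAt_of_contDiffOn hZ hV hθ)).fderiv
  have hs := (hF.contDiffAt (hV.mem_nhds hθ)).isSymmSndFDerivAt minSmoothness_two_le_infty
  simp at h
  rw [h, hs.eq v (Z θ)]
  abel

theorem fderiv_eq_zero_of_eqOn {f : J1 → G} {c : G} {V : Set J1} (hV : IsOpen V)
    (hf : ∀ η ∈ V, f η = c) {θ : J1} (hθ : θ ∈ V) : fderiv ℝ f θ = 0 := by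
  have h : f =ᶠ[𝓝 θ] fun _ => c := by filter_upwards [hV.mem_nhds hθ] with η hη using hf η hη
  rw [h.fderiv_eq, fderiv_fun_const]
  rfl

theorem contDiff_contactForm : ContDiff ℝ ∞ contactForm := by
  unfold contactForm
  fun_prop

theorem contDiffOn_lieDerivOne {Z : J1 → J1} {α : OneForm} {V : Set J1} (hV : IsOpen V)
    (hZ : ContDiffOn ℝ ∞ Z V) (hα : ContDiffOn ℝ ∞ α V) :
    ContDiffOn ℝ ∞ (lieDerivOne Z α) V :=
  ((hα.fderiv_of_isOpen hV (by simp)).clm_apply hZ).add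
    (hα.clm_comp (hZ.fderiv_of_isOpen hV (by simp)))

/-- The iterated Lie derivatives `Z^j(U)` of the contact form. -/
noncomputable def lieContact (Z : J1 → J1) (j : ℕ) : OneForm := (lieDerivOne Z)^[j] contactForm

theorem lieContact_zero (Z : J1 → J1) : lieContact Z 0 = contactForm := rfl

theorem lieContact_succ (Z : J1 → J1) (j : ℕ) :
    lieContact Z (j + 1) = lieDerivOne Z (lieContact Z j) :=
  Function.iterate_succ_apply' _ _ _

theorem contDiffOn_lieContact {Z : J1 → J1} {V : Set J1} (hV : IsOpen V)
    (hZ : ContDiffOn ℝ ∞ Z V) (j : ℕ) : ContDiffOn ℝ ∞ (lieContact Z j) V := by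
  induction j with
  | zero => exact contDiff_contactForm.contDiffOn
  | succ j ih =>
    rw [lieContact_succ]
    exact contDiffOn_lieDerivOne hV hZ ih

/-- In (L_Z α)(Z) = Z(α(Z)) - α([Z, Z]) both terms on the right vanish as soon as α(Z) = 0. -/
theorem lieContact_apply_self {Z : J1 → J1} {V : Set J1} (hV : IsOpen V)
    (hZ : ContDiffOn ℝ ∞ Z V) (hU : ∀ η ∈ V, contactForm η (Z η) = 0) (j : ℕ) :
    ∀ η ∈ V, lieContact Z j η (Z η) = 0 := by
  induction j with
  | zero => exact hU
  | succ j ih =>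
    intro η hη
    rw [lieContact_succ, lieDerivOne_apply_field hV (contDiffOn_lieContact hV hZ j) hZ hη,
      fderiv_eq_zero_of_eqOn hV ih hη, VectorField.lieBracket_self]
    simp

theorem dU_eq (θ v w : J1) : dU θ v w
    = fderiv ℝ contactForm θ v w - fderiv ℝ contactForm θ w v := rfl

/-- `Z(U) = Z ⌟ dU` for a Cartan field. -/
theorem lieContact_one_apply {Z : J1 → J1} {V : Set J1} (hV : IsOpen V)
    (hZ : ContDiffOn ℝ ∞ Z V) (hU : ∀ η ∈ V, contactForm η (Z η) = 0) {θ : J1} (hθ : θ ∈ V)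
    (v : J1) : lieContact Z 1 θ v = dU θ (Z θ) v := by
  have h := congrArg (fun T : J1 →L[ℝ] ℝ => T v)
    ((hasFDerivAt_of_contDiffOn contDiff_contactForm.contDiffOn hV hθ).clm_apply
      (hasFDerivAt_of_contDiffOn hZ hV hθ)).fderiv
  rw [fderiv_eq_zero_of_eqOn hV hU hθ] at h
  simp at h
  rw [lieContact_succ, lieContact_zero, lieDerivOne_apply, dU_eq]
  linarith

/-- Extension of a vector in the kernel of a surjection to a field of vectors in the kernels. -/
theorem exists_field_extension [FiniteDimensional ℝ G] {A : J1 → J1 →L[ℝ] G} {V : Set J1}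
    (hV : IsOpen V) (hA : ContDiffOn ℝ ∞ A V) {θ : J1} (hθ : θ ∈ V)
    (hAθ : Function.Surjective (A θ)) {v : J1} (hv : A θ v = 0) :
    ∃ N : Set J1, IsOpen N ∧ θ ∈ N ∧ N ⊆ V ∧ ∃ W : J1 → J1, ContDiffOn ℝ ∞ W N ∧ W θ = v ∧
      ∀ η ∈ N, A η (W η) = 0 := by
  have : CompleteSpace G := FiniteDimensional.complete ℝ G
  obtain ⟨R, hR⟩ := exists_right_inverse hAθ
  have hM : ContDiffOn ℝ ∞ (fun x => (A x).comp R) V := hA.clm_comp contDiffOn_const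
  refine ⟨V ∩ (fun x => (A x).comp R) ⁻¹' (range ((↑) : (G ≃L[ℝ] G) → G →L[ℝ] G)),
    hM.continuousOn.isOpen_inter_preimage hV ContinuousLinearEquiv.isOpen,
    ⟨hθ, ContinuousLinearEquiv.refl ℝ G, by ext g; simp [hR]⟩, inter_subset_left,
    fun η => v - R (ContinuousLinearMap.inverse ((A η).comp R) (A η v)), ?_, by simp [hv], ?_⟩
  · refine contDiffOn_const.sub (R.contDiff.comp_contDiffOn (ContDiffOn.clm_apply (fun x hx => ?_)
      ((hA.mono inter_subset_left).clm_apply contDiffOn_const)))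
    obtain ⟨T, hT⟩ := hx.2
    have h1 : ContDiffAt ℝ ∞ ContinuousLinearMap.inverse ((A x).comp R) := by
      simp only at hT
      rw [← hT]
      exact contDiffAt_map_inverse T
    exact h1.comp_contDiffWithinAt x ((hM x hx.1).mono inter_subset_left)
  · rintro η ⟨-, T, hT⟩
    simp only at hT ⊢
    rw [← hT, ContinuousLinearMap.inverse_equiv, map_sub, sub_eq_zero]
    have h1 := congrArg (fun S : G →L[ℝ] G => S (T.symm (A η v))) hT
    simpa using h1

/-- If `ker A` is infinitesimally invariant under `Z` at `θ`, then the Lie derivative of a form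
that vanishes on `ker A` vanishes on `ker A` at `θ`. -/
theorem lieDerivOne_apply_eq_zero [FiniteDimensional ℝ G] {A : J1 → J1 →L[ℝ] G} {Z : J1 → J1}
    {β : OneForm} {V : Set J1} (hV : IsOpen V) (hA : ContDiffOn ℝ ∞ A V)
    (hβ : ContDiffOn ℝ ∞ β V) {θ : J1} (hθ : θ ∈ V)
    (hAθ : Function.Surjective (A θ)) (hker : ∀ η ∈ V, ∀ v, A η v = 0 → β η v = 0)
    (hinv : ∀ v, A θ v = 0 → fderiv ℝ A θ (Z θ) v + A θ (fderiv ℝ Z θ v) = 0) {v : J1}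
    (hv : A θ v = 0) : lieDerivOne Z β θ v = 0 := by
  obtain ⟨N, hN, hθN, hNV, W, hW, rfl, hAW⟩ := exists_field_extension hV hA hθ hAθ hv
  have h1 := lieDeriv_apply_field (Z := Z) hN (hA.mono hNV) hW hθN
  rw [hinv _ hv, fderiv_eq_zero_of_eqOn hN hAW hθN, zero_apply, zero_sub,
    eq_comm, neg_eq_zero] at h1
  have h2 : ∀ η ∈ N, β η (W η) = 0 := fun η hη => hker η (hNV hη) _ (hAW η hη)
  rw [lieDerivOne_apply_field hN (hβ.mono hNV) hW hθN, fderiv_eq_zero_of_eqOn hN h2 hθN,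
    hker θ hθ _ h1]
  simp

/-- The contact form restricts to a closed form on the leaves of a foliation by integral
submanifolds. -/
theorem dU_eq_zero_of_firstIntegrals {F : J1 → G} [FiniteDimensional ℝ G] {V : Set J1}
    (hV : IsOpen V) (hF : ContDiffOn ℝ ∞ F V) {θ : J1} (hθ : θ ∈ V)
    (hsurj : Function.Surjective (fderiv ℝ F θ))
    (hker : ∀ η ∈ V, ∀ v, fderiv ℝ F η v = 0 → contactForm η v = 0) {v w : J1}
    (hv : fderiv ℝ F θ v = 0) (hw : fderiv ℝ F θ w = 0) : dU θ v w = 0 := by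
  have hF' : ContDiffOn ℝ ∞ (fderiv ℝ F) V := hF.fderiv_of_isOpen hV (by simp)
  obtain ⟨N, hN, hθN, hNV, W, hW, rfl, hFW⟩ := exists_field_extension hV hF' hθ hsurj hv
  have hU : ∀ η ∈ N, contactForm η (W η) = 0 := fun η hη => hker η (hNV hη) _ (hFW η hη)
  -- For a Cartan field W, dU(W, ·) is L_W U. If W is tangent to the foliation, L_W preserves the
  -- forms vanishing on the leaves, and U is one of them.
  rw [← lieContact_one_apply hN hW hU hθN, lieContact_succ, lieContact_zero]
  refine lieDerivOne_apply_eq_zero hN (hF'.mono hNV) contDiff_contactForm.contDiffOn hθN hsurj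
    (fun η hη => hker η (hNV hη)) (fun u _ => ?_) hw
  rw [lieDeriv_fderiv hN (hF.mono hNV) hW hθN, fderiv_eq_zero_of_eqOn hN hFW hθN]
  simp

/-- Brackets of fields tangent to a foliation are tangent to it. -/
theorem fderiv_lieBracket_eq_zero {F : J1 → G} {V : Set J1} (hV : IsOpen V)
    (hF : ContDiffOn ℝ ∞ F V) {Z W : J1 → J1} (hZ : ContDiffOn ℝ ∞ Z V) (hW : ContDiffOn ℝ ∞ W V)
    (hFZ : ∀ η ∈ V, fderiv ℝ F η (Z η) = 0) (hFW : ∀ η ∈ V, fderiv ℝ F η (W η) = 0) {θ : J1}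
    (hθ : θ ∈ V) : fderiv ℝ F θ (VectorField.lieBracket ℝ Z W θ) = 0 := by
  have hF' : ContDiffOn ℝ ∞ (fderiv ℝ F) V := hF.fderiv_of_isOpen hV (by simp)
  have h1 := lieDeriv_apply_field (Z := Z) hV hF' hW hθ
  rw [lieDeriv_fderiv hV hF hZ hθ, fderiv_eq_zero_of_eqOn hV hFZ hθ,
    fderiv_eq_zero_of_eqOn hV hFW hθ] at h1
  simpa using h1.symm

end Calculus

end ParabolicMAE

namespace ParabolicMAE

/-! ### Symplectic linear algebra of the contact plane. -/

section Symplectic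

theorem mem_contactPlane {θ v : J1} : v ∈ contactPlane θ ↔ contactForm θ v = 0 := Iff.rfl

theorem dU_self (θ v : J1) : dU θ v v = 0 := by simp [dU_apply]; ring

theorem dU_swap (θ v w : J1) : dU θ v w = -dU θ w v := by simp [dU_apply]; ring

/-- `dU` as a bilinear form. -/
noncomputable def dUForm (θ : J1) : LinearMap.BilinForm ℝ J1 :=
  LinearMap.mk₂ ℝ (dU θ) (fun a b c => by simp [dU_apply]; ring)
    (fun r a b => by simp [dU_apply]; ring) (fun a b c => by simp [dU_apply]; ring)
    (fun r a b => by simp [dU_apply]; ring)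

theorem dUForm_apply (θ v w : J1) : dUForm θ v w = dU θ v w := rfl

/-- A Cartan vector that is orthogonal to all Cartan vectors vanishes. -/
theorem eq_zero_of_dU_eq_zero {θ v : J1} (hv : v ∈ contactPlane θ)
    (h : ∀ w ∈ contactPlane θ, dU θ v w = 0) : v = 0 := by
  have h0 := h ![1, 0, θ 3, 0, 0] (by simp [mem_contactPlane, contactForm_apply])
  have h1 := h ![0, 1, θ 4, 0, 0] (by simp [mem_contactPlane, contactForm_apply])
  have h3 := h ![0, 0, 0, 1, 0] (by simp [mem_contactPlane, contactForm_apply])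
  have h4 := h ![0, 0, 0, 0, 1] (by simp [mem_contactPlane, contactForm_apply])
  simp [dU_apply] at h0 h1 h3 h4
  rw [mem_contactPlane, contactForm_apply] at hv
  ext i
  fin_cases i <;> simp_all

theorem finrank_J1 : Module.finrank ℝ J1 = 5 := by simp

theorem finrank_contactPlane (θ : J1) : Module.finrank ℝ (contactPlane θ) = 4 := by
  have h := LinearMap.finrank_range_add_finrank_ker (contactForm θ : J1 →ₗ[ℝ] ℝ)
  have hs : Function.Surjective (contactForm θ) := fun c =>
    ⟨![0, 0, c, 0, 0], by simp [contactForm_apply]⟩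
  rw [LinearMap.range_eq_top.2 hs, finrank_top, finrank_J1, Module.finrank_self] at h
  change Module.finrank ℝ (LinearMap.ker (contactForm θ : J1 →ₗ[ℝ] ℝ)) = 4
  omega

/-- On the whole tangent space dU is degenerate along ∂_z only, which does not meet the contact
plane, so the full complement of E has dimension 5 - dim E. It contains ∂_z, hence is transversal to
the contact plane, and intersecting with that plane lowers the dimension by one. -/
theorem finrank_add_finrank_orthogonal {θ : J1} {E : Submodule ℝ J1} (hE : E ≤ contactPlane θ) :
    Module.finrank ℝ E + Module.finrank ℝ (orthogonal θ E) = 4 := by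
  have hrefl : (dUForm θ).IsRefl := fun v w h => by
    rw [dUForm_apply] at h ⊢
    rw [dU_swap, h, neg_zero]
  have h1 := LinearMap.BilinForm.finrank_add_finrank_orthogonal hrefl E
  have h2 : E ⊓ (dUForm θ).orthogonal ⊤ = ⊥ := by
    rw [eq_bot_iff]
    rintro v ⟨hvE, hv⟩
    refine eq_zero_of_dU_eq_zero (hE hvE) fun w _ => ?_
    have h3 : dU θ w v = 0 := (LinearMap.BilinForm.mem_orthogonal_iff.1 hv) w trivial
    rw [dU_swap, h3, neg_zero]
  rw [h2, finrank_bot, finrank_J1] at h1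
  have h3 : orthogonal θ E = contactPlane θ ⊓ (dUForm θ).orthogonal E := by
    ext v
    refine and_congr_right fun _ => ?_
    rw [SetLike.mem_coe, LinearMap.BilinForm.mem_orthogonal_iff]
    refine forall₂_congr fun w _ => ?_
    change dU θ v w = 0 ↔ dU θ w v = 0
    rw [dU_swap, neg_eq_zero]
  have h4 : contactPlane θ ⊔ (dUForm θ).orthogonal E = ⊤ := by
    rw [eq_top_iff]
    intro v _
    have h5 : v - contactForm θ v • ![0, 0, 1, 0, 0] ∈ contactPlane θ := by
      rw [mem_contactPlane, map_sub, map_smul, contactForm_apply θ ![0, 0, 1, 0, 0]]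
      simp
    have h6 : contactForm θ v • ![0, 0, 1, 0, 0] ∈ (dUForm θ).orthogonal E := by
      rw [LinearMap.BilinForm.mem_orthogonal_iff]
      intro w _
      change dU θ w _ = 0
      simp [dU_apply]
    have h7 := Submodule.add_mem_sup h5 h6
    rwa [sub_add_cancel] at h7
  have h5 := Submodule.finrank_sup_add_finrank_inf_eq (contactPlane θ) ((dUForm θ).orthogonal E)
  rw [h4, ← h3, finrank_top, finrank_J1, finrank_contactPlane] at h5
  omega

/-- A two-dimensional isotropic space of Cartan vectors is its own orthogonal complement. -/
theorem eq_orthogonal_of_isotropic {θ : J1} {E : Submodule ℝ J1} (hE : E ≤ contactPlane θ)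
    (h2 : Module.finrank ℝ E = 2) (hiso : ∀ v ∈ E, ∀ w ∈ E, dU θ v w = 0) :
    E = orthogonal θ E := by
  have h := finrank_add_finrank_orthogonal hE
  exact Submodule.eq_of_le_of_finrank_eq (fun v hv => ⟨hE hv, hiso v hv⟩) (by omega)

theorem finrank_ker_fin_three {T : J1 →L[ℝ] (Fin 3 → ℝ)} (hT : Function.Surjective T) :
    Module.finrank ℝ (LinearMap.ker (T : J1 →ₗ[ℝ] (Fin 3 → ℝ))) = 2 :=
  finrank_ker_of_surjective (by simp) hT

theorem finrank_of_isIntegrableOn {E : J1 → Submodule ℝ J1} {V : Set J1}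
    (hE : IsIntegrableOn E V) {θ : J1} (hθ : θ ∈ V) : Module.finrank ℝ (E θ) = 2 := by
  obtain ⟨W, -, hθW, -, F, -, hF⟩ := hE θ hθ
  rw [(hF θ hθW).2]
  exact finrank_ker_fin_three (hF θ hθW).1

theorem IsIntegrableOn.mono {E : J1 → Submodule ℝ J1} {V V' : Set J1} (hE : IsIntegrableOn E V)
    (hV' : IsOpen V') (h : V' ⊆ V) : IsIntegrableOn E V' := by
  intro θ hθ
  obtain ⟨W, hW, hθW, -, F, hF, hFE⟩ := hE θ (h hθ)
  exact ⟨W ∩ V', hW.inter hV', ⟨hθW, hθ⟩, Set.inter_subset_right, F,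
    hF.mono Set.inter_subset_left, fun η hη => hFE η hη.1⟩

/-- Integrable two-dimensional subdistributions of the contact distribution are lagrangian. -/
theorem isLagrangianOn_of_isIntegrableOn {E : J1 → Submodule ℝ J1} {V : Set J1}
    (hE : IsIntegrableOn E V) (hC : ∀ θ ∈ V, E θ ≤ contactPlane θ) : IsLagrangianOn E V := by
  intro θ hθ
  refine eq_orthogonal_of_isotropic (hC θ hθ) (finrank_of_isIntegrableOn hE hθ) ?_
  obtain ⟨W, hW, hθW, hWV, F, hF, hFE⟩ := hE θ hθ
  intro v hv w hw
  rw [(hFE θ hθW).2] at hv hw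
  refine dU_eq_zero_of_firstIntegrals hW hF hθW (hFE θ hθW).1 (fun η hη u hu => ?_) hv hw
  refine hC η (hWV hη) ?_
  rw [(hFE η hη).2]
  exact hu

end Symplectic

end ParabolicMAE

namespace ParabolicMAE

/-! ### Pointwise algebra of a parabolic equation. -/

section Parabolic

variable {ρ : TwoForm} {θ : J1}

theorem twoForm_swap (ρ : TwoForm) (θ v w : J1) : ρ θ ![v, w] = -ρ θ ![w, v] := by
  have h := (ρ θ).toAlternatingMap.map_swap ![w, v] (i := 0) (j := 1) (by simp)
  have h2 : (![w, v] ∘ Equiv.swap (0 : Fin 2) 1) = ![v, w] := by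
    ext i
    fin_cases i <;> simp
  rw [h2] at h
  exact h

/-- A 2-form at a point as a bilinear form. -/
noncomputable def twoFormBilin (ρ : TwoForm) (θ : J1) : J1 →ₗ[ℝ] J1 →ₗ[ℝ] ℝ :=
  LinearMap.mk₂ ℝ (fun v w => ρ θ ![v, w]) (fun a b c => (ρ θ).vecCons_add ![c] a b)
    (fun r a b => (ρ θ).vecCons_smul ![b] r a)
    (fun a b c => by
      rw [twoForm_swap ρ θ a, twoForm_swap ρ θ a b, twoForm_swap ρ θ a c,
        (ρ θ).vecCons_add ![a] b c, neg_add])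
    (fun r a b => by
      rw [twoForm_swap ρ θ a, twoForm_swap ρ θ a b, (ρ θ).vecCons_smul ![a] r b, smul_neg])

theorem twoFormBilin_apply (v w : J1) : twoFormBilin ρ θ v w = ρ θ ![v, w] := rfl

theorem twoForm_self (ρ : TwoForm) (θ v : J1) : ρ θ ![v, v] = 0 := by
  have := twoForm_swap ρ θ v v
  linarith

/-- The Cartan vector with components `a, b` along `∂_x + p ∂_z, ∂_y + q ∂_z` and `c, d` along
`∂_p, ∂_q`. -/
def cartanVec (θ : J1) (a b c d : ℝ) : J1 := ![a, b, θ 3 * a + θ 4 * b, c, d]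

theorem cartanVec_mem (θ : J1) (a b c d : ℝ) : cartanVec θ a b c d ∈ contactPlane θ := by
  simp [mem_contactPlane, contactForm_apply, cartanVec]

theorem eq_cartanVec {v : J1} (hv : v ∈ contactPlane θ) :
    v = cartanVec θ (v 0) (v 1) (v 3) (v 4) := by
  rw [mem_contactPlane, contactForm_apply] at hv
  ext i
  fin_cases i <;> simp [cartanVec]
  linarith

theorem cartanVec_eq_zero {a b c d : ℝ} (h : cartanVec θ a b c d = 0) :
    a = 0 ∧ b = 0 ∧ c = 0 ∧ d = 0 :=
  ⟨congrFun h 0, congrFun h 1, congrFun h 3, congrFun h 4⟩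

/-- The restriction of a 2-form to the contact space in coordinates. -/
theorem exists_twoForm_coordinates (ρ : TwoForm) (θ : J1) :
    ∃ r₀₁ r₀₃ r₀₄ r₁₃ r₁₄ r₃₄ : ℝ, ∀ v ∈ contactPlane θ, ∀ w ∈ contactPlane θ,
      ρ θ ![v, w] = r₀₁ * (v 0 * w 1 - v 1 * w 0) + r₀₃ * (v 0 * w 3 - v 3 * w 0)
        + r₀₄ * (v 0 * w 4 - v 4 * w 0) + r₁₃ * (v 1 * w 3 - v 3 * w 1)
        + r₁₄ * (v 1 * w 4 - v 4 * w 1) + r₃₄ * (v 3 * w 4 - v 4 * w 3) := by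
  let c : Fin 4 → J1 := ![cartanVec θ 1 0 0 0, cartanVec θ 0 1 0 0, cartanVec θ 0 0 1 0,
    cartanVec θ 0 0 0 1]
  have hc : ∀ v ∈ contactPlane θ, v = v 0 • c 0 + v 1 • c 1 + v 3 • c 2 + v 4 • c 3 := by
    intro v hv
    rw [mem_contactPlane, contactForm_apply] at hv
    ext i
    fin_cases i <;> simp [c, cartanVec]
    linarith
  let b := twoFormBilin ρ θ
  have hs : ∀ v w, b v w = -b w v := fun v w => twoForm_swap ρ θ v w
  have h0 : ∀ v, b v v = 0 := fun v => twoForm_self ρ θ v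
  refine ⟨b (c 0) (c 1), b (c 0) (c 2), b (c 0) (c 3), b (c 1) (c 2), b (c 1) (c 3),
    b (c 2) (c 3), fun v hv w hw => ?_⟩
  rw [← twoFormBilin_apply]
  change b v w = _
  conv_lhs => rw [hc v hv, hc w hw]
  simp only [map_add, map_smul, LinearMap.add_apply, LinearMap.smul_apply, smul_eq_mul, h0]
  rw [hs (c 1) (c 0), hs (c 2) (c 0), hs (c 3) (c 0), hs (c 2) (c 1), hs (c 3) (c 1),
    hs (c 3) (c 2)]
  ring

/-- A parabolic equation determines a nilpotent operator on the contact space, whose kernel is the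
characteristic plane. -/
theorem IsParabolicAt.exists_operator (h : IsParabolicAt ρ θ) :
    ∃ (lam : ℝ) (J : J1 → J1), characteristicDistribution ρ θ = radical ρ lam θ ∧
      (∀ v, J v ∈ contactPlane θ) ∧
      (∀ v ∈ contactPlane θ, ∀ w ∈ contactPlane θ,
        dU θ (J v) w = ρ θ ![v, w] + lam * dU θ v w) ∧ ∀ v, J (J v) = 0 := by
  obtain ⟨hnot, lam, hlam, huniq⟩ := h
  obtain ⟨r₀₁, r₀₃, r₀₄, r₁₃, r₁₄, r₃₄, hr⟩ := exists_twoForm_coordinates ρ θ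
  -- the Pfaffian detects degeneracy
  have hmem : ∀ μ a b c d : ℝ, r₀₁ * b + (r₀₃ + μ) * c + r₀₄ * d = 0 →
      r₀₁ * a - r₁₃ * c - (r₁₄ + μ) * d = 0 → (r₀₃ + μ) * a + r₁₃ * b - r₃₄ * d = 0 →
      r₀₄ * a + (r₁₄ + μ) * b + r₃₄ * c = 0 → cartanVec θ a b c d ∈ radical ρ μ θ := by
    intro μ a b c d e0 e1 e3 e4
    refine ⟨cartanVec_mem θ a b c d, fun w hw => ?_⟩
    rw [hr _ (cartanVec_mem θ a b c d) w hw, dU_apply]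
    simp only [cartanVec, Matrix.cons_val]
    linear_combination -w 0 * e0 + w 1 * e1 + w 3 * e3 + w 4 * e4
  -- The product of a skew matrix with its Pfaffian adjugate is the Pfaffian times the identity.
  -- When the Pfaffian is zero, the rows of the adjugate lie in the radical; three of them contain
  -- every coefficient, so they cannot all vanish unless ρ is -μ dU.
  have hdeg : ∀ μ, r₀₁ * r₃₄ - (r₀₃ + μ) * (r₁₄ + μ) + r₀₄ * r₁₃ = 0 → radical ρ μ θ ≠ ⊥ := by
    intro μ hPf hbot
    have key : ∀ a b c d, cartanVec θ a b c d ∈ radical ρ μ θ → a = 0 ∧ b = 0 ∧ c = 0 ∧ d = 0 := by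
      intro a b c d hv
      rw [hbot, Submodule.mem_bot] at hv
      exact cartanVec_eq_zero hv
    obtain ⟨-, h34, h14, h13⟩ := key 0 r₃₄ (-(r₁₄ + μ)) r₁₃ (hmem μ _ _ _ _
      (by linear_combination hPf) (by ring) (by ring) (by ring))
    obtain ⟨-, -, h04, h03⟩ := key (-r₃₄) 0 r₀₄ (-(r₀₃ + μ)) (hmem μ _ _ _ _
      (by ring) (by linear_combination -hPf) (by ring) (by ring))
    obtain ⟨-, -, -, h01⟩ := key (r₁₄ + μ) (-r₀₄) 0 r₀₁ (hmem μ _ _ _ _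
      (by ring) (by ring) (by linear_combination -hPf) (by ring))
    refine hnot ⟨-μ, fun v hv w hw => ?_⟩
    rw [hr v hv w hw, dU_apply]
    linear_combination (v 0 * w 1 - v 1 * w 0) * h01 - (v 0 * w 3 - v 3 * w 0) * h03
        + (v 0 * w 4 - v 4 * w 0) * h04 + (v 1 * w 3 - v 3 * w 1) * h13
        - (v 1 * w 4 - v 4 * w 1) * h14 + (v 3 * w 4 - v 4 * w 3) * h34
  -- Applying the Pfaffian adjugate to the equations of a radical vector multiplies each of its
  -- coordinates by the Pfaffian.
  have hPf : r₀₁ * r₃₄ - (r₀₃ + lam) * (r₁₄ + lam) + r₀₄ * r₁₃ = 0 := by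
    obtain ⟨v, ⟨hvC, hv⟩, hv0⟩ := (Submodule.ne_bot_iff _).1 hlam
    have e : ∀ a b c d : ℝ, _ := fun a b c d =>
      hv (cartanVec θ a b c d) (cartanVec_mem θ a b c d)
    simp only [hr v hvC _ (cartanVec_mem θ _ _ _ _), dU_apply] at e
    simp only [cartanVec, Matrix.cons_val] at e
    have e0 := e 1 0 0 0
    have e1 := e 0 1 0 0
    have e3 := e 0 0 1 0
    have e4 := e 0 0 0 1
    simp only [mul_one, mul_zero, sub_zero, zero_sub, add_zero, zero_add] at e0 e1 e3 e4
    by_contra hne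
    have h0 : v 0 = 0 := by
      apply (mul_eq_zero.1 _).resolve_left hne
      linear_combination r₃₄ * e1 - (r₁₄ + lam) * e3 + r₁₃ * e4
    have h1 : v 1 = 0 := by
      apply (mul_eq_zero.1 _).resolve_left hne
      linear_combination -r₃₄ * e0 - (r₀₃ + lam) * e4 + r₀₄ * e3
    have h3 : v 3 = 0 := by
      apply (mul_eq_zero.1 _).resolve_left hne
      linear_combination r₀₁ * e4 - r₀₄ * e1 + (r₁₄ + lam) * e0
    have h4 : v 4 = 0 := by
      apply (mul_eq_zero.1 _).resolve_left hne
      linear_combination -r₀₁ * e3 + (r₀₃ + lam) * e1 - r₁₃ * e0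
    apply hv0
    rw [eq_cartanVec hvC, h0, h1, h3, h4]
    ext i
    fin_cases i <;> simp [cartanVec]
  -- the degenerate representative is a double root
  have htr : (r₀₃ + lam) + (r₁₄ + lam) = 0 := by
    -- The Pfaffian is quadratic in μ with sum of roots -(r₀₃ + r₁₄), so this value is the second
    -- root, and uniqueness identifies it with lam.
    have h1 := huniq (lam - ((r₀₃ + lam) + (r₁₄ + lam))) (hdeg _ (by linear_combination hPf))
    linarith
  have hchar : characteristicDistribution ρ θ = radical ρ lam θ := by
    refine le_antisymm (iSup_le fun μ => ?_) (le_iSup (fun lam => radical ρ lam θ) lam)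
    by_cases hμ : radical ρ μ θ = ⊥
    · rw [hμ]
      exact bot_le
    · rw [huniq μ hμ]
  -- The operator is ρ + lam dU with an index raised by dU, where r₁₄ + lam is written as -(r₀₃ +
  -- lam). Then J² is scalar on the contact plane, and the scalar vanishes with the Pfaffian.
  refine ⟨lam, fun v => cartanVec θ ((r₀₃ + lam) * v 0 + r₁₃ * v 1 - r₃₄ * v 4)
    (r₀₄ * v 0 - (r₀₃ + lam) * v 1 + r₃₄ * v 3) (r₀₁ * v 1 + (r₀₃ + lam) * v 3 + r₀₄ * v 4)
    (-(r₀₁ * v 0 + (r₀₃ + lam) * v 4 - r₁₃ * v 3)), hchar, fun v => cartanVec_mem _ _ _ _ _,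
    fun v hv w hw => ?_, fun v => ?_⟩
  · rw [hr v hv w hw, dU_apply, dU_apply]
    simp only [cartanVec, Matrix.cons_val]
    linear_combination (v 4 * w 1 - v 1 * w 4) * htr
  · have hJ : r₀₁ * r₃₄ + (r₀₃ + lam) * (r₀₃ + lam) + r₀₄ * r₁₃ = 0 := by
      linear_combination hPf + (r₀₃ + lam) * htr
    ext i
    fin_cases i <;> simp [cartanVec]
    · linear_combination v 0 * hJ
    · linear_combination v 1 * hJ
    · linear_combination (θ 3 * v 0 + θ 4 * v 1) * hJ
    · linear_combination v 3 * hJ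
    · linear_combination v 4 * hJ

theorem IsParabolicAt.characteristic_le (h : IsParabolicAt ρ θ) :
    characteristicDistribution ρ θ ≤ contactPlane θ := by
  obtain ⟨lam, -, hD, -⟩ := h.exists_operator
  rw [hD]
  exact fun v hv => hv.1

/-- As J² = 0, the image of `J` is characteristic. A vector v orthogonal to it satisfies (ρ + lam
dU)(u, v) = dU(Ju, v) = 0 for every Cartan vector u, so v is in the radical. -/
theorem IsParabolicAt.orthogonal_le (h : IsParabolicAt ρ θ) :
    orthogonal θ (characteristicDistribution ρ θ) ≤ characteristicDistribution ρ θ := by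
  obtain ⟨lam, J, hD, hJC, hJ, hJJ⟩ := h.exists_operator
  rw [hD]
  rintro v ⟨hvC, hv⟩
  refine ⟨hvC, fun u hu => ?_⟩
  have h1 : J u ∈ radical ρ lam θ := by
    refine ⟨hJC u, fun w hw => ?_⟩
    rw [← hJ _ (hJC u) w hw, hJJ]
    simp [dU_apply]
  have h2 := hv _ h1
  rw [dU_swap, hJ u hu v hvC] at h2
  rw [twoForm_swap ρ θ v u, dU_swap θ v u]
  linarith

/-- Complete integrals meet the characteristic distribution. -/
theorem IsParabolicAt.exists_mem_inf (h : IsParabolicAt ρ θ) {E : Submodule ℝ J1}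
    (hE : E = orthogonal θ E) (hne : E ≠ ⊥) (hρ : ∀ v ∈ E, ∀ w ∈ E, ρ θ ![v, w] = 0) :
    ∃ v ∈ E, v ∈ characteristicDistribution ρ θ ∧ v ≠ 0 := by
  obtain ⟨lam, J, hD, hJC, hJ, hJJ⟩ := h.exists_operator
  rw [hD]
  have hEo : ∀ v ∈ E, v ∈ orthogonal θ E := fun v hv => hE ▸ hv
  have hker : ∀ v ∈ contactPlane θ, J v = 0 → v ∈ radical ρ lam θ := by
    intro v hv hJv
    refine ⟨hv, fun w hw => ?_⟩
    rw [← hJ v hv w hw, hJv]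
    simp [dU_apply]
  obtain ⟨a, ha, ha0⟩ := (Submodule.ne_bot_iff _).1 hne
  -- If Ja is not zero, dU(Ja, w) = (ρ + lam dU)(a, w) = 0 for w in E, so Ja lies in E^⊥ = E, and it
  -- is characteristic because J² = 0.
  by_cases hJa : J a = 0
  · exact ⟨a, ha, hker a (hEo a ha).1 hJa, ha0⟩
  · refine ⟨J a, ?_, hker _ (hJC a) (hJJ a), hJa⟩
    rw [hE]
    refine ⟨hJC a, fun w hw => ?_⟩
    rw [hJ a (hEo a ha).1 w (hEo w hw).1, hρ a ha w hw, (hEo a ha).2 w hw]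
    simp

/-- A lagrangian plane that meets the characteristic distribution is integral. -/
theorem IsParabolicAt.twoForm_eq_zero (h : IsParabolicAt ρ θ) {E : Submodule ℝ J1}
    (hE : E = orthogonal θ E) (h2 : Module.finrank ℝ E = 2) {u : J1} (hu : u ∈ E)
    (huD : u ∈ characteristicDistribution ρ θ) (hu0 : u ≠ 0) :
    ∀ v ∈ E, ∀ w ∈ E, ρ θ ![v, w] = 0 := by
  obtain ⟨lam, J, hD, -⟩ := h.exists_operator
  rw [hD] at huD
  have hEo : ∀ v ∈ E, v ∈ orthogonal θ E := fun v hv => hE ▸ hv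
  have hu' : ∀ w ∈ E, ρ θ ![u, w] = 0 := by
    intro w hw
    have h1 := huD.2 w (hEo w hw).1
    rw [(hEo u hu).2 w hw, mul_zero, add_zero] at h1
    exact h1
  intro v hv w hw
  -- `u, v, w` are dependent
  by_cases hvu : ∃ c : ℝ, c • u = v
  · obtain ⟨c, rfl⟩ := hvu
    rw [← twoFormBilin_apply, map_smul, LinearMap.smul_apply, twoFormBilin_apply, hu' w hw,
      smul_zero]
  · push Not at hvu
    have hli : LinearIndependent ℝ ![u, v] := (LinearIndependent.pair_iff' hu0).2 hvu
    have hspan : Submodule.span ℝ (Set.range ![u, v]) = E := by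
      refine Submodule.eq_of_le_of_finrank_eq ?_ ?_
      · rw [Submodule.span_le]
        rintro _ ⟨i, rfl⟩
        fin_cases i
        · exact hu
        · exact hv
      · rw [h2]
        simpa using finrank_span_eq_card hli
    rw [← hspan, Matrix.range_cons, Matrix.range_cons, Matrix.range_empty, Set.union_empty,
      Set.singleton_union, Submodule.mem_span_pair] at hw
    obtain ⟨a, b, rfl⟩ := hw
    rw [← twoFormBilin_apply, map_add, map_smul, map_smul, twoFormBilin_apply, twoFormBilin_apply,
      twoForm_self, twoForm_swap, hu' v hv]
    simp

/-- The inclusion 𝒟^⊥ ⊆ 𝒟 forces dimension at least two, and two generators allow no more. -/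
theorem IsParabolicAt.finrank_characteristic (h : IsParabolicAt ρ θ) {X Y : J1}
    (hD : characteristicDistribution ρ θ = Submodule.span ℝ {X, Y}) :
    Module.finrank ℝ (characteristicDistribution ρ θ) = 2 := by
  have h1 := finrank_add_finrank_orthogonal h.characteristic_le
  have h2 := Submodule.finrank_mono h.orthogonal_le
  have h3 : Module.finrank ℝ (characteristicDistribution ρ θ) ≤ 2 := by
    rw [hD]
    have := finrank_range_le_card (R := ℝ) ![X, Y]
    rw [Matrix.range_cons, Matrix.range_cons, Matrix.range_empty, Set.union_empty,
      Set.singleton_union] at this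
    simpa [Set.finrank] using this
  omega

theorem IsParabolicAt.eq_orthogonal (h : IsParabolicAt ρ θ) {X Y : J1}
    (hD : characteristicDistribution ρ θ = Submodule.span ℝ {X, Y}) :
    orthogonal θ (characteristicDistribution ρ θ) = characteristicDistribution ρ θ := by
  have h1 := finrank_add_finrank_orthogonal h.characteristic_le
  have h2 := h.finrank_characteristic hD
  exact Submodule.eq_of_le_of_finrank_eq h.orthogonal_le (by omega)

theorem IsParabolicAt.linearIndependent (h : IsParabolicAt ρ θ) {X Y : J1}
    (hD : characteristicDistribution ρ θ = Submodule.span ℝ {X, Y}) :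
    LinearIndependent ℝ ![X, Y] := by
  have h2 := h.finrank_characteristic hD
  rw [linearIndependent_iff_card_eq_finrank_span, Matrix.range_cons, Matrix.range_cons,
    Matrix.range_empty, Set.union_empty, Set.singleton_union, Set.finrank, ← hD, h2]
  simp

end Parabolic

end ParabolicMAE

namespace ParabolicMAE

/-! ### Tuples of 1-forms and their common kernels. -/

section Tuples

open Topology Set

variable {n : ℕ}

/-- A tuple of 1-forms as a form with values in `ℝⁿ`. -/
noncomputable def formTuple (α : Fin n → OneForm) : J1 → J1 →L[ℝ] (Fin n → ℝ) :=
  fun θ => ContinuousLinearMap.pi fun i => α i θ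

theorem formTuple_apply (α : Fin n → OneForm) (θ v : J1) (i : Fin n) :
    formTuple α θ v i = α i θ v := rfl

theorem formTuple_eq_zero {α : Fin n → OneForm} {θ v : J1} :
    formTuple α θ v = 0 ↔ ∀ i, α i θ v = 0 := funext_iff

theorem contDiffOn_formTuple {α : Fin n → OneForm} {V : Set J1}
    (hα : ∀ i, ContDiffOn ℝ ∞ (α i) V) : ContDiffOn ℝ ∞ (formTuple α) V := by
  rw [contDiffOn_clm_apply]
  intro v
  rw [contDiffOn_pi]
  exact fun i => (hα i).clm_apply contDiffOn_const

theorem lieDeriv_formTuple {α : Fin n → OneForm} {V : Set J1} (hV : IsOpen V)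
    (hα : ∀ i, ContDiffOn ℝ ∞ (α i) V) (Z : J1 → J1) {θ : J1} (hθ : θ ∈ V) (v : J1) :
    fderiv ℝ (formTuple α) θ (Z θ) v + formTuple α θ (fderiv ℝ Z θ v)
      = fun i => lieDerivOne Z (α i) θ v := by
  ext i
  have h1 := hasFDerivAt_of_contDiffOn (contDiffOn_formTuple hα) hV hθ
  let L := ContinuousLinearMap.compL ℝ J1 (Fin n → ℝ) ℝ
    (ContinuousLinearMap.proj (R := ℝ) (φ := fun _ : Fin n => ℝ) i)
  have h2 : HasFDerivAt (α i) (L.comp (fderiv ℝ (formTuple α) θ)) θ :=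
    (L.hasFDerivAt (x := formTuple α θ)).comp θ h1
  rw [lieDerivOne_apply, h2.fderiv]
  rfl

/-- A proper range would lie in the kernel of a nonzero functional on ℝⁿ, whose coefficients form a
linear relation between the forms. -/
theorem formTuple_surjective {α : Fin n → OneForm} {θ : J1}
    (h : LinearIndependent ℝ fun i => α i θ) : Function.Surjective (formTuple α θ) := by
  by_contra hs
  have hlt : LinearMap.range (formTuple α θ : J1 →ₗ[ℝ] (Fin n → ℝ)) < ⊤ :=
    lt_top_iff_ne_top.2 fun h => hs (LinearMap.range_eq_top.1 h)
  obtain ⟨f, hf0, hf⟩ := Submodule.exists_le_ker_of_lt_top _ hlt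
  apply hf0
  have h1 : ∀ x : Fin n → ℝ, f x = ∑ i, x i * f (Pi.single i 1) := by
    intro x
    conv_lhs => rw [← LinearMap.sum_single_apply (fun _ : Fin n => ℝ) x, map_sum]
    refine Finset.sum_congr rfl fun i _ => ?_
    rw [← smul_eq_mul, ← map_smul]
    congr 1
    ext j
    simp [Pi.single_apply]
  have h2 : ∑ i, f (Pi.single i 1) • α i θ = 0 := by
    ext v
    have h3 : f (formTuple α θ v) = 0 := hf ⟨v, rfl⟩
    rw [h1] at h3
    simpa [formTuple_apply, mul_comm] using h3
  have h3 := Fintype.linearIndependent_iff.1 h _ h2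
  ext i
  simpa using h3 i

theorem mem_span_of_ker_le {α : Fin n → OneForm} {θ : J1}
    (h : Function.Surjective (formTuple α θ)) {β : J1 →L[ℝ] ℝ}
    (hβ : ∀ v, formTuple α θ v = 0 → β v = 0) :
    β ∈ Submodule.span ℝ (range fun i => α i θ) := by
  obtain ⟨R, hR⟩ := exists_right_inverse h
  have h1 : β = ∑ i, β (R (Pi.single i 1)) • α i θ := by
    ext v
    have h2 : β (v - R (formTuple α θ v)) = 0 := hβ _ (by rw [map_sub, hR, sub_self])
    rw [map_sub, sub_eq_zero] at h2
    have h3 : formTuple α θ v = ∑ i, α i θ v • (Pi.single i 1 : Fin n → ℝ) := by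
      ext j
      simp [Finset.sum_apply, Pi.single_apply, formTuple_apply]
    rw [h2, h3]
    simp [mul_comm]
  rw [h1]
  exact Submodule.sum_mem _ fun i _ => Submodule.smul_mem _ _ (Submodule.subset_span ⟨i, rfl⟩)

theorem apply_eq_zero_of_mem_span {S : Set (J1 →L[ℝ] ℝ)} {v : J1} (hS : ∀ α ∈ S, α v = 0)
    {β : J1 →L[ℝ] ℝ} (hβ : β ∈ Submodule.span ℝ S) : β v = 0 := by
  induction hβ using Submodule.span_induction with
  | mem x h => exact hS x h
  | zero => rfl
  | add x y _ _ hx hy => simp [hx, hy]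
  | smul c x _ hx => simp [hx]

theorem isOpen_linearIndependent {α : Fin n → OneForm} {V : Set J1} (hV : IsOpen V)
    (hα : ∀ i, ContDiffOn ℝ ∞ (α i) V) :
    IsOpen (V ∩ {θ | LinearIndependent ℝ fun i => α i θ}) := by
  have hc : ContinuousOn (fun θ => fun i : Fin n => α i θ) V :=
    continuousOn_pi.2 fun i => (hα i).continuousOn
  exact hc.isOpen_inter_preimage hV isOpen_setOfPred_linearIndependent

/-- A functional that does not vanish on the common kernel of an independent pair completes it to
an independent triple. -/
theorem linearIndependent_triple {f : Fin 3 → J1 →L[ℝ] ℝ} {g : Fin 2 → J1 →L[ℝ] ℝ}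
    (hg : LinearIndependent ℝ g) (h0 : g 0 = f 0) (h1 : g 1 = f 1) {v : J1} (hv0 : f 0 v = 0)
    (hv1 : f 1 v = 0) (hv2 : f 2 v ≠ 0) : LinearIndependent ℝ f := by
  rw [Fintype.linearIndependent_iff]
  intro c hc
  rw [Fin.sum_univ_three] at hc
  have hc2 : c 2 = 0 := by
    have := congrArg (fun T : J1 →L[ℝ] ℝ => T v) hc
    simpa [hv0, hv1, hv2] using this
  rw [hc2, zero_smul, add_zero] at hc
  have h4 := Fintype.linearIndependent_iff.1 hg ![c 0, c 1] (by
    rw [Fin.sum_univ_two, h0, h1]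
    exact hc)
  intro i
  fin_cases i
  · exact h4 0
  · exact h4 1
  · exact hc2

end Tuples

/-! ### The rank of U, Z(U), Z²(U), Z³(U). -/

section Rank

open Topology Set

/-- The rank of `U, Z(U), Z²(U), Z³(U)` at a point. -/
noncomputable def lieRank (Z : J1 → J1) (θ : J1) : ℕ :=
  Module.finrank ℝ (Submodule.span ℝ (range fun j : Fin 4 => lieContact Z j θ))

theorem card_le_lieRank {Z : J1 → J1} {θ : J1} {m : ℕ} {f : Fin m → Fin 4}
    (h : LinearIndependent ℝ fun i => lieContact Z (f i) θ) : m ≤ lieRank Z θ := by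
  have h1 := finrank_span_eq_card h
  rw [Fintype.card_fin] at h1
  rw [← h1]
  apply Submodule.finrank_mono
  apply Submodule.span_mono
  rintro _ ⟨i, rfl⟩
  exact ⟨f i, rfl⟩

theorem lieRank_le {Z : J1 → J1} {θ : J1} {n : ℕ} {α : Fin n → OneForm}
    (h : Function.Surjective (formTuple α θ))
    (hα : ∀ v, formTuple α θ v = 0 → ∀ j : Fin 4, lieContact Z j θ v = 0) : lieRank Z θ ≤ n := by
  have h1 : Submodule.span ℝ (range fun j : Fin 4 => lieContact Z j θ)
      ≤ Submodule.span ℝ (range fun i => α i θ) := by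
    rw [Submodule.span_le]
    rintro _ ⟨j, rfl⟩
    exact mem_span_of_ker_le h fun v hv => hα v hv j
  have h2 := finrank_range_le_card (R := ℝ) fun i => α i θ
  rw [Fintype.card_fin] at h2
  have : Module.Finite ℝ (Submodule.span ℝ (range fun i => α i θ)) :=
    Module.Finite.span_of_finite ℝ (finite_range _)
  exact (Submodule.finrank_mono h1).trans h2

/-- If as many of the forms as the rank are independent, they define the common kernel. -/
theorem lieContact_apply_eq_zero {Z : J1 → J1} {θ : J1} {m : ℕ} {f : Fin m → Fin 4}
    (h : LinearIndependent ℝ fun i => lieContact Z (f i) θ) (hm : lieRank Z θ = m) {v : J1}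
    (hv : ∀ i, lieContact Z (f i) θ v = 0) (j : Fin 4) : lieContact Z j θ v = 0 := by
  have h1 := finrank_span_eq_card h
  rw [Fintype.card_fin] at h1
  have h2 : Submodule.span ℝ (range fun i => lieContact Z (f i) θ)
      = Submodule.span ℝ (range fun j : Fin 4 => lieContact Z j θ) := by
    have : Module.Finite ℝ (Submodule.span ℝ (range fun j : Fin 4 => lieContact Z j θ)) :=
      Module.Finite.span_of_finite ℝ (finite_range _)
    refine Submodule.eq_of_le_of_finrank_eq (Submodule.span_mono ?_) (h1.trans hm.symm)
    rintro _ ⟨i, rfl⟩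
    exact ⟨f i, rfl⟩
  refine apply_eq_zero_of_mem_span (S := range fun i => lieContact Z (f i) θ) ?_ ?_
  · rintro _ ⟨i, rfl⟩
    exact hv i
  · rw [h2]
    exact Submodule.subset_span ⟨j, rfl⟩

/-- A Cartan field whose rank is at most three has constant rank somewhere in every open set. -/
theorem exists_hasTypeOn {Z : J1 → J1} {V : Set J1} (hV : IsOpen V) (hne : V.Nonempty)
    (hZ : ContDiffOn ℝ ∞ Z V) (h3 : ∀ θ ∈ V, lieRank Z θ ≤ 3) :
    ∃ N : Set J1, IsOpen N ∧ N.Nonempty ∧ N ⊆ V ∧ ∃ k < 4, HasTypeOn Z N k := by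
  -- A point of maximal rank: near it the rank cannot drop, by openness of independence, nor grow.
  -- The truncated subtraction loses nothing since the rank is at most 3.
  obtain ⟨θ, hθ, hmin⟩ : ∃ θ ∈ V, ∀ η ∈ V, 3 - lieRank Z θ ≤ 3 - lieRank Z η :=
    ⟨Function.argminOn (fun θ => 3 - lieRank Z θ) V hne, Function.argminOn_mem _ _ hne,
      fun η hη => Function.argminOn_le (fun θ => 3 - lieRank Z θ) _ hη⟩
  obtain ⟨g, hg, -, hgi⟩ := Submodule.exists_fun_fin_finrank_span_eq ℝ
    (range fun j : Fin 4 => lieContact Z j θ)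
  choose f hf using hg
  have hfi : LinearIndependent ℝ fun i => lieContact Z (f i) θ := by
    have h1 : (fun i => lieContact Z (f i) θ) = g := funext hf
    rw [h1]
    exact hgi
  refine ⟨_, isOpen_linearIndependent (α := fun i => lieContact Z (f i)) hV
    (fun i => contDiffOn_lieContact hV hZ _), ⟨θ, hθ, hfi⟩, inter_subset_left, lieRank Z θ,
    (h3 θ hθ).trans_lt (by norm_num), fun η hη => ?_⟩
  have h1 := card_le_lieRank (Z := Z) hη.2
  have h2 := hmin η hη.1
  have h4 := h3 η hη.1
  change lieRank Z η = lieRank Z θ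
  change lieRank Z θ ≤ lieRank Z η at h1
  have h5 := h3 θ hθ
  omega

/-- `U` and `Z(U)` are independent for a nonvanishing Cartan field `Z`. -/
theorem linearIndependent_lieContact_two {Z : J1 → J1} {V : Set J1} (hV : IsOpen V)
    (hZ : ContDiffOn ℝ ∞ Z V) (hU : ∀ η ∈ V, contactForm η (Z η) = 0) {θ : J1} (hθ : θ ∈ V)
    (hZθ : Z θ ≠ 0) :
    LinearIndependent ℝ fun i : Fin 2 => lieContact Z ((![0, 1] : Fin 2 → Fin 4) i) θ := by
  have h0 : (fun i : Fin 2 => lieContact Z ((![0, 1] : Fin 2 → Fin 4) i) θ)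
      = ![contactForm θ, lieContact Z 1 θ] := by
    ext i
    fin_cases i <;> rfl
  rw [h0, LinearIndependent.pair_iff]
  intro s t hst
  have h1 : ∀ w, s * contactForm θ w + t * dU θ (Z θ) w = 0 := by
    intro w
    have := congrArg (fun T : J1 →L[ℝ] ℝ => T w) hst
    simpa [lieContact_one_apply hV hZ hU hθ] using this
  have hs : s = 0 := by
    have := h1 ![0, 0, 1, 0, 0]
    simpa [contactForm_apply, dU_apply] using this
  refine ⟨hs, ?_⟩
  by_contra ht
  apply hZθ
  refine eq_zero_of_dU_eq_zero (hU θ hθ) fun w _ => ?_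
  have := h1 w
  rw [hs, zero_mul, zero_add] at this
  exact (mul_eq_zero.1 this).resolve_left ht

end Rank

/-! ### Fields of type less than four lie in integrable lagrangian distributions. -/

section FieldsOfLowType

open Topology Set

theorem isIntegrableOn_ker {A : J1 → J1 →L[ℝ] (Fin 3 → ℝ)} {W : Set J1} (hW : IsOpen W)
    {F : J1 → Fin 3 → ℝ} (hF : ContDiffOn ℝ ∞ F W)
    (h : ∀ x ∈ W, Function.Surjective (fderiv ℝ F x) ∧ LinearMap.ker (A x : J1 →ₗ[ℝ] (Fin 3 → ℝ))
      = LinearMap.ker (fderiv ℝ F x : J1 →ₗ[ℝ] (Fin 3 → ℝ))) :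
    IsIntegrableOn (fun x => LinearMap.ker (A x : J1 →ₗ[ℝ] (Fin 3 → ℝ))) W :=
  fun _ hθ => ⟨W, hW, hθ, Subset.rfl, F, hF, h⟩

/-- A first integral of a nonvanishing vector field with prescribed differential at a point. -/
theorem exists_firstIntegral {V : Set J1} (hV : IsOpen V) {Z : J1 → J1}
    (hZ : ContDiffOn ℝ ∞ Z V) {θ : J1} (hθ : θ ∈ V) (hZθ : Z θ ≠ 0) {μ : J1 →L[ℝ] ℝ}
    (hμ : μ (Z θ) = 0) :
    ∃ N : Set J1, IsOpen N ∧ θ ∈ N ∧ N ⊆ V ∧ ∃ g : J1 → ℝ, ContDiffOn ℝ ∞ g N ∧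
      fderiv ℝ g θ = μ ∧ ∀ η ∈ N, fderiv ℝ g η (Z η) = 0 := by
  obtain ⟨e, hes, heθ, hed, het, hec, hesc, heZ⟩ := exists_flowBox hV hZ hθ hZθ
  have hθt : θ ∈ e.target := by
    have := e.map_source hes
    rwa [heθ] at this
  have hsθ : e.symm θ = θ := by
    have := e.left_inv hes
    rwa [heθ] at this
  have hinv : ∀ y ∈ e.target, (fderiv ℝ e.symm y).comp (fderiv ℝ e (e.symm y))
      = ContinuousLinearMap.id ℝ J1 := by
    intro y hy
    have h1 := fderiv_symm_comp_fderiv hec hesc (e.map_target hy)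
    rwa [e.right_inv hy] at h1
  have hd : ∀ y ∈ e.target, fderiv ℝ (fun y => μ (e.symm y)) y = μ.comp (fderiv ℝ e.symm y) :=
    fun y hy => (μ.hasFDerivAt.comp y (hasFDerivAt_of_contDiffOn hesc e.open_target hy)).fderiv
  refine ⟨e.target, e.open_target, hθt, het, fun y => μ (e.symm y),
    μ.contDiff.comp_contDiffOn hesc, ?_, fun y hy => ?_⟩
  · have h1 := hinv θ hθt
    rw [hsθ, hed, ContinuousLinearMap.comp_id] at h1
    rw [hd θ hθt, h1, ContinuousLinearMap.comp_id]
  · have h1 := congrArg (fun T : J1 →L[ℝ] J1 => T (Z θ)) (hinv y hy)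
    simp only [ContinuousLinearMap.comp_apply, ContinuousLinearMap.id_apply] at h1
    rw [heZ _ (e.map_target hy), e.right_inv hy] at h1
    rw [hd y hy, ContinuousLinearMap.comp_apply, h1, hμ]

variable {Z : J1 → J1} {V : Set J1}

/-- Invariance of the span of a triple containing `U, Z(U)`: integrability of the kernel. -/
theorem exists_integrable_of_triple (hV : IsOpen V) (hZ : ContDiffOn ℝ ∞ Z V)
    {θ : J1} (hθ : θ ∈ V) (hZθ : Z θ ≠ 0)
    {α : Fin 3 → OneForm} (hα : ∀ i, ContDiffOn ℝ ∞ (α i) V) (hα0 : α 0 = contactForm)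
    (hαZ : ∀ η ∈ V, ∀ i, α i η (Z η) = 0) (hind : LinearIndependent ℝ fun i => α i θ)
    {V₁ : Set J1} (hV₁ : V ⊆ closure V₁)
    (hinv : ∀ η ∈ V, η ∈ V₁ → ∀ v, (∀ i, α i η v = 0) → ∀ i, lieDerivOne Z (α i) η v = 0) :
    ∃ W : Set J1, IsOpen W ∧ θ ∈ W ∧ W ⊆ V ∧ ∃ E : J1 → Submodule ℝ J1,
      IsIntegrableOn E W ∧ ∀ η ∈ W, E η ≤ contactPlane η ∧ Z η ∈ E η := by
  obtain ⟨W, hW, hθW, hWV, F, hF, hFW⟩ := exists_firstIntegrals (by simp) hV hV₁ hZ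
    (contDiffOn_formTuple hα) (fun η hη => formTuple_eq_zero.2 (hαZ η hη)) hθ hZθ
    (formTuple_surjective hind) (fun η hη hη₁ v hv => by
      rw [lieDeriv_formTuple hV hα Z hη]
      exact funext (hinv η hη hη₁ v (formTuple_eq_zero.1 hv)))
  refine ⟨W, hW, hθW, hWV, _, isIntegrableOn_ker hW hF hFW, fun η hη => ⟨fun v hv => ?_, ?_⟩⟩
  · have h1 := formTuple_eq_zero.1 (LinearMap.mem_ker.1 hv) 0
    rw [hα0] at h1
    exact h1
  · exact formTuple_eq_zero.2 (hαZ η (hWV hη))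

/-- The points where `U, Z(U), Z²(U)` are independent are dense when the type is three. -/
theorem subset_closure_of_type_three (hV : IsOpen V) (hZ : ContDiffOn ℝ ∞ Z V)
    (hU : ∀ η ∈ V, contactForm η (Z η) = 0) (hZ0 : ∀ η ∈ V, Z η ≠ 0) (h3 : HasTypeOn Z V 3) :
    V ⊆ closure (V ∩ {η | LinearIndependent ℝ fun i : Fin 3 =>
      lieContact Z ((![0, 1, 2] : Fin 3 → Fin 4) i) η}) := by
  intro η hη
  by_contra hcl
  let N := V ∩ (closure (V ∩ {η | LinearIndependent ℝ fun i : Fin 3 =>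
      lieContact Z ((![0, 1, 2] : Fin 3 → Fin 4) i) η}))ᶜ
  have hN : IsOpen N := hV.inter isClosed_closure.isOpen_compl
  have hNV : N ⊆ V := inter_subset_left
  let α : Fin 2 → OneForm := fun i => lieContact Z ((![0, 1] : Fin 2 → Fin 4) i)
  have hα : ∀ i, ContDiffOn ℝ ∞ (α i) N := fun i => (contDiffOn_lieContact hV hZ _).mono hNV
  have hsurj : ∀ ξ ∈ V, Function.Surjective (formTuple α ξ) := fun ξ hξ =>
    formTuple_surjective (linearIndependent_lieContact_two hV hZ hU hξ (hZ0 ξ hξ))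
  have h2 : ∀ ξ ∈ N, ∀ v, formTuple α ξ v = 0 → lieContact Z 2 ξ v = 0 := by
    intro ξ hξ
    by_contra! hcon
    obtain ⟨v, hv, hv2⟩ := hcon
    refine hξ.2 (subset_closure ⟨hξ.1, ?_⟩)
    exact linearIndependent_triple (linearIndependent_lieContact_two hV hZ hU hξ.1 (hZ0 ξ hξ.1))
      rfl rfl (formTuple_eq_zero.1 hv 0) (formTuple_eq_zero.1 hv 1) hv2
  -- If Z²(U) depends on U and Z(U) throughout an open set, their kernel is invariant under Z there,
  -- so Z³(U) depends on them as well and the rank is too small.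
  have h4 : lieRank Z η ≤ 2 := by
    refine lieRank_le (hsurj η hη) fun v hv j => ?_
    fin_cases j
    · exact formTuple_eq_zero.1 hv 0
    · exact formTuple_eq_zero.1 hv 1
    · exact h2 η ⟨hη, hcl⟩ v hv
    · change lieContact Z (2 + 1) η v = 0
      rw [lieContact_succ]
      refine lieDerivOne_apply_eq_zero hN (contDiffOn_formTuple hα)
        ((contDiffOn_lieContact hV hZ 2).mono hNV) ⟨hη, hcl⟩ (hsurj η hη) h2 (fun u hu => ?_) hv
      rw [lieDeriv_formTuple hN hα Z ⟨hη, hcl⟩]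
      ext i
      fin_cases i
      · change lieDerivOne Z (lieContact Z 0) η u = 0
        rw [← lieContact_succ]
        exact formTuple_eq_zero.1 hu 1
      · change lieDerivOne Z (lieContact Z 1) η u = 0
        rw [← lieContact_succ]
        exact h2 η ⟨hη, hcl⟩ u hu
  have := h3 η hη
  change lieRank Z η = 3 at this
  omega

/-- When the type is three, `Z⁴(U)` belongs to the span of the preceding forms on a dense set. -/
theorem lieContact_four_apply (hV : IsOpen V) (hZ : ContDiffOn ℝ ∞ Z V) (h3 : HasTypeOn Z V 3)
    {η : J1} (hη : η ∈ V ∩ {η | LinearIndependent ℝ fun i : Fin 3 =>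
      lieContact Z ((![0, 1, 2] : Fin 3 → Fin 4) i) η}) {v : J1}
    (hv : ∀ j : Fin 4, lieContact Z j η v = 0) : lieContact Z 4 η v = 0 := by
  let α : Fin 3 → OneForm := fun i => lieContact Z ((![0, 1, 2] : Fin 3 → Fin 4) i)
  have hα : ∀ i, ContDiffOn ℝ ∞ (α i) V := fun i => contDiffOn_lieContact hV hZ _
  have hN := isOpen_linearIndependent hV hα
  have hNV : V ∩ {η | LinearIndependent ℝ fun i => α i η} ⊆ V := inter_subset_left
  rw [show (4 : ℕ) = 3 + 1 from rfl, lieContact_succ]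
  refine lieDerivOne_apply_eq_zero hN (contDiffOn_formTuple fun i => (hα i).mono hNV)
    ((contDiffOn_lieContact hV hZ 3).mono hNV) hη (formTuple_surjective hη.2)
    (fun ξ hξ u hu => lieContact_apply_eq_zero hξ.2 (h3 ξ hξ.1) (formTuple_eq_zero.1 hu) 3)
    (fun u hu => ?_) (formTuple_eq_zero.2 fun i => hv _)
  rw [lieDeriv_formTuple hV hα Z hη.1]
  have hu' := lieContact_apply_eq_zero hη.2 (h3 η hη.1) (formTuple_eq_zero.1 hu)
  ext i
  fin_cases i
  · change lieDerivOne Z (lieContact Z 0) η u = 0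
    rw [← lieContact_succ]
    exact hu' 1
  · change lieDerivOne Z (lieContact Z 1) η u = 0
    rw [← lieContact_succ]
    exact hu' 2
  · change lieDerivOne Z (lieContact Z 2) η u = 0
    rw [← lieContact_succ]
    exact hu' 3

/-- At θ the form Z²(U) may depend on U and Z(U), with Z³(U) completing the basis instead, hence the
index m. Invariance of the kernel requires Z⁴(U) to be in the span, which is known on the dense set
where U, Z(U), Z²(U) are independent; that is why Frobenius is used in its dense form. -/
theorem exists_integrable_of_type_three (hV : IsOpen V) (hZ : ContDiffOn ℝ ∞ Z V)
    (hU : ∀ η ∈ V, contactForm η (Z η) = 0) (hZ0 : ∀ η ∈ V, Z η ≠ 0) (h3 : HasTypeOn Z V 3)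
    {θ : J1} (hθ : θ ∈ V) {m : Fin 4} (hm : LinearIndependent ℝ fun i : Fin 3 =>
      lieContact Z ((![0, 1, m] : Fin 3 → Fin 4) i) θ) :
    ∃ W : Set J1, IsOpen W ∧ θ ∈ W ∧ W ⊆ V ∧ ∃ E : J1 → Submodule ℝ J1,
      IsIntegrableOn E W ∧ ∀ η ∈ W, E η ≤ contactPlane η ∧ Z η ∈ E η := by
  let α : Fin 3 → OneForm := fun i => lieContact Z ((![0, 1, m] : Fin 3 → Fin 4) i)
  have hα : ∀ i, ContDiffOn ℝ ∞ (α i) V := fun i => contDiffOn_lieContact hV hZ _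
  have hN := isOpen_linearIndependent hV hα
  have hNV : V ∩ {η | LinearIndependent ℝ fun i => α i η} ⊆ V := inter_subset_left
  obtain ⟨W, hW, hθW, hWN, E, hE, hEW⟩ := exists_integrable_of_triple hN (hZ.mono hNV)
    ⟨hθ, hm⟩ (hZ0 θ hθ) (fun i => (hα i).mono hNV) rfl
    (fun η hη i => lieContact_apply_self hV hZ hU _ η hη.1) hm
    (hNV.trans (subset_closure_of_type_three hV hZ hU hZ0 h3)) (by
      intro η hη hη₁ v hv
      have h4 := lieContact_apply_eq_zero hη.2 (h3 η hη.1) hv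
      have h5 : ∀ j : Fin 4, lieDerivOne Z (lieContact Z j) η v = 0 := by
        intro j
        rw [← lieContact_succ]
        fin_cases j
        · exact h4 1
        · exact h4 2
        · exact h4 3
        · exact lieContact_four_apply hV hZ h3 hη₁ h4
      exact fun i => h5 _)
  exact ⟨W, hW, hθW, hWN.trans hNV, E, hE, hEW⟩

/-- The kernel of U and Z(U) has rank three and is invariant under Z. Adding dg, for a first
integral g of Z whose differential is nonzero on that kernel, preserves invariance because Z(dg) =
d(Z(g)) = 0. -/
theorem exists_integrable_of_type_two (hV : IsOpen V) (hZ : ContDiffOn ℝ ∞ Z V)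
    (hU : ∀ η ∈ V, contactForm η (Z η) = 0) (hZ0 : ∀ η ∈ V, Z η ≠ 0) (h2 : HasTypeOn Z V 2)
    {θ : J1} (hθ : θ ∈ V) :
    ∃ W : Set J1, IsOpen W ∧ θ ∈ W ∧ W ⊆ V ∧ ∃ E : J1 → Submodule ℝ J1,
      IsIntegrableOn E W ∧ ∀ η ∈ W, E η ≤ contactPlane η ∧ Z η ∈ E η := by
  let β : Fin 2 → OneForm := fun i => lieContact Z ((![0, 1] : Fin 2 → Fin 4) i)
  have hli : ∀ η ∈ V, LinearIndependent ℝ fun i => β i η := fun η hη =>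
    linearIndependent_lieContact_two hV hZ hU hη (hZ0 η hη)
  -- a vector transversal to `Z` in the kernel of `U, Z(U)`
  obtain ⟨v, hv, hvZ⟩ : ∃ v, formTuple β θ v = 0 ∧ v ∉ Submodule.span ℝ {Z θ} := by
    by_contra! hcon
    have h1 := LinearMap.finrank_range_add_finrank_ker (formTuple β θ : J1 →ₗ[ℝ] (Fin 2 → ℝ))
    rw [LinearMap.range_eq_top.2 (formTuple_surjective (hli θ hθ)), finrank_top, finrank_J1,
      Module.finrank_fin_fun] at h1
    have h3 : LinearMap.ker (formTuple β θ : J1 →ₗ[ℝ] (Fin 2 → ℝ)) ≤ Submodule.span ℝ {Z θ} :=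
      fun v hv => hcon v hv
    have h4 := Submodule.finrank_mono h3
    rw [finrank_span_singleton (hZ0 θ hθ)] at h4
    omega
  obtain ⟨μ', hμv, hμZ⟩ := Submodule.exists_le_ker_of_notMem hvZ
  let μ : J1 →L[ℝ] ℝ := μ'.toContinuousLinearMap
  have hμZ' : μ (Z θ) = 0 := hμZ (Submodule.mem_span_singleton_self _)
  obtain ⟨N, hN, hθN, hNV, g, hg, hgθ, hgZ⟩ := exists_firstIntegral hV hZ hθ (hZ0 θ hθ) hμZ'
  have hg' : ContDiffOn ℝ ∞ (fderiv ℝ g) N := hg.fderiv_of_isOpen hN (by simp)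
  let α : Fin 3 → OneForm := ![contactForm, lieContact Z 1, fderiv ℝ g]
  have hind : LinearIndependent ℝ fun i => α i θ := by
    refine linearIndependent_triple (hli θ hθ) rfl rfl (formTuple_eq_zero.1 hv 0)
      (formTuple_eq_zero.1 hv 1) ?_
    change fderiv ℝ g θ v ≠ 0
    rw [hgθ]
    exact hμv
  obtain ⟨W, hW, hθW, hWN, E, hE, hEW⟩ :=
      exists_integrable_of_triple (α := α) hN (hZ.mono hNV) hθN (hZ0 θ hθ) (by
      intro i
      fin_cases i
      · exact contDiff_contactForm.contDiffOn
      · exact (contDiffOn_lieContact hV hZ 1).mono hNV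
      · exact hg') rfl (by
      intro η hη i
      fin_cases i
      · exact hU η (hNV hη)
      · exact lieContact_apply_self hV hZ hU 1 η (hNV hη)
      · exact hgZ η hη) hind subset_closure (by
      intro η hη _ u hu i
      fin_cases i
      · change lieDerivOne Z (lieContact Z 0) η u = 0
        rw [← lieContact_succ]
        exact hu 1
      · change lieDerivOne Z (lieContact Z 1) η u = 0
        rw [← lieContact_succ]
        refine lieContact_apply_eq_zero (hli η (hNV hη)) (h2 η (hNV hη)) (fun i => ?_) 2
        fin_cases i
        · exact hu 0
        · exact hu 1
      · change lieDerivOne Z (fderiv ℝ g) η u = 0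
        rw [lieDerivOne_apply, lieDeriv_fderiv hN hg (hZ.mono hNV) hη,
          fderiv_eq_zero_of_eqOn hN hgZ hη]
        rfl)
  exact ⟨W, hW, hθW, hWN.trans hNV, E, hE, hEW⟩

/-- A nonvanishing Cartan field of type less than four is locally contained in an integrable
lagrangian distribution. -/
theorem exists_integrable_of_type_lt_four (hV : IsOpen V) (hZ : ContDiffOn ℝ ∞ Z V)
    (hU : ∀ η ∈ V, contactForm η (Z η) = 0) (hZ0 : ∀ η ∈ V, Z η ≠ 0) {k : ℕ} (hk : k < 4)
    (htype : HasTypeOn Z V k) {θ : J1} (hθ : θ ∈ V) :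
    ∃ W : Set J1, IsOpen W ∧ θ ∈ W ∧ W ⊆ V ∧ ∃ E : J1 → Submodule ℝ J1,
      IsIntegrableOn E W ∧ ∀ η ∈ W, E η ≤ contactPlane η ∧ Z η ∈ E η := by
  have hli := linearIndependent_lieContact_two hV hZ hU hθ (hZ0 θ hθ)
  have h2 : 2 ≤ k := (htype θ hθ) ▸ card_le_lieRank hli
  have hk23 : k = 2 ∨ k = 3 := by omega
  obtain rfl | rfl := hk23
  · exact exists_integrable_of_type_two hV hZ hU hZ0 htype hθ
  · -- one of `Z²(U)`, `Z³(U)` completes `U, Z(U)` to a basis of the span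
    obtain ⟨m, v, hv, hmv⟩ : ∃ (m : Fin 4) (v : J1),
        (∀ i, lieContact Z ((![0, 1] : Fin 2 → Fin 4) i) θ v = 0) ∧ lieContact Z m θ v ≠ 0 := by
      by_contra! hcon
      have h1 : lieRank Z θ ≤ 2 := lieRank_le (α := fun i => lieContact Z
        ((![0, 1] : Fin 2 → Fin 4) i)) (formTuple_surjective hli)
        fun v hv j => hcon j v (formTuple_eq_zero.1 hv)
      have h3 := htype θ hθ
      change lieRank Z θ = 3 at h3
      omega
    refine exists_integrable_of_type_three hV hZ hU hZ0 htype hθ (m := m) ?_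
    exact linearIndependent_triple hli rfl rfl (hv 0) (hv 1) hmv

end FieldsOfLowType

end ParabolicMAE

namespace ParabolicMAE

/-! ### Partial Legendre transformations as contact charts. -/

section LegendreCharts

open Topology Set

/-- Partial Legendre transformations, for `ε, δ ∈ {0, 1}`. -/
def legendre (ε δ : ℝ) (θ : J1) : J1 :=
  ![(1 - ε) * θ 0 + ε * θ 3, (1 - δ) * θ 1 + δ * θ 4, θ 2 - ε * (θ 0 * θ 3) - δ * (θ 1 * θ 4),
    (1 - ε) * θ 3 - ε * θ 0, (1 - δ) * θ 4 - δ * θ 1]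

/-- The inverse of `legendre`. -/
def legendreSymm (ε δ : ℝ) (θ : J1) : J1 :=
  ![(1 - ε) * θ 0 - ε * θ 3, (1 - δ) * θ 1 - δ * θ 4, θ 2 - ε * (θ 0 * θ 3) - δ * (θ 1 * θ 4),
    (1 - ε) * θ 3 + ε * θ 0, (1 - δ) * θ 4 + δ * θ 1]

theorem contDiff_legendre (ε δ : ℝ) : ContDiff ℝ ∞ (legendre ε δ) := by
  rw [contDiff_pi]
  intro i
  fin_cases i <;> simp [legendre] <;> fun_prop

theorem contDiff_legendreSymm (ε δ : ℝ) : ContDiff ℝ ∞ (legendreSymm ε δ) := by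
  rw [contDiff_pi]
  intro i
  fin_cases i <;> simp [legendreSymm] <;> fun_prop

theorem fderiv_legendre (ε δ : ℝ) (θ v : J1) : fderiv ℝ (legendre ε δ) θ v =
    ![(1 - ε) * v 0 + ε * v 3, (1 - δ) * v 1 + δ * v 4,
      v 2 - ε * (θ 0 * v 3 + θ 3 * v 0) - δ * (θ 1 * v 4 + θ 4 * v 1),
      (1 - ε) * v 3 - ε * v 0, (1 - δ) * v 4 - δ * v 1] := by
  have h := ((contDiff_legendre ε δ).contDiffAt (x := θ)).differentiableAt (by simp)
  have hx : ∀ i, HasFDerivAt (fun θ : J1 => θ i)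
      (ContinuousLinearMap.proj (R := ℝ) (φ := fun _ : Fin 5 => ℝ) i) θ :=
    fun i => hasFDerivAt_apply i θ
  have hc := hasFDerivAt_pi'.1 h.hasFDerivAt
  ext i
  have key : ∀ {L : J1 →L[ℝ] ℝ}, HasFDerivAt (fun θ => legendre ε δ θ i) L θ →
      fderiv ℝ (legendre ε δ) θ v i = L v := fun hL =>
    congrArg (fun T : J1 →L[ℝ] ℝ => T v) ((hc i).unique hL)
  fin_cases i
  · rw [key (((hx 0).const_mul (1 - ε)).add ((hx 3).const_mul ε))]
    simp
  · rw [key (((hx 1).const_mul (1 - δ)).add ((hx 4).const_mul δ))]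
    simp
  · rw [key (((hx 2).sub (((hx 0).mul (hx 3)).const_mul ε)).sub
      (((hx 1).mul (hx 4)).const_mul δ))]
    simp
    ring
  · rw [key (((hx 3).const_mul (1 - ε)).sub ((hx 0).const_mul ε))]
    simp
  · rw [key (((hx 4).const_mul (1 - δ)).sub ((hx 1).const_mul δ))]
    simp

theorem contactForm_fderiv_legendre {ε δ : ℝ} (hε : ε * ε = ε) (hδ : δ * δ = δ) (θ v : J1) :
    contactForm (legendre ε δ θ) (fderiv ℝ (legendre ε δ) θ v) = contactForm θ v := by
  rw [fderiv_legendre, contactForm_apply, contactForm_apply]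
  simp [legendre]
  linear_combination (θ 0 * v 3 - θ 3 * v 0 + θ 3 * v 3 - θ 0 * v 0) * hε
    + (θ 1 * v 4 - θ 4 * v 1 + θ 4 * v 4 - θ 1 * v 1) * hδ

theorem dU_fderiv_legendre {ε δ : ℝ} (hε : ε * ε = ε) (hδ : δ * δ = δ) (θ v w : J1) :
    dU (legendre ε δ θ) (fderiv ℝ (legendre ε δ) θ v) (fderiv ℝ (legendre ε δ) θ w)
      = dU θ v w := by
  rw [fderiv_legendre, fderiv_legendre, dU_apply, dU_apply]
  simp
  linear_combination 2 * (v 0 * w 3 - v 3 * w 0) * hε + 2 * (v 1 * w 4 - v 4 * w 1) * hδ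

/-- The restriction of a partial Legendre transformation to an open set. -/
noncomputable def legendreChart {ε δ : ℝ} (hε : ε * ε = ε) (hδ : δ * δ = δ) (V : Set J1)
    (hV : IsOpen V) : OpenPartialHomeomorph J1 J1 :=
  Homeomorph.toOpenPartialHomeomorphOfImageEq
    { toFun := legendre ε δ
      invFun := legendreSymm ε δ
      left_inv := fun θ => by
        ext i
        fin_cases i <;> simp [legendre, legendreSymm]
        · linear_combination 2 * θ 0 * hε
        · linear_combination 2 * θ 1 * hδ
        · linear_combination (2 * θ 0 * θ 3 + ε * (θ 3 ^ 2 - θ 0 ^ 2)) * hε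
            + (2 * θ 1 * θ 4 + δ * (θ 4 ^ 2 - θ 1 ^ 2)) * hδ
        · linear_combination 2 * θ 3 * hε
        · linear_combination 2 * θ 4 * hδ
      right_inv := fun θ => by
        ext i
        fin_cases i <;> simp [legendre, legendreSymm]
        · linear_combination 2 * θ 0 * hε
        · linear_combination 2 * θ 1 * hδ
        · linear_combination (2 * θ 0 * θ 3 - ε * (θ 3 ^ 2 - θ 0 ^ 2)) * hε
            + (2 * θ 1 * θ 4 - δ * (θ 4 ^ 2 - θ 1 ^ 2)) * hδ
        · linear_combination 2 * θ 3 * hε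
        · linear_combination 2 * θ 4 * hδ
      continuous_toFun := (contDiff_legendre ε δ).continuous
      continuous_invFun := (contDiff_legendreSymm ε δ).continuous }
    V hV _ rfl

theorem isContactChart_legendreChart {ε δ : ℝ} (hε : ε * ε = ε) (hδ : δ * δ = δ) {V : Set J1}
    (hV : IsOpen V) : IsContactChart (legendreChart hε hδ V hV) := by
  refine ⟨(contDiff_legendre ε δ).contDiffOn, (contDiff_legendreSymm ε δ).contDiffOn,
    fun θ _ => ⟨1, one_ne_zero, ?_⟩⟩
  ext v
  rw [one_smul]
  exact contactForm_fderiv_legendre hε hδ θ v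

/-- A lagrangian plane projects isomorphically to the `x, y`-plane after a suitable partial
Legendre transformation. -/
theorem exists_legendre_transversal {θ : J1} {E : Submodule ℝ J1} (hE : E ≤ contactPlane θ)
    (h2 : Module.finrank ℝ E = 2) (hiso : ∀ v ∈ E, ∀ w ∈ E, dU θ v w = 0) :
    ∃ ε δ : ℝ, ε * ε = ε ∧ δ * δ = δ ∧ ∀ v ∈ E, fderiv ℝ (legendre ε δ) θ v 0 = 0 →
      fderiv ℝ (legendre ε δ) θ v 1 = 0 → v = 0 := by
  by_contra! hcon
  have : Module.Finite ℝ E := Module.finite_of_finrank_eq_succ h2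
  let B := Module.finBasisOfFinrankEq ℝ E h2
  let a : J1 := B 0
  let b : J1 := B 1
  have hli : ∀ s t : ℝ, s • a + t • b = 0 → s = 0 ∧ t = 0 := by
    intro s t hst
    have h1 := Fintype.linearIndependent_iff.1 B.linearIndependent ![s, t] (by
      rw [Fin.sum_univ_two]
      exact Subtype.ext hst)
    exact ⟨h1 0, h1 1⟩
  have hspan : ∀ v ∈ E, ∃ s t : ℝ, v = s • a + t • b := by
    intro v hv
    have h1 := congrArg Subtype.val (B.sum_repr ⟨v, hv⟩)
    rw [Fin.sum_univ_two] at h1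
    exact ⟨_, _, h1.symm⟩
  -- Failure of transversality in one of the four charts is the vanishing of one Plücker coordinate
  -- of E: that of (x, y), (x, q), (p, y) or (p, q).
  have hminor : ∀ i j : Fin 5, (∃ v ∈ E, v i = 0 ∧ v j = 0 ∧ v ≠ 0) →
      a i * b j - a j * b i = 0 := by
    rintro i j ⟨v, hv, hi, hj, hv0⟩
    obtain ⟨s, t, rfl⟩ := hspan v hv
    simp only [Pi.add_apply, Pi.smul_apply, smul_eq_mul] at hi hj
    by_contra hne
    have hs : s = 0 := (mul_eq_zero.1 (show s * (a i * b j - a j * b i) = 0 by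
      linear_combination b j * hi - b i * hj)).resolve_right hne
    have ht : t = 0 := (mul_eq_zero.1 (show t * (a i * b j - a j * b i) = 0 by
      linear_combination a i * hj - a j * hi)).resolve_right hne
    exact hv0 (by rw [hs, ht]; simp)
  have h01 := hminor 0 1 (by
    obtain ⟨v, hv, h0, h1, hv0⟩ := hcon 0 0 (by norm_num) (by norm_num)
    simp only [fderiv_legendre] at h0 h1
    exact ⟨v, hv, by simpa using h0, by simpa using h1, hv0⟩)
  have h04 := hminor 0 4 (by
    obtain ⟨v, hv, h0, h1, hv0⟩ := hcon 0 1 (by norm_num) (by norm_num)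
    simp only [fderiv_legendre] at h0 h1
    exact ⟨v, hv, by simpa using h0, by simpa using h1, hv0⟩)
  have h31 := hminor 3 1 (by
    obtain ⟨v, hv, h0, h1, hv0⟩ := hcon 1 0 (by norm_num) (by norm_num)
    simp only [fderiv_legendre] at h0 h1
    exact ⟨v, hv, by simpa using h0, by simpa using h1, hv0⟩)
  have h34 := hminor 3 4 (by
    obtain ⟨v, hv, h0, h1, hv0⟩ := hcon 1 1 (by norm_num) (by norm_num)
    simp only [fderiv_legendre] at h0 h1
    exact ⟨v, hv, by simpa using h0, by simpa using h1, hv0⟩)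
  have haE : a ∈ E := (B 0).2
  have hbE : b ∈ E := (B 1).2
  have hab := hiso a haE b hbE
  rw [dU_apply] at hab
  -- Isotropy makes the two remaining coordinates p₀₃ and p₁₄ opposite, while the Plücker relation
  -- makes their product zero.
  have h03 : a 0 * b 3 - a 3 * b 0 = 0 := by
    have h1 : (a 0 * b 3 - a 3 * b 0) * (a 0 * b 3 - a 3 * b 0) = 0 := by
      linear_combination (a 0 * b 3 - a 3 * b 0) * hab - (a 3 * b 4 - a 4 * b 3) * h01
        + (a 3 * b 1 - a 1 * b 3) * h04
    exact mul_self_eq_zero.1 h1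
  have h14 : a 1 * b 4 - a 4 * b 1 = 0 := by linear_combination hab - h03
  -- With all 2×2 minors zero, a i • b - b i • a vanishes, and independence of a and b makes a i
  -- zero.
  have key : ∀ i : Fin 5, (a i * b 0 - a 0 * b i = 0) → (a i * b 1 - a 1 * b i = 0) →
      (a i * b 3 - a 3 * b i = 0) → (a i * b 4 - a 4 * b i = 0) → a i = 0 := by
    intro i e0 e1 e3 e4
    have h1 : (-b i) • a + a i • b = 0 := by
      rw [eq_cartanVec (Submodule.add_mem _ (Submodule.smul_mem _ (-b i) (hE haE))
        (Submodule.smul_mem _ (a i) (hE hbE)))]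
      ext j
      fin_cases j <;> simp [cartanVec]
      · linear_combination e0
      · linear_combination e1
      · linear_combination θ 3 * e0 + θ 4 * e1
      · linear_combination e3
      · linear_combination e4
    exact (hli _ _ h1).2
  have ha : a = 0 := by
    rw [eq_cartanVec (hE haE), key 0 (by ring) h01 h03 h04,
      key 1 (by linear_combination -h01) (by ring) (by linear_combination -h31) h14,
      key 3 (by linear_combination -h03) h31 (by ring) h34,
      key 4 (by linear_combination -h04) (by linear_combination -h14)
        (by linear_combination -h34) (by ring)]
    ext j
    fin_cases j <;> simp [cartanVec]
  exact one_ne_zero (hli 1 0 (by rw [ha]; simp)).1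

end LegendreCharts

end ParabolicMAE

namespace ParabolicMAE

/-! ### Complete integrals as sections of J². -/

section Sections

open Topology Set

theorem inChart_apply (Φ : OpenPartialHomeomorph J1 J1) (ρ : TwoForm) (η v w : J1) :
    inChart Φ ρ η ![v, w]
      = ρ (Φ.symm η) ![fderiv ℝ Φ.symm η v, fderiv ℝ Φ.symm η w] := by
  change ρ (Φ.symm η) (fderiv ℝ Φ.symm η ∘ ![v, w]) = _
  congr 1
  ext i : 1
  fin_cases i <;> rfl

theorem HasIntegrableSection.hasCompleteIntegral {ρ : TwoForm} {V : Set J1}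
    (h : HasIntegrableSection ρ V) : HasCompleteIntegral ρ V := by
  obtain ⟨E, Φ, σ, hE, hlag, rfl, ⟨hΦ, hΦs, -⟩, -, hproj, hmap, heq⟩ := h
  refine ⟨E, hE, fun θ hθ => ⟨fun v hv => ?_, fun v hv w hw => ?_⟩⟩
  · rw [hlag θ hθ] at hv
    exact hv.1
  · have hmem : ∀ u ∈ E θ, fderiv ℝ Φ θ u ∈ rPlane (σ (Φ θ)) := fun u hu => by
      rw [← hmap θ hθ]
      exact ⟨u, hu, rfl⟩
    have h1 := heq (Φ θ) (Φ.map_source hθ) _ (hmem v hv) _ (hmem w hw)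
    have h2 : ∀ u, fderiv ℝ Φ.symm (Φ θ) (fderiv ℝ Φ θ u) = u := fun u =>
      congrArg (fun T : J1 →L[ℝ] J1 => T u) (fderiv_symm_comp_fderiv hΦ hΦs hθ)
    rwa [hproj _ (Φ.map_source hθ), inChart_apply, Φ.left_inv hθ, h2, h2] at h1

/-- An integrable lagrangian distribution is locally spanned by a pair of vector fields that
project to the coordinate fields `∂_x, ∂_y` in a suitable contact chart. -/
theorem exists_adapted_frame {E : J1 → Submodule ℝ J1} {V : Set J1} (hE : IsIntegrableOn E V)
    (hlag : IsLagrangianOn E V) {θ : J1} (hθ : θ ∈ V) :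
    ∃ ε δ : ℝ, ε * ε = ε ∧ δ * δ = δ ∧ ∃ N : Set J1, IsOpen N ∧ θ ∈ N ∧ N ⊆ V ∧
      ∃ a b : J1 → J1, ContDiffOn ℝ ∞ a N ∧ ContDiffOn ℝ ∞ b N ∧
        ∀ η ∈ N, E η = Submodule.span ℝ {a η, b η} ∧ fderiv ℝ (legendre ε δ) η (a η) 0 = 1 ∧
          fderiv ℝ (legendre ε δ) η (a η) 1 = 0 ∧ fderiv ℝ (legendre ε δ) η (b η) 0 = 0 ∧
          fderiv ℝ (legendre ε δ) η (b η) 1 = 1 := by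
  have hlag' : ∀ v ∈ E θ, v ∈ orthogonal θ (E θ) := fun v hv => hlag θ hθ ▸ hv
  obtain ⟨ε, δ, hε, hδ, htr⟩ := exists_legendre_transversal (fun v hv => (hlag' v hv).1)
    (finrank_of_isIntegrableOn hE hθ) (fun v hv => (hlag' v hv).2)
  refine ⟨ε, δ, hε, hδ, ?_⟩
  obtain ⟨W, hW, hθW, hWV, F, hF, hFE⟩ := hE θ hθ
  let dL : J1 → J1 →L[ℝ] J1 := fderiv ℝ (legendre ε δ)
  have hdL : ContDiff ℝ ∞ dL := (contDiff_legendre ε δ).fderiv_right (by simp)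
  have hF' : ContDiffOn ℝ ∞ (fderiv ℝ F) W := hF.fderiv_of_isOpen hW (by simp)
  let pr : Fin 5 → J1 →L[ℝ] ℝ := ContinuousLinearMap.proj (R := ℝ) (φ := fun _ : Fin 5 => ℝ)
  -- The first integrals together with the new x and y components. Transversality makes this square
  -- system invertible at θ, hence nearby; the frame consists of the preimages of the last two unit
  -- vectors.
  let T : J1 → J1 →L[ℝ] (Fin 3 → ℝ) × ℝ × ℝ := fun η =>
    (fderiv ℝ F η).prod (((pr 0).comp (dL η)).prod ((pr 1).comp (dL η)))
  have hT : ContDiffOn ℝ ∞ T W := by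
    rw [contDiffOn_clm_apply]
    intro v
    have h1 : ContDiffOn ℝ ∞ (fun η => dL η v) W :=
      hdL.contDiffOn.clm_apply contDiffOn_const
    exact (hF'.clm_apply contDiffOn_const).prodMk
      (((pr 0).contDiff.comp_contDiffOn h1).prodMk ((pr 1).contDiff.comp_contDiffOn h1))
  have hmem : ∀ η ∈ W, ∀ v, v ∈ E η ↔ (T η v).1 = 0 := fun η hη v => by
    rw [(hFE η hη).2]
    rfl
  have hinj : Function.Injective (T θ) := by
    rw [injective_iff_map_eq_zero]
    intro v hv
    exact htr v ((hmem θ hθW v).2 (congrArg (fun y : (Fin 3 → ℝ) × ℝ × ℝ => y.1) hv))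
      (congrArg (fun y : (Fin 3 → ℝ) × ℝ × ℝ => y.2.1) hv)
      (congrArg (fun y : (Fin 3 → ℝ) × ℝ × ℝ => y.2.2) hv)
  let T₀ : J1 ≃L[ℝ] (Fin 3 → ℝ) × ℝ × ℝ := (LinearEquiv.ofInjectiveOfFinrankEq
    (T θ : J1 →ₗ[ℝ] (Fin 3 → ℝ) × ℝ × ℝ) hinj (by simp)).toContinuousLinearEquiv
  have hN : IsOpen (W ∩ T ⁻¹' range
      ((↑) : (J1 ≃L[ℝ] (Fin 3 → ℝ) × ℝ × ℝ) → J1 →L[ℝ] (Fin 3 → ℝ) × ℝ × ℝ)) :=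
    hT.continuousOn.isOpen_inter_preimage hW ContinuousLinearEquiv.isOpen
  have hinv : ∀ y, ContDiffOn ℝ ∞ (fun η => (T η).inverse y) (W ∩ T ⁻¹' range
      ((↑) : (J1 ≃L[ℝ] (Fin 3 → ℝ) × ℝ × ℝ) → J1 →L[ℝ] (Fin 3 → ℝ) × ℝ × ℝ)) := by
    intro y
    refine ContDiffOn.clm_apply (fun η hη => ?_) contDiffOn_const
    obtain ⟨S, hS⟩ := hη.2
    have h1 : ContDiffAt ℝ ∞ ContinuousLinearMap.inverse (T η) := by
      rw [← hS]
      exact contDiffAt_map_inverse S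
    exact h1.comp_contDiffWithinAt η ((hT.mono inter_subset_left) η hη)
  refine ⟨_, hN, ⟨hθW, T₀, by ext1 v; rfl⟩, inter_subset_left.trans hWV,
    fun η => (T η).inverse (0, 1, 0), fun η => (T η).inverse (0, 0, 1), hinv _, hinv _, ?_⟩
  rintro η ⟨hηW, S, hS⟩
  have hTi : ∀ y, T η ((T η).inverse y) = y := fun y => by
    rw [← hS, ContinuousLinearMap.inverse_equiv]
    exact S.apply_symm_apply y
  have hTinj : ∀ v, T η v = 0 → v = 0 := fun v hv => by
    rw [← hS] at hv
    exact S.map_eq_zero_iff.1 hv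
  have ha := hTi (0, 1, 0)
  have hb := hTi (0, 0, 1)
  refine ⟨le_antisymm (fun v hv => ?_) ?_, congrArg (fun y : (Fin 3 → ℝ) × ℝ × ℝ => y.2.1) ha,
    congrArg (fun y : (Fin 3 → ℝ) × ℝ × ℝ => y.2.2) ha,
    congrArg (fun y : (Fin 3 → ℝ) × ℝ × ℝ => y.2.1) hb,
    congrArg (fun y : (Fin 3 → ℝ) × ℝ × ℝ => y.2.2) hb⟩
  · rw [Submodule.mem_span_pair]
    refine ⟨(T η v).2.1, (T η v).2.2, ?_⟩
    rw [← sub_eq_zero]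
    apply hTinj
    rw [map_sub, map_add, map_smul, map_smul, ha, hb]
    have h1 := (hmem η hηW v).1 hv
    refine Prod.ext ?_ (Prod.ext ?_ ?_) <;> simp [h1]
  · rw [Submodule.span_le]
    rintro _ (rfl | rfl)
    · exact (hmem η hηW _).2 (congrArg (fun y : (Fin 3 → ℝ) × ℝ × ℝ => y.1) ha)
    · exact (hmem η hηW _).2 (congrArg (fun y : (Fin 3 → ℝ) × ℝ × ℝ => y.1) hb)

/-- The adapted frame has x, y components (1, 0) and (0, 1). The contact form then fixes its z
components as p and q, and dU(a, b) = 0 equates the p component of b with the q component of a. So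
the frame is that of an R-plane, and r, s, t can be read off from it. -/
theorem IsCompleteIntegralOn.exists_section {ρ : TwoForm} {E : J1 → Submodule ℝ J1} {V : Set J1}
    (h : IsCompleteIntegralOn ρ E V) {θ : J1} (hθ : θ ∈ V) :
    ∃ N : Set J1, IsOpen N ∧ θ ∈ N ∧ N ⊆ V ∧ HasIntegrableSection ρ N := by
  have hlag := isLagrangianOn_of_isIntegrableOn h.1 fun η hη => (h.2 η hη).1
  obtain ⟨ε, δ, hε, hδ, N, hN, hθN, hNV, a, b, ha, hb, hab⟩ := exists_adapted_frame h.1 hlag hθ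
  refine ⟨N, hN, hθN, hNV, ?_⟩
  let Φ := legendreChart hε hδ N hN
  have hchart : IsContactChart Φ := isContactChart_legendreChart hε hδ hN
  let dL : J1 → J1 →L[ℝ] J1 := fderiv ℝ (legendre ε δ)
  have hdL : ContDiff ℝ ∞ dL := (contDiff_legendre ε δ).fderiv_right (by simp)
  let σ : J1 → J2 := fun η => ![η 0, η 1, η 2, η 3, η 4, dL (Φ.symm η) (a (Φ.symm η)) 3,
    dL (Φ.symm η) (a (Φ.symm η)) 4, dL (Φ.symm η) (b (Φ.symm η)) 4]
  have hsymm : MapsTo Φ.symm Φ.target N := fun η hη => Φ.map_target hη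
  have hσ : ContDiffOn ℝ ∞ σ Φ.target := by
    have hcomp : ∀ {c : J1 → J1}, ContDiffOn ℝ ∞ c N → ∀ i : Fin 5,
        ContDiffOn ℝ ∞ (fun η => dL (Φ.symm η) (c (Φ.symm η)) i) Φ.target := by
      intro c hc i
      have h1 : ContDiffOn ℝ ∞ (fun η => dL η (c η)) N := hdL.contDiffOn.clm_apply hc
      have h2 := h1.comp hchart.2.1 hsymm
      exact contDiffOn_pi.1 h2 i
    rw [contDiffOn_pi]
    intro i
    fin_cases i
    · exact (contDiff_apply ℝ ℝ (0 : Fin 5)).contDiffOn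
    · exact (contDiff_apply ℝ ℝ (1 : Fin 5)).contDiffOn
    · exact (contDiff_apply ℝ ℝ (2 : Fin 5)).contDiffOn
    · exact (contDiff_apply ℝ ℝ (3 : Fin 5)).contDiffOn
    · exact (contDiff_apply ℝ ℝ (4 : Fin 5)).contDiffOn
    · exact hcomp ha 3
    · exact hcomp ha 4
    · exact hcomp hb 4
  have hproj : ∀ η ∈ Φ.target, proj21 (σ η) = η := by
    intro η _
    ext i
    fin_cases i <;> rfl
  have hmap : ∀ η ∈ N, (E η).map (fderiv ℝ Φ η : J1 →ₗ[ℝ] J1) = rPlane (σ (Φ η)) := by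
    intro η hη
    obtain ⟨hspan, ha0, ha1, hb0, hb1⟩ := hab η hη
    have haE : a η ∈ E η := hspan ▸ Submodule.subset_span (by simp)
    have hbE : b η ∈ E η := hspan ▸ Submodule.subset_span (by simp)
    have hC : ∀ v ∈ E η, contactForm (legendre ε δ η) (dL η v) = 0 := fun v hv => by
      rw [contactForm_fderiv_legendre hε hδ]
      exact (h.2 η (hNV hη)).1 hv
    have hca := hC _ haE
    have hcb := hC _ hbE
    have haO : a η ∈ orthogonal η (E η) := hlag η (hNV hη) ▸ haE
    have hdU := haO.2 _ hbE
    rw [← dU_fderiv_legendre hε hδ, dU_apply, ha0, ha1, hb0, hb1] at hdU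
    rw [contactForm_apply] at hca hcb
    simp only [dL, ha0, ha1, hb0, hb1] at hca hcb
    have hs : Φ.symm (Φ η) = η := Φ.left_inv hη
    have hva : fderiv ℝ Φ η (a η) = ![1, 0, σ (Φ η) 3, σ (Φ η) 5, σ (Φ η) 6] := by
      change dL η (a η) = ![1, 0, legendre ε δ η 3, dL (Φ.symm (Φ η)) (a (Φ.symm (Φ η))) 3,
        dL (Φ.symm (Φ η)) (a (Φ.symm (Φ η))) 4]
      rw [hs]
      ext i
      fin_cases i
      · exact ha0
      · exact ha1
      · change dL η (a η) 2 = legendre ε δ η 3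
        linarith
      · rfl
      · rfl
    have hvb : fderiv ℝ Φ η (b η) = ![0, 1, σ (Φ η) 4, σ (Φ η) 6, σ (Φ η) 7] := by
      change dL η (b η) = ![0, 1, legendre ε δ η 4, dL (Φ.symm (Φ η)) (a (Φ.symm (Φ η))) 4,
        dL (Φ.symm (Φ η)) (b (Φ.symm (Φ η))) 4]
      rw [hs]
      ext i
      fin_cases i
      · exact hb0
      · exact hb1
      · change dL η (b η) 2 = legendre ε δ η 4
        linarith
      · change dL η (b η) 3 = dL η (a η) 4
        linarith
      · rfl
    rw [hspan, Submodule.map_span, image_pair, ContinuousLinearMap.coe_coe, hva, hvb, rPlane]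
  refine ⟨E, Φ, σ, h.1.mono hN hNV, fun η hη => hlag η (hNV hη), rfl, hchart, hσ, hproj, hmap,
    fun η hη v hv w hw => ?_⟩
  have hηN := hsymm hη
  have hv' := hmap _ hηN
  rw [Φ.right_inv hη] at hv'
  rw [← hv'] at hv hw
  obtain ⟨v, hv, rfl⟩ := hv
  obtain ⟨w, hw, rfl⟩ := hw
  have h2 : ∀ u, fderiv ℝ Φ.symm η (fderiv ℝ Φ (Φ.symm η) u) = u := fun u => by
    have h3 := congrArg (fun T : J1 →L[ℝ] J1 => T u)
      (fderiv_symm_comp_fderiv hchart.1 hchart.2.1 (x := Φ.symm η) hηN)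
    rwa [Φ.right_inv hη] at h3
  rw [hproj η hη, inChart_apply, ContinuousLinearMap.coe_coe, h2, h2]
  exact (h.2 _ (hNV hηN)).2 v hv w hw

end Sections

end ParabolicMAE

namespace ParabolicMAE

/-! ### Hamiltonian fields and the fields Z_f. -/

section Hamiltonian

open Topology Set

variable {f : J1 → ℝ} {V : Set J1}

theorem contDiffOn_hamiltonianField (hV : IsOpen V) (hf : ContDiffOn ℝ ∞ f V) :
    ContDiffOn ℝ ∞ (hamiltonianField f) V := by
  have hp : ∀ i, ContDiffOn ℝ ∞ (partialDeriv i f) V := fun i =>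
    (hf.fderiv_of_isOpen hV (by simp)).clm_apply contDiffOn_const
  have hc : ∀ i : Fin 5, ContDiffOn ℝ ∞ (fun θ : J1 => θ i) V := fun i =>
    (contDiff_apply ℝ ℝ i).contDiffOn
  rw [contDiffOn_pi]
  intro i
  fin_cases i
  · exact hp 3
  · exact hp 4
  · exact ((hc 3).mul (hp 3)).add ((hc 4).mul (hp 4))
  · exact ((hp 0).add ((hc 3).mul (hp 2))).neg
  · exact ((hp 1).add ((hc 4).mul (hp 2))).neg

theorem contDiffOn_fieldOf (hV : IsOpen V) (hf : ContDiffOn ℝ ∞ f V) {X Y : J1 → J1}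
    (hX : ContDiffOn ℝ ∞ X V) (hY : ContDiffOn ℝ ∞ Y V) : ContDiffOn ℝ ∞ (fieldOf X Y f) V := by
  have hf' : ContDiffOn ℝ ∞ (fderiv ℝ f) V := hf.fderiv_of_isOpen hV (by simp)
  exact ((hf'.clm_apply hY).smul hX).sub ((hf'.clm_apply hX).smul hY)

theorem fieldOf_mem_span (X Y : J1 → J1) (f : J1 → ℝ) (θ : J1) :
    fieldOf X Y f θ ∈ Submodule.span ℝ {X θ, Y θ} :=
  Submodule.sub_mem _ (Submodule.smul_mem _ _ (Submodule.subset_span (by simp)))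
    (Submodule.smul_mem _ _ (Submodule.subset_span (by simp)))

theorem fderiv_fieldOf (X Y : J1 → J1) (f : J1 → ℝ) (θ : J1) :
    fderiv ℝ f θ (fieldOf X Y f θ) = 0 := by
  rw [fieldOf, map_sub, map_smul, map_smul, smul_eq_mul, smul_eq_mul, mul_comm, sub_self]

theorem fderiv_hamiltonianField (f : J1 → ℝ) (θ : J1) :
    fderiv ℝ f θ (hamiltonianField f θ) = 0 := by
  have h := dU_hamiltonianField f θ (hamiltonianField f θ)
  rw [dU_self, show contactForm θ (hamiltonianField f θ) = 0 from hamiltonianField_mem f θ] at h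
  linarith

theorem dU_hamiltonianField_of_mem {θ w : J1} (hw : w ∈ contactPlane θ) :
    dU θ (hamiltonianField f θ) w = fderiv ℝ f θ w := by
  rw [dU_hamiltonianField, mem_contactPlane.1 hw, mul_zero, sub_zero]

end Hamiltonian

/-! ### The implications valid at every point. -/

section Implications

open Topology Set

variable {ρ : TwoForm} {X Y : J1 → J1} {V : Set J1}

theorem HasFieldOfTypeLTFour.exists_hasFieldInIntegrableLagrangian (hV : IsOpen V)
    (hpar : ∀ θ ∈ V, IsParabolicAt ρ θ)
    (hD : ∀ θ ∈ V, characteristicDistribution ρ θ = Submodule.span ℝ {X θ, Y θ})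
    (h : HasFieldOfTypeLTFour X Y V) {θ : J1} (hθ : θ ∈ V) :
    ∃ N : Set J1, IsOpen N ∧ θ ∈ N ∧ N ⊆ V ∧ HasFieldInIntegrableLagrangian X Y N := by
  obtain ⟨Z, ⟨hZ, hZm⟩, k, hk, htype⟩ := h
  obtain ⟨N, hN, hθN, hNV, E, hE, hEN⟩ := exists_integrable_of_type_lt_four hV hZ
    (fun η hη => (hpar η hη).characteristic_le (by rw [hD η hη]; exact (hZm η hη).2))
    (fun η hη => (hZm η hη).1) hk htype hθ
  exact ⟨N, hN, hθN, hNV, Z, E, ⟨hZ.mono hNV, fun η hη => hZm η (hNV hη)⟩, hE,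
    isLagrangianOn_of_isIntegrableOn hE fun η hη => (hEN η hη).1, fun η hη => (hEN η hη).2⟩

theorem HasFieldInIntegrableLagrangian.hasCompleteIntegral
    (hpar : ∀ θ ∈ V, IsParabolicAt ρ θ)
    (hD : ∀ θ ∈ V, characteristicDistribution ρ θ = Submodule.span ℝ {X θ, Y θ})
    (h : HasFieldInIntegrableLagrangian X Y V) : HasCompleteIntegral ρ V := by
  obtain ⟨Z, E, ⟨-, hZ⟩, hE, hlag, hZE⟩ := h
  refine ⟨E, hE, fun θ hθ => ⟨fun v hv => ?_, ?_⟩⟩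
  · rw [hlag θ hθ] at hv
    exact hv.1
  · exact (hpar θ hθ).twoForm_eq_zero (hlag θ hθ) (finrank_of_isIntegrableOn hE hθ) (hZE θ hθ)
      (by rw [hD θ hθ]; exact (hZ θ hθ).2) (hZ θ hθ).1

/-- The first integrals of a complete integral are determining functions. -/
theorem IsCompleteIntegralOn.exists_determiningFunction
    (hpar : ∀ θ ∈ V, IsParabolicAt ρ θ)
    (hD : ∀ θ ∈ V, characteristicDistribution ρ θ = Submodule.span ℝ {X θ, Y θ})
    (hX : ContDiffOn ℝ ∞ X V) (hY : ContDiffOn ℝ ∞ Y V) {E : J1 → Submodule ℝ J1}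
    (h : IsCompleteIntegralOn ρ E V) {θ : J1} (hθ : θ ∈ V) :
    ∃ N : Set J1, IsOpen N ∧ θ ∈ N ∧ N ⊆ V ∧ HasDeterminingFunction X Y N := by
  have hlag := isLagrangianOn_of_isIntegrableOn h.1 fun η hη => (h.2 η hη).1
  obtain ⟨W, hW, hθW, hWV, F, hF, hFE⟩ := h.1 θ hθ
  have hcomp : ∀ η ∈ W, ∀ i v, fderiv ℝ (fun η => F η i) η v = fderiv ℝ F η v i :=
    fun η hη i v => congrArg (fun T : J1 →L[ℝ] ℝ => T v)
      (hasFDerivAt_pi'.1 (hasFDerivAt_of_contDiffOn hF hW hη) i).fderiv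
  -- Were all these hamiltonian fields zero at θ, dF would kill the four-dimensional contact plane,
  -- while its kernel has dimension two.
  obtain ⟨i, hi⟩ : ∃ i, hamiltonianField (fun η => F η i) θ ≠ 0 := by
    by_contra! hcon
    have h1 : contactPlane θ ≤ LinearMap.ker (fderiv ℝ F θ : J1 →ₗ[ℝ] (Fin 3 → ℝ)) := by
      intro v hv
      rw [LinearMap.mem_ker]
      ext i
      have h2 := dU_hamiltonianField_of_mem (f := fun η => F η i) hv
      rw [hcon, hcomp θ hθW] at h2
      change fderiv ℝ F θ v i = 0
      rw [← h2]
      simp [dU_apply]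
    have h2 := Submodule.finrank_mono h1
    rw [finrank_contactPlane, finrank_ker_fin_three (hFE θ hθW).1] at h2
    omega
  let f : J1 → ℝ := fun η => F η i
  have hf : ContDiffOn ℝ ∞ f W := contDiffOn_pi.1 hF i
  have hXf := contDiffOn_hamiltonianField hW hf
  have hZf := contDiffOn_fieldOf hW hf (hX.mono hWV) (hY.mono hWV)
  have hmem : ∀ η ∈ W, ∀ v, v ∈ E η ↔ fderiv ℝ F η v = 0 := fun η hη v => by
    rw [(hFE η hη).2]
    rfl
  have hfE : ∀ η ∈ W, ∀ v ∈ E η, fderiv ℝ f η v = 0 := fun η hη v hv => by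
    rw [hcomp η hη, (hmem η hη v).1 hv]
    rfl
  have hXE : ∀ η ∈ W, hamiltonianField f η ∈ E η := by
    intro η hη
    rw [hlag η (hWV hη)]
    refine ⟨hamiltonianField_mem f η, fun w hw => ?_⟩
    rw [dU_hamiltonianField_of_mem ((h.2 η (hWV hη)).1 hw), hfE η hη w hw]
  -- E contains a characteristic vector e = aX + bY ≠ 0, and df(e) = 0. This gives a Z_f = Y(f) e
  -- and b Z_f = -X(f) e, so Z_f is a multiple of e.
  have hZE : ∀ η ∈ W, fieldOf X Y f η ∈ E η := by
    intro η hη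
    have hne : E η ≠ ⊥ := fun hbot => by
      have := finrank_of_isIntegrableOn h.1 (hWV hη)
      rw [hbot, finrank_bot] at this
      omega
    obtain ⟨e, heE, heD, he0⟩ := (hpar η (hWV hη)).exists_mem_inf (hlag η (hWV hη)) hne
      (h.2 η (hWV hη)).2
    rw [hD η (hWV hη), Submodule.mem_span_pair] at heD
    obtain ⟨a, b, rfl⟩ := heD
    have hfe := hfE η hη _ heE
    rw [map_add, map_smul, map_smul, smul_eq_mul, smul_eq_mul] at hfe
    by_cases hb : b = 0
    · have ha : a ≠ 0 := by
        rintro rfl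
        exact he0 (by rw [hb]; simp)
      rw [← (E η).smul_mem_iff ha]
      convert (E η).smul_mem (fderiv ℝ f η (Y η)) heE using 1
      have h3 : a * fderiv ℝ f η (X η) = -(fderiv ℝ f η (Y η) * b) := by linear_combination hfe
      rw [fieldOf, smul_sub, smul_smul a (fderiv ℝ f η (X η)), h3]
      module
    · rw [← (E η).smul_mem_iff hb]
      convert (E η).smul_mem (-fderiv ℝ f η (X η)) heE using 1
      have h3 : b * fderiv ℝ f η (Y η) = -fderiv ℝ f η (X η) * a := by linear_combination hfe
      rw [fieldOf, smul_sub, smul_smul b, h3, smul_add, smul_smul, smul_smul, smul_smul,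
        sub_eq_add_neg, ← neg_smul]
      congr 2
      ring
  refine ⟨W ∩ {η | hamiltonianField f η ≠ 0}, hXf.continuousOn.isOpen_inter_preimage hW
    isOpen_compl_singleton, ⟨hθW, hi⟩, inter_subset_left.trans hWV, f, hf.mono inter_subset_left,
    fun η hη => hη.2, fun η hη => ?_⟩
  have hbr := (hmem η hη.1 _).2 (fderiv_lieBracket_eq_zero hW hF hZf hXf
    (fun ξ hξ => (hmem ξ hξ _).1 (hZE ξ hξ)) (fun ξ hξ => (hmem ξ hξ _).1 (hXE ξ hξ)) hη.1)
  have hZO := hZE η hη.1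
  rw [hlag η (hWV hη.1)] at hZO
  exact hZO.2 _ hbr

end Implications

end ParabolicMAE

namespace ParabolicMAE

/-! ### From a determining function to a field of low type on a smaller open set. -/

section Density

open Topology Set

variable {V : Set J1}

/-- A Cartan field that normalizes a two-dimensional Cartan distribution containing it has rank
at most three. -/
theorem lieRank_le_three {Z W : J1 → J1} (hV : IsOpen V) (hZ : ContDiffOn ℝ ∞ Z V)
    (hW : ContDiffOn ℝ ∞ W V) (hUZ : ∀ η ∈ V, contactForm η (Z η) = 0)
    (hUW : ∀ η ∈ V, contactForm η (W η) = 0)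
    (hbr : ∀ η ∈ V, VectorField.lieBracket ℝ Z W η ∈ Submodule.span ℝ {Z η, W η})
    {θ : J1} (hθ : θ ∈ V) (hli : LinearIndependent ℝ ![Z θ, W θ]) : lieRank Z θ ≤ 3 := by
  -- As [Z, W] stays in ⟨Z, W⟩, every Z^j(U) kills this plane; four independent forms on a
  -- five-dimensional space have only a line as common kernel.
  have hkill : ∀ j : ℕ, ∀ η ∈ V, lieContact Z j η (W η) = 0 := by
    intro j
    induction j with
    | zero => exact hUW
    | succ j ih =>
      intro η hη
      obtain ⟨a, b, hab⟩ := Submodule.mem_span_pair.1 (hbr η hη)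
      rw [lieContact_succ, lieDerivOne_apply_field hV (contDiffOn_lieContact hV hZ j) hW hη,
        fderiv_eq_zero_of_eqOn hV ih hη, ← hab, map_add, map_smul, map_smul, ih η hη,
        lieContact_apply_self hV hZ hUZ j η hη]
      simp
  by_contra hlt
  have h4 : lieRank Z θ ≤ 4 := by
    have h1 := finrank_range_le_card (R := ℝ) fun j : Fin 4 => lieContact Z j θ
    rwa [Fintype.card_fin] at h1
  have hind : LinearIndependent ℝ fun j : Fin 4 => lieContact Z j θ := by
    rw [linearIndependent_iff_card_eq_finrank_span, Fintype.card_fin]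
    change 4 = lieRank Z θ
    omega
  have hsurj := formTuple_surjective (α := fun j : Fin 4 => lieContact Z j) hind
  have h1 := LinearMap.finrank_range_add_finrank_ker
    (formTuple (fun j : Fin 4 => lieContact Z j) θ : J1 →ₗ[ℝ] (Fin 4 → ℝ))
  rw [LinearMap.range_eq_top.2 hsurj, finrank_top, finrank_J1, Module.finrank_fin_fun] at h1
  have h2 : Submodule.span ℝ (range ![Z θ, W θ]) ≤ LinearMap.ker
      (formTuple (fun j : Fin 4 => lieContact Z j) θ : J1 →ₗ[ℝ] (Fin 4 → ℝ)) := by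
    rw [Submodule.span_le]
    rintro _ ⟨i, rfl⟩
    fin_cases i
    · exact formTuple_eq_zero.2 fun j => lieContact_apply_self hV hZ hUZ j θ hθ
    · exact formTuple_eq_zero.2 fun j => hkill j θ hθ
  have h3 := Submodule.finrank_mono h2
  rw [finrank_span_eq_card hli, Fintype.card_fin] at h3
  omega

/-- Hamiltonian fields have rank at most two. -/
theorem lieRank_hamiltonianField_le {f : J1 → ℝ} (hV : IsOpen V) (hf : ContDiffOn ℝ ∞ f V)
    {θ : J1} (hθ : θ ∈ V) (h0 : ∀ η ∈ V, hamiltonianField f η ≠ 0) :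
    lieRank (hamiltonianField f) θ ≤ 2 := by
  have hZ := contDiffOn_hamiltonianField hV hf
  have hU : ∀ η ∈ V, contactForm η (hamiltonianField f η) = 0 := fun η _ =>
    hamiltonianField_mem f η
  have hf' : ContDiffOn ℝ ∞ (fderiv ℝ f) V := hf.fderiv_of_isOpen hV (by simp)
  -- The span of U and df is invariant under X_f, since X_f(U) = df - f_z U and X_f(df) = d(X_f(f))
  -- = 0.
  let α : Fin 2 → OneForm := ![contactForm, fderiv ℝ f]
  have hα : ∀ i, ContDiffOn ℝ ∞ (α i) V := by
    intro i
    fin_cases i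
    · exact contDiff_contactForm.contDiffOn
    · exact hf'
  have hone : ∀ η ∈ V, lieContact (hamiltonianField f) 1 η
      = fderiv ℝ f η - partialDeriv 2 f η • contactForm η := by
    intro η hη
    ext v
    rw [lieContact_one_apply hV hZ hU hη, dU_hamiltonianField]
    simp
  have hsurj : ∀ η ∈ V, Function.Surjective (formTuple α η) := by
    intro η hη
    refine formTuple_surjective ?_
    have h1 := linearIndependent_lieContact_two hV hZ hU hη (h0 η hη)
    rw [Fintype.linearIndependent_iff] at h1 ⊢
    intro c hc
    rw [Fin.sum_univ_two] at hc
    have h2 := h1 ![c 0 + c 1 * partialDeriv 2 f η, c 1] (by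
      rw [Fin.sum_univ_two]
      change (c 0 + c 1 * partialDeriv 2 f η) • contactForm η
        + c 1 • lieContact (hamiltonianField f) 1 η = 0
      rw [hone η hη]
      change c 0 • contactForm η + c 1 • fderiv ℝ f η = 0 at hc
      rw [← hc]
      module)
    have h4 : c 1 = 0 := h2 1
    have h3 : c 0 + c 1 * partialDeriv 2 f η = 0 := h2 0
    rw [h4, zero_mul, add_zero] at h3
    intro i
    fin_cases i
    · exact h3
    · exact h4
  have hkill : ∀ j : ℕ, ∀ η ∈ V, ∀ v, formTuple α η v = 0 →
      lieContact (hamiltonianField f) j η v = 0 := by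
    intro j
    induction j with
    | zero => exact fun η _ v hv => formTuple_eq_zero.1 hv 0
    | succ j ih =>
      intro η hη v hv
      rw [lieContact_succ]
      refine lieDerivOne_apply_eq_zero hV (contDiffOn_formTuple hα)
        (contDiffOn_lieContact hV hZ j) hη (hsurj η hη) ih (fun u hu => ?_) hv
      rw [lieDeriv_formTuple hV hα _ hη]
      ext i
      fin_cases i
      · change lieDerivOne _ (lieContact (hamiltonianField f) 0) η u = 0
        have hu0 : contactForm η u = 0 := formTuple_eq_zero.1 hu 0
        have hu1 : fderiv ℝ f η u = 0 := formTuple_eq_zero.1 hu 1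
        rw [← lieContact_succ, hone η hη]
        simp [hu0, hu1]
      · change lieDerivOne _ (fderiv ℝ f) η u = 0
        rw [lieDerivOne_apply, lieDeriv_fderiv hV hf hZ hη,
          fderiv_eq_zero_of_eqOn hV (fun ξ _ => fderiv_hamiltonianField f ξ) hη]
        rfl
  exact lieRank_le (hsurj θ hθ) fun v hv j => hkill j θ hθ v hv

variable {ρ : TwoForm} {X Y : J1 → J1}

/-- A determining function gives a field of type less than four somewhere. -/
theorem HasDeterminingFunction.exists_hasFieldOfTypeLTFour (hV : IsOpen V) (hne : V.Nonempty)
    (hpar : ∀ θ ∈ V, IsParabolicAt ρ θ)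
    (hD : ∀ θ ∈ V, characteristicDistribution ρ θ = Submodule.span ℝ {X θ, Y θ})
    (hX : ContDiffOn ℝ ∞ X V) (hY : ContDiffOn ℝ ∞ Y V) (h : HasDeterminingFunction X Y V) :
    ∃ N : Set J1, IsOpen N ∧ N.Nonempty ∧ N ⊆ V ∧ HasFieldOfTypeLTFour X Y N := by
  obtain ⟨f, hf, hf0, hbr⟩ := h
  have hXf := contDiffOn_hamiltonianField hV hf
  have hZf := contDiffOn_fieldOf hV hf hX hY
  by_cases hind : ∃ η ∈ V, LinearIndependent ℝ ![fieldOf X Y f η, hamiltonianField f η]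
  · obtain ⟨η₀, hη₀, hli₀⟩ := hind
    have hc : ContinuousOn (fun η => ![fieldOf X Y f η, hamiltonianField f η]) V := by
      rw [continuousOn_pi]
      intro i
      fin_cases i
      · exact hZf.continuousOn
      · exact hXf.continuousOn
    have hO : IsOpen (V ∩ {η | LinearIndependent ℝ ![fieldOf X Y f η, hamiltonianField f η]}) :=
      hc.isOpen_inter_preimage hV isOpen_setOfPred_linearIndependent
    have hZC : ∀ η ∈ V, fieldOf X Y f η ∈ contactPlane η := fun η hη =>
      (hpar η hη).characteristic_le (by rw [hD η hη]; exact fieldOf_mem_span X Y f η)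
    have hXZ : ∀ η ∈ V, dU η (fieldOf X Y f η) (hamiltonianField f η) = 0 := fun η hη => by
      rw [dU_swap, dU_hamiltonianField_of_mem (hZC η hη), fderiv_fieldOf, neg_zero]
    have hbrC : ∀ η ∈ V, VectorField.lieBracket ℝ (fieldOf X Y f) (hamiltonianField f) η
        ∈ contactPlane η := by
      intro η hη
      have h1 := lieContact_one_apply hV hZf hZC hη (hamiltonianField f η)
      have h2 : ∀ ξ ∈ V, contactForm ξ (hamiltonianField f ξ) = 0 := fun ξ _ =>
        hamiltonianField_mem f ξ
      rw [hXZ η hη, lieContact_succ, lieContact_zero, lieDerivOne_apply_field hV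
        contDiff_contactForm.contDiffOn hXf hη, fderiv_eq_zero_of_eqOn hV h2 hη] at h1
      simpa [mem_contactPlane] using h1
    -- The plane ⟨Z_f, X_f⟩ is lagrangian. The bracket is a Cartan vector because dU(Z_f, X_f) = 0,
    -- orthogonal to Z_f by hypothesis, and orthogonal to X_f because both fields annihilate f;
    -- hence it lies in the plane.
    have hbrmem : ∀ η ∈ V, LinearIndependent ℝ ![fieldOf X Y f η, hamiltonianField f η] →
        VectorField.lieBracket ℝ (fieldOf X Y f) (hamiltonianField f) η
          ∈ Submodule.span ℝ {fieldOf X Y f η, hamiltonianField f η} := by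
      intro η hη hli
      have h2 : Module.finrank ℝ
          (Submodule.span ℝ {fieldOf X Y f η, hamiltonianField f η}) = 2 := by
        have := finrank_span_eq_card hli
        rwa [Matrix.range_cons, Matrix.range_cons, Matrix.range_empty, union_empty,
          singleton_union, Fintype.card_fin] at this
      have hspan : ∀ u, dU η u (fieldOf X Y f η) = 0 → dU η u (hamiltonianField f η) = 0 →
          ∀ w ∈ Submodule.span ℝ {fieldOf X Y f η, hamiltonianField f η}, dU η u w = 0 := by
        intro u h3 h4 w hw
        obtain ⟨a, b, rfl⟩ := Submodule.mem_span_pair.1 hw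
        rw [← dUForm_apply, map_add, map_smul, map_smul, dUForm_apply, dUForm_apply, h3, h4]
        simp
      rw [eq_orthogonal_of_isotropic ?_ h2 ?_]
      · refine ⟨hbrC η hη, hspan _ ?_ ?_⟩
        · rw [dU_swap, hbr η hη, neg_zero]
        · rw [dU_swap, dU_hamiltonianField_of_mem (hbrC η hη), fderiv_lieBracket_eq_zero hV hf hZf
            hXf (fun ξ _ => fderiv_fieldOf X Y f ξ) (fun ξ _ => fderiv_hamiltonianField f ξ) hη,
            neg_zero]
      · rw [Submodule.span_le]
        rintro _ (rfl | rfl)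
        · exact hZC η hη
        · exact hamiltonianField_mem f η
      · intro v hv
        refine hspan v ?_ ?_
        · rw [dU_swap, hspan _ (dU_self _ _) (hXZ η hη) v hv, neg_zero]
        · rw [dU_swap, hspan _ (by rw [dU_swap, hXZ η hη, neg_zero]) (dU_self _ _) v hv, neg_zero]
    obtain ⟨N, hN, hNne, hNO, k, hk, htype⟩ := exists_hasTypeOn hO ⟨η₀, hη₀, hli₀⟩
      (hZf.mono inter_subset_left) fun θ hθ => lieRank_le_three hO (hZf.mono inter_subset_left)
        (hXf.mono inter_subset_left) (fun η hη => hZC η hη.1)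
        (fun η _ => hamiltonianField_mem f η) (fun η hη => hbrmem η hη.1 hη.2) hθ hθ.2
    exact ⟨N, hN, hNne, hNO.trans inter_subset_left, _,
      ⟨hZf.mono (hNO.trans inter_subset_left), fun θ hθ =>
        ⟨(hNO hθ).2.ne_zero 0, fieldOf_mem_span X Y f θ⟩⟩, k, hk, htype⟩
  · push Not at hind
    -- Where Z_f = 0, df vanishes on 𝒟, so X_f lies in 𝒟^⊥ = 𝒟. Elsewhere dependence makes X_f a
    -- multiple of the characteristic field Z_f.
    have hmem : ∀ η ∈ V, hamiltonianField f η ∈ Submodule.span ℝ {X η, Y η} := by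
      intro η hη
      by_cases hz : fieldOf X Y f η = 0
      · have hXY := LinearIndependent.pair_iff.1 ((hpar η hη).linearIndependent (hD η hη))
          (fderiv ℝ f η (Y η)) (-fderiv ℝ f η (X η)) (by rw [neg_smul, ← sub_eq_add_neg]; exact hz)
        rw [← hD η hη, ← (hpar η hη).eq_orthogonal (hD η hη)]
        refine ⟨hamiltonianField_mem f η, fun w hw => ?_⟩
        rw [dU_hamiltonianField_of_mem ((hpar η hη).characteristic_le hw)]
        rw [hD η hη] at hw
        obtain ⟨a, b, rfl⟩ := Submodule.mem_span_pair.1 hw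
        rw [map_add, map_smul, map_smul, hXY.1, neg_eq_zero.1 hXY.2]
        simp
      · have h1 := hind η hη
        rw [LinearIndependent.pair_iff' hz] at h1
        push Not at h1
        obtain ⟨a, ha⟩ := h1
        rw [← ha]
        exact Submodule.smul_mem _ _ (fieldOf_mem_span X Y f η)
    obtain ⟨N, hN, hNne, hNV, k, hk, htype⟩ := exists_hasTypeOn hV hne hXf fun θ hθ =>
      (lieRank_hamiltonianField_le hV hf hθ hf0).trans (by norm_num)
    exact ⟨N, hN, hNne, hNV, _,
      ⟨hXf.mono hNV, fun θ hθ => ⟨hf0 θ (hNV hθ), hmem θ (hNV hθ)⟩⟩, k, hk, htype⟩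

end Density

/-! ### Local properties and the assembly of the theorem. -/

section Near

open Set

theorem Near.map {Ω : Set J1} {θ : J1} {P Q : Set J1 → Prop} (h : Near Ω θ P)
    (hPQ : ∀ V, IsOpen V → θ ∈ V → V ⊆ Ω → P V →
      ∃ N, IsOpen N ∧ θ ∈ N ∧ N ⊆ V ∧ Q N) : Near Ω θ Q := by
  obtain ⟨V, hV, hθ, hVΩ, hP⟩ := h
  obtain ⟨N, hN, hθN, hNV, hQ⟩ := hPQ V hV hθ hVΩ hP
  exact ⟨N, hN, hθN, hNV.trans hVΩ, hQ⟩

theorem isOpen_setOf_near (Ω : Set J1) (P : Set J1 → Prop) : IsOpen {θ | Near Ω θ P} := by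
  rw [isOpen_iff_forall_mem_open]
  rintro θ ⟨V, hV, hθ, hVΩ, hP⟩
  exact ⟨V, fun η hη => ⟨V, hV, hη, hVΩ, hP⟩, hV, hθ⟩

theorem Near.mem {Ω : Set J1} {θ : J1} {P : Set J1 → Prop} (h : Near Ω θ P) : θ ∈ Ω := by
  obtain ⟨V, -, hθ, hVΩ, -⟩ := h
  exact hVΩ hθ

end Near

end ParabolicMAE

theorem mainTheorem5 (Ω : Set ParabolicMAE.J1) (hΩ : IsOpen Ω)
    (ρ : ParabolicMAE.TwoForm) (hρ : ContDiffOn ℝ ∞ ρ Ω)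
    (hpar : ∀ θ ∈ Ω, ParabolicMAE.IsParabolicAt ρ θ)
    (X Y : ParabolicMAE.J1 → ParabolicMAE.J1)
    (hX : ContDiffOn ℝ ∞ X Ω) (hY : ContDiffOn ℝ ∞ Y Ω)
    (hD : ∀ θ ∈ Ω, ParabolicMAE.characteristicDistribution ρ θ = Submodule.span ℝ {X θ, Y θ}) :
    (∃ Ω' : Set ParabolicMAE.J1, IsOpen Ω' ∧ Ω' ⊆ Ω ∧ Ω ⊆ closure Ω' ∧
      ∀ θ₀ ∈ Ω', List.TFAE
        [ParabolicMAE.Near Ω θ₀ (ParabolicMAE.HasCompleteIntegral ρ),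
         ParabolicMAE.Near Ω θ₀ (ParabolicMAE.HasGeneralizedIntermediateIntegral ρ),
         ParabolicMAE.Near Ω θ₀ (ParabolicMAE.HasFieldOfTypeLTFour X Y),
         ParabolicMAE.Near Ω θ₀ (ParabolicMAE.HasFieldInIntegrableLagrangian X Y),
         ParabolicMAE.Near Ω θ₀ (ParabolicMAE.HasIntegrableSection ρ),
         ParabolicMAE.Near Ω θ₀ (ParabolicMAE.HasDeterminingFunction X Y)]) ∧
    (∀ θ₀ ∈ Ω,
      (ParabolicMAE.Near Ω θ₀ (ParabolicMAE.HasGeneralizedIntermediateIntegral ρ) ↔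
        ParabolicMAE.Near Ω θ₀ (ParabolicMAE.HasFieldOfTypeLTFour X Y)) ∧
      (ParabolicMAE.Near Ω θ₀ (ParabolicMAE.HasFieldOfTypeLTFour X Y) →
        ParabolicMAE.Near Ω θ₀ (ParabolicMAE.HasFieldInIntegrableLagrangian X Y)) ∧
      (ParabolicMAE.Near Ω θ₀ (ParabolicMAE.HasFieldInIntegrableLagrangian X Y) →
        ParabolicMAE.Near Ω θ₀ (ParabolicMAE.HasCompleteIntegral ρ)) ∧
      (ParabolicMAE.Near Ω θ₀ (ParabolicMAE.HasCompleteIntegral ρ) ↔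
        ParabolicMAE.Near Ω θ₀ (ParabolicMAE.HasIntegrableSection ρ)) ∧
      (ParabolicMAE.Near Ω θ₀ (ParabolicMAE.HasCompleteIntegral ρ) →
        ParabolicMAE.Near Ω θ₀ (ParabolicMAE.HasDeterminingFunction X Y))) := by
  open ParabolicMAE Set in
  have h23 : ∀ θ, Near Ω θ (HasGeneralizedIntermediateIntegral ρ) ↔
      Near Ω θ (HasFieldOfTypeLTFour X Y) := by
    refine fun θ => ⟨fun h => h.map ?_, fun h => h.map ?_⟩
    · rintro V hV hθ hVΩ ⟨Z, ⟨hZ, hZD⟩, hk⟩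
      exact ⟨V, hV, hθ, Subset.rfl, Z, ⟨hZ, fun η hη =>
        ⟨(hZD η hη).1, (hD η (hVΩ hη)).le (hZD η hη).2⟩⟩, hk⟩
    · rintro V hV hθ hVΩ ⟨Z, ⟨hZ, hZD⟩, hk⟩
      exact ⟨V, hV, hθ, Subset.rfl, Z, ⟨hZ, fun η hη =>
        ⟨(hZD η hη).1, (hD η (hVΩ hη)).ge (hZD η hη).2⟩⟩, hk⟩
  have h34 : ∀ θ, Near Ω θ (HasFieldOfTypeLTFour X Y) →
      Near Ω θ (HasFieldInIntegrableLagrangian X Y) := fun θ h => h.map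
    fun V hV hθ hVΩ hP => hP.exists_hasFieldInIntegrableLagrangian hV
      (fun η hη => hpar η (hVΩ hη)) (fun η hη => hD η (hVΩ hη)) hθ
  have h41 : ∀ θ, Near Ω θ (HasFieldInIntegrableLagrangian X Y) →
      Near Ω θ (HasCompleteIntegral ρ) := fun θ h => h.map
    fun V hV hθ hVΩ hP => ⟨V, hV, hθ, Subset.rfl, hP.hasCompleteIntegral
      (fun η hη => hpar η (hVΩ hη)) (fun η hη => hD η (hVΩ hη))⟩
  have h15 : ∀ θ, Near Ω θ (HasCompleteIntegral ρ) ↔ Near Ω θ (HasIntegrableSection ρ) :=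
    fun θ => ⟨fun h => h.map fun V hV hθ hVΩ ⟨_, hE⟩ => hE.exists_section hθ,
      fun h => h.map fun V hV hθ hVΩ hP => ⟨V, hV, hθ, Subset.rfl, hP.hasCompleteIntegral⟩⟩
  have h16 : ∀ θ, Near Ω θ (HasCompleteIntegral ρ) → Near Ω θ (HasDeterminingFunction X Y) :=
    fun θ h => h.map fun V hV hθ hVΩ ⟨_, hE⟩ => hE.exists_determiningFunction
      (fun η hη => hpar η (hVΩ hη)) (fun η hη => hD η (hVΩ hη)) (hX.mono hVΩ) (hY.mono hVΩ) hθ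
  refine ⟨?_, fun θ _ => ⟨h23 θ, h34 θ, h41 θ, h15 θ, h16 θ⟩⟩
  -- On the first set the strongest property holds, so all six do; on the second the weakest one
  -- fails, so all six fail.
  refine ⟨{θ | Near Ω θ (HasFieldOfTypeLTFour X Y)} ∪
    (Ω \ closure {θ | Near Ω θ (HasDeterminingFunction X Y)}),
    (isOpen_setOf_near _ _).union (hΩ.sdiff isClosed_closure), ?_, ?_, ?_⟩
  · rintro θ (h | h)
    · exact Near.mem h
    · exact h.1
  -- A determining function restricts to every smaller neighbourhood, each of which then contains
  -- points having a field of low type.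
  · have hdense : {θ | Near Ω θ (HasDeterminingFunction X Y)}
        ⊆ closure {θ | Near Ω θ (HasFieldOfTypeLTFour X Y)} := by
      rintro θ ⟨V, hV, hθ, hVΩ, f, hf, hf0, hbr⟩
      rw [mem_closure_iff]
      intro O hO hθO
      have hVO : V ∩ O ⊆ V := inter_subset_left
      have hP : HasDeterminingFunction X Y (V ∩ O) :=
        ⟨f, hf.mono hVO, fun η hη => hf0 η hη.1, fun η hη => hbr η hη.1⟩
      obtain ⟨N, hN, ⟨η, hη⟩, hNV, hQ⟩ := hP.exists_hasFieldOfTypeLTFour (hV.inter hO)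
        ⟨θ, hθ, hθO⟩ (fun η hη => hpar η (hVΩ hη.1)) (fun η hη => hD η (hVΩ hη.1))
        (hX.mono (hVO.trans hVΩ)) (hY.mono (hVO.trans hVΩ))
      exact ⟨η, (hNV hη).2, N, hN, hη, (hNV.trans hVO).trans hVΩ, hQ⟩
    intro θ hθ
    rw [closure_union]
    by_cases hcl : θ ∈ closure {θ | Near Ω θ (HasDeterminingFunction X Y)}
    · exact Or.inl (closure_minimal hdense isClosed_closure hcl)
    · exact Or.inr (subset_closure ⟨hθ, hcl⟩)
  · rintro θ (h | ⟨-, h⟩)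
    · have h3 : Near Ω θ (HasFieldOfTypeLTFour X Y) := h
      have h1 := h41 θ (h34 θ h3)
      refine List.tfae_of_forall True _ ?_
      simp [h1, (h23 θ).2 h3, h3, h34 θ h3, (h15 θ).1 h1, h16 θ h1]
    · have h6 : ¬ Near Ω θ (HasDeterminingFunction X Y) := fun h6 => h (subset_closure h6)
      have h1 : ¬ Near Ω θ (HasCompleteIntegral ρ) := fun h1 => h6 (h16 θ h1)
      have h4 : ¬ Near Ω θ (HasFieldInIntegrableLagrangian X Y) := fun h4 => h1 (h41 θ h4)
      have h3 : ¬ Near Ω θ (HasFieldOfTypeLTFour X Y) := fun h3 => h4 (h34 θ h3)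
      refine List.tfae_of_forall False _ ?_
      simp [h1, h3, h4, h6, mt (h23 θ).1 h3, mt (h15 θ).2 h1]
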